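/- **Setting.** Let $d\in\mathbb N$, $m>0$, and let $V,\Phi\in C^3(\mathbb R^d;\mathbb R)$ with $\Phi$ even. Points of $\mathbb R^{2d}$ are written $y=(q,p)$, and $\rho_m(dp)=(2\pi m)^{-d/2}e^{-|p|^2/2m}dp$. *Generator and test functions.* $\mathcal G\subseteq C_b(\mathbb R^d)\times C_b(\mathbb R^d)$ is a linear operator on functions of $p$ that is a Markov generator: $\mathcal G1=0$, and $\mathcal Gu(p)\le 0$ whenever $u\in D(\mathcal G)$ is maximal at $p$. Its domain $D(\mathcal G)$ is a linear space stable under $(u_1,\dots,u_l)\mapsto\psi(u_1,\dots,u_l)$, $\psi\in C^2(\mathbb R^l)$. It acts on functions on $\mathbb R^{2d}$ through $p$ only: $(\mathcal Gf)(q,p)=(\mathcal Gf(q,\cdot))(p)$. $\mathcal T\subseteq C^2(\mathbb R^{2d})$ is a linear space of test functions containing $C^2_c(\mathbb R^{2d})$ and all $C^2$ functions of $q$ alone, such that for $f\in\mathcal T$: $f(q,\cdot)\in D(\mathcal G)$ for all $q$, $\nabla_pf$ is bounded, and $\mathcal Gf,\ e^{-f}\mathcal Ge^{f}\in C_b(\mathbb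 R^{2d})$. A cylinder function is $F(\rho)=\varphi(\langle f_1,\rho\rangle,\dots,\langle f_l,\rho\rangle)$ with $f_j\in\mathcal T$, $\varphi\in C^2(\mathbb R^l)$; its derivative is $dF(\rho)=\sum_j\partial_j\varphi(\langle f_1,\rho\rangle,\dots,\langle f_l,\rho\rangle)f_j$. With $\eta_n(y_1,\dots,y_n)=\frac1n\sum_i\delta_{y_i}$, let $\mathcal G_n$ be the sum over $i$ of $\mathcal G$ acting on the $i$-th particle, and $H_nF(\eta_n(y))=\frac1n e^{-nF(\eta_n(y))}\,\mathcal G_n(e^{nF\circ\eta_n})(y)$. **Condition.** (a) $\mathcal G$ acts on the momentum only, independently of $q$ (as above). (b) $\mathcal G$ is reversible with respect to $\rho_m$: $\int u\,\mathcal Gw\,d\rho_m=\int w\,\mathcal Gu\,d\rho_m$ for $u,w\in D(\mathcal G)$. (c) There is $\mathcal H_2$ such that for every cylinder function $F$ and every probability measure $\rho$ with $f_1,\dots,f_l\in L^1(\rho)$, $\lim_n H_nF(\eta_n(y^n))=\mathcal H_2(\rho,dF(\rho))$ for all $y^n\in(\mathbb R^{2d})^n$ such that $\eta_n(y^n)\to\rho$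 weakly and $\langle f_j,\eta_n(y^n)\rangle\to\langle f_j,\rho\rangle$ for all $j$. **Functionals and states.** Put $(\Phi*\rho)(q)=\int\Phi(q-q')\rho(dq',dp')$, $E(\rho)=\int\big(\frac{|p|^2}{2m}+V+\frac12\Phi*\rho\big)d\rho$, $S(\rho)=\int\log\rho\,d\rho+E(\rho)$, with functional derivatives $dE(\rho)=\frac{|p|^2}{2m}+V+\Phi*\rho$ and $dS(\rho)=\log\rho+1+dE(\rho)$. The cotangent space is $T^*_\rho=\{\xi\in\mathcal T:\ \xi\in L^1(\rho),\ (1+|p|)|\nabla_q\xi|\in L^1(\rho)\}$ and the tangent space $T_\rho$ is the space of linear functionals on $T^*_\rho$. The state space $Z\subseteq\mathcal P(\mathbb R^{2d})$ consists of the probability measures $\rho$ with a positive $C^2$ density, also denoted $\rho$, such that $|p|^2,V,|\nabla V|\in L^1(\rho)$, $\Phi(q-q'),|\nabla\Phi(q-q')|\in L^1(\rho\otimes\rho)$, for each $R$ there is $w$ with $(1+|p|)w(q)\in L^1(\rho)$ and $|D^k\Phi(q-q')|\le w(q)$ for $k\le 3$, $|q'|\le R$, and $dS(\rho)\in T^*_\rho$.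 For $\rho\in Z$ let $L(\rho)\xi=\operatorname{div}(\rho J\nabla\xi)$ with $J=\begin{pmatrix}0&-1\\1&0\end{pmatrix}$ (weakly), $\langle\mathcal G^*(\rho),\xi\rangle=\int\mathcal G\xi\,d\rho$, and $$\Psi^*(\rho,\xi)=\mathcal H_2\big(\rho,\xi+\tfrac12dS(\rho)\big)-\mathcal H_2\big(\rho,\tfrac12dS(\rho)\big),\qquad \mathbf F(\rho)=-\operatorname{div}_q\!\Big(\rho\frac pm\Big)+\operatorname{div}_p\big(\rho\nabla_qV+\rho(\nabla_q\Phi*\rho)\big)+\mathcal G^*(\rho).$$ *Calculus on $\widehat Z=Z\times\mathbb R$.* $(\xi,r)\in T^*_\rho\times\mathbb R$ is a differential of $U:\widehat Z\to\mathbb R$ at $(\rho,e)$ if for all $s\in\mathbb R$ and $\sigma\in C_c^\infty(\mathbb R^{2d})$ with $\int\sigma=0$, $\rho+t\sigma\in Z$ for small $t$ and $\frac{d}{dt}\big|_{t=0}U(\rho+t\sigma,e+ts)=\int\xi\sigma+rs$ (so $\xi$ is determined up to an additive constant, which plays no role below). $U$ is $C^1$ if it has differentials everywhere and, for all such $\sigma,\tau,s,b$,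 their pairing with $(\tau,b)$ at $(\rho+t\sigma,e+ts)$ is continuous in $t$ at $0$. Smooth functions are $U(\rho,e)=\varphi(\langle f_1,\rho\rangle,\dots,\langle f_l,\rho\rangle,e)$ with $f_j\in C_c^\infty(\mathbb R^{2d})$, $\varphi\in C^\infty(\mathbb R^{l+1})$. *GENERIC.* A vector field $\widehat{\mathbf F}$ on $\widehat Z$ is GENERIC for $C^1$ functionals $\widehat S,\widehat E$, potentials $(\widehat\Psi,\widehat\Psi^*)$ and linear operators $\widehat L(z):T^*_z\widehat Z\to T_z\widehat Z$ if 1. $\widehat\Psi,\widehat\Psi^*$ take values in $[0,\infty]$, are convex, even, zero at $0$, and Legendre duals of each other, and $\widehat\Psi^*$ is $C^1$ along lines; 2. $\widehat L$ is anti-symmetric, and for smooth functions the bracket $\{F,G\}=\langle dF,\widehat L\,dG\rangle$ is differentiable and satisfies the Jacobi identity $\{\{F_1,F_2\},F_3\}+\{\{F_3,F_1\},F_2\}+\{\{F_2,F_3\},F_1\}=0$; 3. $\widehat L\,d\widehat S=0$ and $\widehat\Psi^*(z,\zeta+\alpha\,d\widehat E(z))=\widehat\Psi^*(z,\zeta)$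 for all $z\in\widehat Z$, $\zeta\in T^*_z\widehat Z$, $\alpha\in\mathbb R$; 4. $\widehat\Psi\big(z,\widehat{\mathbf F}-\widehat L\,d\widehat E\big)+\widehat\Psi^*\big(z,-\tfrac12d\widehat S\big)+\tfrac12\langle\widehat{\mathbf F},d\widehat S\rangle=0$ for all $z$. **Corollary.** Assume the Condition. Then $dE(\rho)$ and $dS(\rho)$ above are the functional derivatives of $E$ and $S$ at every $\rho\in Z$, and the dynamics $\widehat{\mathbf F}(\rho,e)=(\mathbf F(\rho),0)$ on $Z\times\mathbb R$ (with tangent spaces $T_\rho\times\mathbb R$ and cotangent spaces $T^*_\rho\times\mathbb R$) is GENERIC for $$\widehat S(\rho,e)=S(\rho),\qquad \widehat E(\rho,e)=e,\qquad \widehat\Psi^*((\rho,e),(\xi,r))=\Psi^*(\rho,\xi),\qquad \widehat L(\rho,e)\begin{pmatrix}\xi\\ r\end{pmatrix}=\begin{pmatrix}r\,L(\rho)dE(\rho)\\-\langle L(\rho)dE(\rho),\xi\rangle\end{pmatrix},$$ and $\widehat\Psi$ the Legendre transform of $\widehat\Psi^*$. -/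

import Mathlib

open MeasureTheory Filter Topology Set
open scoped ContDiff

noncomputable section

/-! ## GENERIC systems -/

/-- The differential-geometric data needed to speak of GENERIC systems on a (possibly
infinite-dimensional, formal) manifold: points, cotangent and tangent spaces in duality, the
relation `HasDiff U z ξ` (the covector `ξ` is a differential of `U` at `z`), the `C¹` functions,
and the class of "smooth" functions to which the Poisson bracket is applied. -/
structure Geometry where
  Pt : Type
  Cot : Pt → Type
  Tan : Pt → Type
  [cotGroup : ∀ z, AddCommGroup (Cot z)]
  [cotModule : ∀ z, Module ℝ (Cot z)]
  [tanGroup : ∀ z, AddCommGroup (Tan z)]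
  [tanModule : ∀ z, Module ℝ (Tan z)]
  pair : ∀ z, Tan z →ₗ[ℝ] Cot z →ₗ[ℝ] ℝ
  HasDiff : (Pt → ℝ) → ∀ z, Cot z → Prop
  IsC1 : (Pt → ℝ) → Prop
  IsSmooth : (Pt → ℝ) → Prop

attribute [instance] Geometry.cotGroup Geometry.cotModule Geometry.tanGroup Geometry.tanModule

namespace Geometry

variable (M : Geometry)

/-- `U` has a differential at every point. -/
def Diffable (U : M.Pt → ℝ) : Prop := ∀ z, ∃ ξ, M.HasDiff U z ξ

open Classical in
/-- The differential `dU(z)` (with value `0` where there is none). -/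
def d (U : M.Pt → ℝ) (z : M.Pt) : M.Cot z :=
  if h : ∃ ξ, M.HasDiff U z ξ then h.choose else 0

/-- The bracket `{F, G} = ⟨dF, L dG⟩`. -/
def bracket (L : ∀ z, M.Cot z →ₗ[ℝ] M.Tan z) (F G : M.Pt → ℝ) (z : M.Pt) : ℝ :=
  M.pair z (L z (M.d G z)) (M.d F z)

/-- The Legendre transform `Ψ(z, v) = sup_ξ (⟨v, ξ⟩ - Ψ*(z, ξ))` of `Ψ*`. -/
def legendre (Ψs : ∀ z, M.Cot z → EReal) (z : M.Pt) (v : M.Tan z) : EReal :=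
  ⨆ ξ : M.Cot z, ((M.pair z v ξ : ℝ) : EReal) - Ψs z ξ

/-- The Legendre transform `Ψ*(z, ξ) = sup_v (⟨v, ξ⟩ - Ψ(z, v))` of `Ψ`. -/
def legendreDual (Ψ : ∀ z, M.Tan z → EReal) (z : M.Pt) (ξ : M.Cot z) : EReal :=
  ⨆ v : M.Tan z, ((M.pair z v ξ : ℝ) : EReal) - Ψ z v

/-- Symmetric dissipation potentials `Ψ : TZ → [0, ∞]`, `Ψ* : T*Z → [0, ∞]`: convex Legendre
duals of each other, vanishing at zero and even, with `Ψ*` continuously differentiable along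
lines.  Strict convexity is not asked for: it is incompatible with the degeneracy
`Ψ*(z, ξ + α dE) = Ψ*(z, ξ)` of GENERIC as soon as `dE ≠ 0`, and by that same degeneracy `Ψ`
takes the value `∞`. -/
structure SymmetricDissipationPotentials
    (Ψ : ∀ z, M.Tan z → EReal) (Ψs : ∀ z, M.Cot z → EReal) : Prop where
  nonneg : ∀ z v, 0 ≤ Ψ z v
  nonneg_dual : ∀ z ξ, 0 ≤ Ψs z ξ
  legendre : ∀ z v, Ψ z v = M.legendre Ψs z v
  legendre_dual : ∀ z ξ, Ψs z ξ = M.legendreDual Ψ z ξ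
  convex : ∀ z v w, ∀ a b : ℝ, 0 ≤ a → 0 ≤ b → a + b = 1 →
    Ψ z (a • v + b • w) ≤ (a : EReal) * Ψ z v + (b : EReal) * Ψ z w
  convex_dual : ∀ z ξ η, ∀ a b : ℝ, 0 ≤ a → 0 ≤ b → a + b = 1 →
    Ψs z (a • ξ + b • η) ≤ (a : EReal) * Ψs z ξ + (b : EReal) * Ψs z η
  contDiff_dual : ∀ z ξ η, ∃ g : ℝ → ℝ, ContDiff ℝ 1 g ∧
    ∀ t : ℝ, Ψs z (ξ + t • η) = ((g t : ℝ) : EReal)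
  zero : ∀ z, Ψ z 0 = 0
  zero_dual : ∀ z, Ψs z 0 = 0
  symm : ∀ z v, Ψ z (-v) = Ψ z v
  symm_dual : ∀ z ξ, Ψs z (-ξ) = Ψs z ξ

/-- The family `L` is a Poisson operator: it is anti-symmetric, and the bracket `⟨dF, L dG⟩` of
smooth functions is differentiable and satisfies the Jacobi identity. -/
structure IsPoisson (L : ∀ z, M.Cot z →ₗ[ℝ] M.Tan z) : Prop where
  antisymm : ∀ z ξ η, M.pair z (L z ξ) η = - M.pair z (L z η) ξ
  diffable : ∀ F, M.IsSmooth F → M.Diffable F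
  diffable_bracket : ∀ F G, M.IsSmooth F → M.IsSmooth G → M.Diffable (M.bracket L F G)
  jacobi : ∀ F₁ F₂ F₃, M.IsSmooth F₁ → M.IsSmooth F₂ → M.IsSmooth F₃ → ∀ z,
    M.bracket L (M.bracket L F₁ F₂) F₃ z + M.bracket L (M.bracket L F₃ F₁) F₂ z
      + M.bracket L (M.bracket L F₂ F₃) F₁ z = 0

/-- The evolution `ż = F(z)` is GENERIC for the entropy `S`, the energy `E`, the dissipation
potentials `(Ψ, Ψ*)` and the operators `L`. -/
structure IsGENERIC (S E : M.Pt → ℝ) (Ψ : ∀ z, M.Tan z → EReal) (Ψs : ∀ z, M.Cot z → EReal)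
    (L : ∀ z, M.Cot z →ₗ[ℝ] M.Tan z) (F : ∀ z, M.Tan z) : Prop where
  entropy_C1 : M.IsC1 S
  energy_C1 : M.IsC1 E
  potentials : M.SymmetricDissipationPotentials Ψ Ψs
  poisson : M.IsPoisson L
  degeneracy_entropy : ∀ z, L z (M.d S z) = 0
  degeneracy_energy : ∀ z ξ, ∀ α : ℝ, Ψs z (ξ + α • M.d E z) = Ψs z ξ
  equation : ∀ z, Ψ z (F z - L z (M.d E z)) + Ψs z (-((1 / 2 : ℝ) • M.d S z))
    + (((1 / 2 : ℝ) * M.pair z (F z) (M.d S z) : ℝ) : EReal) = 0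

end Geometry

/-! ## Phase space, the momentum generator and the test functions -/

namespace Underdamped

/-- Position space and momentum space `ℝ^d`. -/
abbrev Conf (d : ℕ) : Type := EuclideanSpace ℝ (Fin d)

/-- Phase space `ℝ^{2d}`, the space of pairs `(q, p)`. -/
abbrev Phase (d : ℕ) : Type := Conf d × Conf d

variable {d : ℕ}

/-- `∇_q ξ`. -/
def gradQ (ξ : Phase d → ℝ) (y : Phase d) : Conf d := gradient (fun q => ξ (q, y.2)) y.1

/-- `∇_p ξ`. -/
def gradP (ξ : Phase d → ℝ) (y : Phase d) : Conf d := gradient (fun p => ξ (y.1, p)) y.2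

/-- The density of the centred Gaussian measure `ρ_m(dp)` with variance `m`. -/
def maxwellian (m : ℝ) (p : Conf d) : ℝ :=
  (√(2 * Real.pi * m))⁻¹ ^ d * Real.exp (-(‖p‖ ^ 2 / (2 * m)))

/-- Continuous and bounded. -/
def IsCb {A : Type*} [TopologicalSpace A] (f : A → ℝ) : Prop :=
  Continuous f ∧ ∃ C : ℝ, ∀ x, |f x| ≤ C

/-- A (conservative) Markov generator `𝒢 ⊆ C_b(ℝ^d) × C_b(ℝ^d)` on momentum space, given on a
domain `dom` that is stable under composition with `C²` functions.  Only the values of `op` on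
`dom` matter. -/
structure MomentumGenerator (d : ℕ) where
  dom : Submodule ℝ (Conf d → ℝ)
  op : (Conf d → ℝ) →ₗ[ℝ] (Conf d → ℝ)
  isCb_dom : ∀ u ∈ dom, IsCb u
  isCb_op : ∀ u ∈ dom, IsCb (op u)
  comp_mem : ∀ (l : ℕ) (u : Fin l → Conf d → ℝ), (∀ j, u j ∈ dom) →
    ∀ ψ : (Fin l → ℝ) → ℝ, ContDiff ℝ 2 ψ → (fun p => ψ fun j => u j p) ∈ dom
  op_one : op (fun _ => 1) = 0
  max_principle : ∀ u ∈ dom, ∀ p, (∀ p', u p' ≤ u p) → op u p ≤ 0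

namespace MomentumGenerator

variable (G : MomentumGenerator d)

/-- `𝒢` acting on functions of `(q, p)`: it acts on the momentum variable only, in the same way
for every `q`. -/
def lift (f : Phase d → ℝ) (y : Phase d) : ℝ := G.op (fun p => f (y.1, p)) y.2

/-- `𝒢` is reversible with respect to `ρ_m`. -/
def Reversible (m : ℝ) : Prop := ∀ u ∈ G.dom, ∀ w ∈ G.dom,
  ∫ p, u p * G.op w p * maxwellian m p = ∫ p, w p * G.op u p * maxwellian m p

/-- The empirical measure `η_n(y_1, …, y_n)`. -/
def empirical {n : ℕ} (y : Fin n → Phase d) : Measure (Phase d) :=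
  (n : ENNReal)⁻¹ • ∑ i, Measure.dirac (y i)

/-- The `n`-particle generator: the sum over `i` of `𝒢` acting on the `i`-th particle. -/
def particles (n : ℕ) (u : (Fin n → Phase d) → ℝ) (y : Fin n → Phase d) : ℝ :=
  ∑ i, G.lift (fun x => u (Function.update y i x)) (y i)

/-- `H_n F = n⁻¹ e^{-nF} G_n e^{nF}` at the empirical measure of `y_1, …, y_n`, where
`G_n F (η_n(y)) = 𝒢_n (F ∘ η_n) (y)`. -/
def hamiltonian (n : ℕ) (F : Measure (Phase d) → ℝ) (y : Fin n → Phase d) : ℝ :=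
  (n : ℝ)⁻¹ * Real.exp (-(n * F (empirical y)))
    * G.particles n (fun x => Real.exp (n * F (empirical x))) y

/-- A linear space of `C²` test functions on phase space, adapted to `𝒢`. It contains all
compactly supported `C²` functions and all `C²` functions of the position alone (on which
`𝒢` vanishes); `𝒢 f` and `e^{-f} 𝒢 e^f` are in `C_b` for every test function `f`. -/
structure TestSpace where
  space : Submodule ℝ (Phase d → ℝ)
  contDiff : ∀ f ∈ space, ContDiff ℝ 2 f
  slice_mem : ∀ f ∈ space, ∀ q, (fun p => f (q, p)) ∈ G.dom
  gradP_bdd : ∀ f ∈ space, ∃ C : ℝ, ∀ y, ‖gradP f y‖ ≤ C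
  isCb_lift : ∀ f ∈ space, IsCb (G.lift f)
  isCb_exp : ∀ f ∈ space, IsCb fun y => Real.exp (-f y) * G.lift (fun x => Real.exp (f x)) y
  compact_mem : ∀ f : Phase d → ℝ, ContDiff ℝ 2 f → HasCompactSupport f → f ∈ space
  position_mem : ∀ a : Conf d → ℝ, ContDiff ℝ 2 a → (fun y : Phase d => a y.1) ∈ space

/-- The cylinder function `F(ρ) = φ(⟨f_1, ρ⟩, …, ⟨f_l, ρ⟩)`. -/
def cylinder {l : ℕ} (φ : (Fin l → ℝ) → ℝ) (f : Fin l → Phase d → ℝ) (μ : Measure (Phase d)) : ℝ :=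
  φ fun j => ∫ y, f j y ∂μ

/-- Its functional derivative `dF(ρ) = ∑_j ∂_j φ(⟨f_1, ρ⟩, …, ⟨f_l, ρ⟩) f_j`. -/
def dCylinder {l : ℕ} (φ : (Fin l → ℝ) → ℝ) (f : Fin l → Phase d → ℝ) (μ : Measure (Phase d))
    (y : Phase d) : ℝ :=
  fderiv ℝ φ (fun j => ∫ x, f j x ∂μ) fun j => f j y

/-- `lim_n H_n F (ρ)` exists for cylinder functions `F` and equals `ℋ₂(ρ, dF(ρ))`. As `H_n F` lives
on `n`-particle empirical measures, this means convergence along all sequences of empirical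
measures that converge weakly to `ρ`, and also when tested against the functions `f_j` defining
`F` (which is automatic if these are bounded). -/
def HasLimitHamiltonian (T : G.TestSpace) (H₂ : Measure (Phase d) → (Phase d → ℝ) → ℝ) : Prop :=
  ∀ (l : ℕ) (φ : (Fin l → ℝ) → ℝ) (f : Fin l → Phase d → ℝ), ContDiff ℝ 2 φ →
    (∀ j, f j ∈ T.space) →
    ∀ μ : Measure (Phase d), IsProbabilityMeasure μ → (∀ j, Integrable (f j) μ) →
    ∀ y : ∀ n : ℕ, Fin n → Phase d,
      (∀ g : BoundedContinuousFunction (Phase d) ℝ,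
        Tendsto (fun n => ∫ x, g x ∂(empirical (y n))) atTop (𝓝 (∫ x, g x ∂μ))) →
      (∀ j, Tendsto (fun n => ∫ x, f j x ∂(empirical (y n))) atTop (𝓝 (∫ x, f j x ∂μ))) →
      Tendsto (fun n => G.hamiltonian n (cylinder φ f) (y n)) atTop (𝓝 (H₂ μ (dCylinder φ f μ)))

end MomentumGenerator

/-! ## The macroscopic dynamics -/

/-- The data of the dynamics: the potentials `V` and `Φ`, the mass `m`, the generator `𝒢` of the
momentum fluctuations and its test functions. -/
structure Model (d : ℕ) where
  V : Conf d → ℝ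
  Φ : Conf d → ℝ
  m : ℝ
  m_pos : 0 < m
  contDiff_V : ContDiff ℝ 3 V
  contDiff_Φ : ContDiff ℝ 3 Φ
  even_Φ : ∀ q, Φ (-q) = Φ q
  G : MomentumGenerator d
  T : G.TestSpace

namespace Model

variable (M : Model d)

/-- `(Φ ∗ ρ)(q)` for `ρ` with density `r`. -/
def conv (r : Phase d → ℝ) (q : Conf d) : ℝ := ∫ y, M.Φ (q - y.1) * r y

/-- `(∇Φ ∗ ρ)(q)`. -/
def convGrad (r : Phase d → ℝ) (q : Conf d) : Conf d := ∫ y, r y • gradient M.Φ (q - y.1)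

/-- The energy `E(ρ)`. -/
def energy (r : Phase d → ℝ) : ℝ :=
  ∫ y, (‖y.2‖ ^ 2 / (2 * M.m) + M.V y.1 + 1 / 2 * M.conv r y.1) * r y

/-- The functional derivative `dE(ρ)`. -/
def dEnergy (r : Phase d → ℝ) (y : Phase d) : ℝ :=
  ‖y.2‖ ^ 2 / (2 * M.m) + M.V y.1 + M.conv r y.1

/-- The entropy `S(ρ)`. -/
def entropy (r : Phase d → ℝ) : ℝ := (∫ y, Real.log (r y) * r y) + M.energy r

/-- The functional derivative `dS(ρ)`. -/
def dEntropy (r : Phase d → ℝ) (y : Phase d) : ℝ := Real.log (r y) + 1 + M.dEnergy r y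

/-- The cotangent vectors at `ρ`: test functions, with enough integrability to be paired with the
Hamiltonian vector field. -/
structure IsCot (r ξ : Phase d → ℝ) : Prop where
  mem : ξ ∈ M.T.space
  integrable : Integrable fun y => ξ y * r y
  integrable_grad : Integrable fun y => (1 + ‖y.2‖) * ‖gradQ ξ y‖ * r y

/-- The states: probability measures with a positive `C²` density `r` for which the energy and the
forces are finite, and the entropy has a functional derivative in the cotangent space. -/
structure IsState (r : Phase d → ℝ) : Prop where
  pos : ∀ y, 0 < r y
  contDiff : ContDiff ℝ 2 r
  integrable : Integrable r
  integral_eq_one : ∫ y, r y = 1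
  kinetic : Integrable fun y => ‖y.2‖ ^ 2 * r y
  potential : Integrable fun y => M.V y.1 * r y
  force : Integrable fun y => ‖gradient M.V y.1‖ * r y
  interaction : Integrable fun z : Phase d × Phase d => M.Φ (z.1.1 - z.2.1) * (r z.1 * r z.2)
  interaction_force :
    Integrable fun z : Phase d × Phase d => ‖gradient M.Φ (z.1.1 - z.2.1)‖ * (r z.1 * r z.2)
  /-- translates of `Φ` and its derivatives are `ρ`-integrable, locally uniformly -/
  domination : ∀ R : ℝ, ∃ w : Conf d → ℝ,
    (∀ k : ℕ, k ≤ 3 → ∀ q q' : Conf d, ‖q'‖ ≤ R → ‖iteratedFDeriv ℝ k M.Φ (q - q')‖ ≤ w q) ∧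
    Integrable fun y : Phase d => (1 + ‖y.2‖) * w y.1 * r y
  dEntropy_isCot : M.IsCot r (M.dEntropy r)

/-- The state space, a part of `𝒫(ℝ^{2d})`. -/
def State : Type := {r : Phase d → ℝ // M.IsState r}

variable {M}

/-- The probability measure with density `r`. -/
def State.measure (ρ : M.State) : Measure (Phase d) :=
  volume.withDensity fun y => ENNReal.ofReal (ρ.1 y)

lemma gradQ_eq {ξ : Phase d → ℝ} (h : Differentiable ℝ ξ) (y : Phase d) :
    gradQ ξ y = (InnerProductSpace.toDual ℝ (Conf d)).symm
      ((fderiv ℝ ξ y).comp (ContinuousLinearMap.inl ℝ (Conf d) (Conf d))) := by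
  have h1 : HasFDerivAt (fun q : Conf d => (q, y.2))
      (ContinuousLinearMap.inl ℝ (Conf d) (Conf d)) y.1 := hasFDerivAt_prodMk_left _ _
  have h2 : HasFDerivAt ξ (fderiv ℝ ξ y) (y.1, y.2) := (h y).hasFDerivAt
  have h3 := (h2.comp y.1 h1).fderiv
  simp only [gradQ, gradient]
  exact congrArg _ h3

lemma gradP_eq {ξ : Phase d → ℝ} (h : Differentiable ℝ ξ) (y : Phase d) :
    gradP ξ y = (InnerProductSpace.toDual ℝ (Conf d)).symm
      ((fderiv ℝ ξ y).comp (ContinuousLinearMap.inr ℝ (Conf d) (Conf d))) := by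
  have h1 : HasFDerivAt (fun p : Conf d => (y.1, p))
      (ContinuousLinearMap.inr ℝ (Conf d) (Conf d)) y.2 := hasFDerivAt_prodMk_right _ _
  have h2 : HasFDerivAt ξ (fderiv ℝ ξ y) (y.1, y.2) := (h y).hasFDerivAt
  have h3 := (h2.comp y.2 h1).fderiv
  simp only [gradP, gradient]
  exact congrArg _ h3

lemma gradQ_add {ξ η : Phase d → ℝ} (h : Differentiable ℝ ξ) (h' : Differentiable ℝ η) :
    gradQ (ξ + η) = gradQ ξ + gradQ η := by
  funext y
  rw [Pi.add_apply, gradQ_eq (h.add h'), gradQ_eq h, gradQ_eq h', fderiv_add (h y) (h' y),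
    ContinuousLinearMap.add_comp, map_add]

lemma gradP_add {ξ η : Phase d → ℝ} (h : Differentiable ℝ ξ) (h' : Differentiable ℝ η) :
    gradP (ξ + η) = gradP ξ + gradP η := by
  funext y
  rw [Pi.add_apply, gradP_eq (h.add h'), gradP_eq h, gradP_eq h', fderiv_add (h y) (h' y),
    ContinuousLinearMap.add_comp, map_add]

lemma gradQ_smul {ξ : Phase d → ℝ} (c : ℝ) (h : Differentiable ℝ ξ) :
    gradQ (c • ξ) = c • gradQ ξ := by
  funext y
  rw [Pi.smul_apply, gradQ_eq (h.const_smul c), gradQ_eq h, fderiv_const_smul (h y),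
    ContinuousLinearMap.smul_comp]
  simp

lemma gradP_smul {ξ : Phase d → ℝ} (c : ℝ) (h : Differentiable ℝ ξ) :
    gradP (c • ξ) = c • gradP ξ := by
  funext y
  rw [Pi.smul_apply, gradP_eq (h.const_smul c), gradP_eq h, fderiv_const_smul (h y),
    ContinuousLinearMap.smul_comp]
  simp

lemma measurable_gradQ {ξ : Phase d → ℝ} (h : Differentiable ℝ ξ) : Measurable (gradQ ξ) := by
  rw [funext (gradQ_eq h)]
  refine (LinearIsometryEquiv.continuous _).measurable.comp ?_
  exact ((ContinuousLinearMap.compL ℝ (Conf d) (Phase d) ℝ).flip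
    (ContinuousLinearMap.inl ℝ (Conf d) (Conf d))).continuous.measurable.comp (measurable_fderiv ℝ ξ)

lemma measurable_gradP {ξ : Phase d → ℝ} (h : Differentiable ℝ ξ) : Measurable (gradP ξ) := by
  rw [funext (gradP_eq h)]
  refine (LinearIsometryEquiv.continuous _).measurable.comp ?_
  exact ((ContinuousLinearMap.compL ℝ (Conf d) (Phase d) ℝ).flip
    (ContinuousLinearMap.inr ℝ (Conf d) (Conf d))).continuous.measurable.comp (measurable_fderiv ℝ ξ)

lemma IsCot.differentiable {r ξ : Phase d → ℝ} (h : M.IsCot r ξ) : Differentiable ℝ ξ :=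
  (M.T.contDiff ξ h.mem).differentiable (by norm_num)

/-- The cotangent space `T*_ρ`. -/
def cot (ρ : M.State) : Submodule ℝ (Phase d → ℝ) where
  carrier := {ξ | M.IsCot ρ.1 ξ}
  zero_mem' := by
    refine ⟨M.T.space.zero_mem, by simp, ?_⟩
    have h : gradQ (0 : Phase d → ℝ) = 0 := by
      have := gradQ_smul (0 : ℝ) (differentiable_const (0 : ℝ) : Differentiable ℝ fun _ : Phase d => (0 : ℝ))
      simp only [zero_smul] at this
      exact this
    simp [h]
  add_mem' := by
    intro ξ η h h'
    refine ⟨M.T.space.add_mem h.mem h'.mem, ?_, ?_⟩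
    · refine (h.integrable.add h'.integrable).congr (Eventually.of_forall fun y => ?_)
      simp only [Pi.add_apply]
      ring
    · refine (h.integrable_grad.add h'.integrable_grad).mono' ?_ ?_
      · have := measurable_gradQ (h.differentiable.add h'.differentiable)
        exact (((by fun_prop : Measurable fun y : Phase d => 1 + ‖y.2‖).mul this.norm).mul
          ρ.2.contDiff.continuous.measurable).aestronglyMeasurable
      · refine Eventually.of_forall fun y => ?_
        have hr := (ρ.2.pos y).le
        rw [Real.norm_of_nonneg (by positivity), gradQ_add h.differentiable h'.differentiable]
        simp only [Pi.add_apply]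
        calc (1 + ‖y.2‖) * ‖gradQ ξ y + gradQ η y‖ * ρ.1 y
            ≤ (1 + ‖y.2‖) * (‖gradQ ξ y‖ + ‖gradQ η y‖) * ρ.1 y := by
              gcongr; exact norm_add_le _ _
          _ = _ := by ring
  smul_mem' := by
    intro c ξ h
    refine ⟨M.T.space.smul_mem c h.mem, ?_, ?_⟩
    · simpa [mul_assoc] using h.integrable.const_mul c
    · have := h.integrable_grad.const_mul |c|
      rw [gradQ_smul c h.differentiable]
      refine this.congr (Eventually.of_forall fun y => ?_)
      simp only [Pi.smul_apply, norm_smul, Real.norm_eq_abs]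
      ring

/-- The tangent space `T_ρ`: the linear functionals ("distributions") on the cotangent space. -/
abbrev tan (ρ : M.State) : Type := Module.Dual ℝ (cot ρ)

/-- `dS(ρ)` as a cotangent vector. -/
def dS (ρ : M.State) : cot ρ := ⟨M.dEntropy ρ.1, ρ.2.dEntropy_isCot⟩

/-- `𝒢*(ρ)`, the functional `ξ ↦ ∫ 𝒢 ξ dρ`. -/
def adjointG (ρ : M.State) : tan ρ where
  toFun ξ := ∫ y, M.G.lift ξ.1 y * ρ.1 y
  map_add' ξ η := by
    have key : ∀ ζ : cot ρ, Integrable fun y => M.G.lift ζ.1 y * ρ.1 y := by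
      intro ζ
      obtain ⟨hc, C, hC⟩ := M.T.isCb_lift ζ.1 ζ.2.mem
      exact ρ.2.integrable.bdd_mul hc.aestronglyMeasurable
        (Eventually.of_forall fun y => by simpa using hC y)
    rw [← integral_add (key ξ) (key η)]
    refine integral_congr_ae (Eventually.of_forall fun y => ?_)
    have : M.G.lift (ξ + η : cot ρ).1 y = M.G.lift ξ.1 y + M.G.lift η.1 y := by
      unfold MomentumGenerator.lift
      have := congrFun (map_add M.G.op (fun p => ξ.1 (y.1, p)) fun p => η.1 (y.1, p)) y.2
      exact this
    simp only [this, add_mul]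
  map_smul' c ξ := by
    rw [RingHom.id_apply, smul_eq_mul, ← integral_const_mul]
    refine integral_congr_ae (Eventually.of_forall fun y => ?_)
    have : M.G.lift (c • ξ : cot ρ).1 y = c * M.G.lift ξ.1 y := by
      unfold MomentumGenerator.lift
      have := congrFun (map_smul M.G.op c fun p => ξ.1 (y.1, p)) y.2
      exact this
    simp only [this, mul_assoc]

/-- Vector fields `a` (in position) and `b` (in momentum) whose flux `ρ (a, b)` has a divergence
in the tangent space `T_ρ`. -/
structure IsFlux (r : Phase d → ℝ) (a b : Phase d → Conf d) : Prop where
  measurable_fst : Measurable a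
  measurable_snd : Measurable b
  growth : ∃ C : ℝ, ∀ y, ‖a y‖ ≤ C * (1 + ‖y.2‖)
  integrable : Integrable fun y => ‖b y‖ * r y

lemma IsFlux.integrable_pair {ρ : M.State} {a b : Phase d → Conf d} (h : IsFlux ρ.1 a b)
    (η : cot ρ) :
    Integrable fun y => (inner ℝ (a y) (gradQ η.1 y) - inner ℝ (b y) (gradP η.1 y)) * ρ.1 y := by
  obtain ⟨C, hC⟩ := h.growth
  obtain ⟨D, hD⟩ := M.T.gradP_bdd η.1 η.2.mem
  have hη := η.2.differentiable
  have hr := ρ.2.contDiff.continuous.measurable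
  refine ((η.2.integrable_grad.const_mul C).add (h.integrable.mul_const D)).mono' ?_ ?_
  · exact (((h.measurable_fst.inner (measurable_gradQ hη)).sub
      (h.measurable_snd.inner (measurable_gradP hη))).mul hr).aestronglyMeasurable
  · refine Eventually.of_forall fun y => ?_
    have hr0 := (ρ.2.pos y).le
    rw [norm_mul, Real.norm_of_nonneg hr0]
    have h1 : ‖(inner ℝ (a y) (gradQ η.1 y) : ℝ)‖ ≤ C * (1 + ‖y.2‖) * ‖gradQ η.1 y‖ :=
      (norm_inner_le_norm _ _).trans (by gcongr; exact hC y)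
    have h2 : ‖(inner ℝ (b y) (gradP η.1 y) : ℝ)‖ ≤ ‖b y‖ * D :=
      (norm_inner_le_norm _ _).trans (by gcongr; exact hD y)
    calc ‖(inner ℝ (a y) (gradQ η.1 y) - inner ℝ (b y) (gradP η.1 y) : ℝ)‖ * ρ.1 y
        ≤ (C * (1 + ‖y.2‖) * ‖gradQ η.1 y‖ + ‖b y‖ * D) * ρ.1 y := by
          gcongr
          exact (norm_sub_le _ _).trans (add_le_add h1 h2)
      _ = _ := by simp only [Pi.add_apply]; ring

/-- The tangent vector `-div_q(ρ a) + div_p(ρ b)`, in weak form. -/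
def flux (ρ : M.State) (a b : Phase d → Conf d) (h : IsFlux ρ.1 a b) : tan ρ where
  toFun η := ∫ y, (inner ℝ (a y) (gradQ η.1 y) - inner ℝ (b y) (gradP η.1 y)) * ρ.1 y
  map_add' ξ η := by
    rw [← integral_add (h.integrable_pair ξ) (h.integrable_pair η)]
    refine integral_congr_ae (Eventually.of_forall fun y => ?_)
    have h1 := congrFun (gradQ_add ξ.2.differentiable η.2.differentiable) y
    have h2 := congrFun (gradP_add ξ.2.differentiable η.2.differentiable) y
    simp only [Submodule.coe_add, h1, h2, Pi.add_apply, inner_add_right]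
    ring
  map_smul' c ξ := by
    rw [RingHom.id_apply, smul_eq_mul, ← integral_const_mul]
    refine integral_congr_ae (Eventually.of_forall fun y => ?_)
    have h1 := congrFun (gradQ_smul c ξ.2.differentiable) y
    have h2 := congrFun (gradP_smul c ξ.2.differentiable) y
    simp only [Submodule.coe_smul, h1, h2, Pi.smul_apply, inner_smul_right]
    ring

/-- The functions `ξ` to which `L(ρ)` is applied. -/
structure IsHamiltonianFor (r ξ : Phase d → ℝ) : Prop where
  differentiable : Differentiable ℝ ξ
  growth : ∃ C : ℝ, ∀ y, ‖gradP ξ y‖ ≤ C * (1 + ‖y.2‖)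
  integrable : Integrable fun y => ‖gradQ ξ y‖ * r y

/-- `L(ρ) ξ = div(ρ J ∇ξ) = -div_q(ρ ∇_p ξ) + div_p(ρ ∇_q ξ)`. -/
def L (ρ : M.State) (ξ : Phase d → ℝ) (h : IsHamiltonianFor ρ.1 ξ) : tan ρ :=
  flux ρ (gradP ξ) (gradQ ξ)
    ⟨measurable_gradP h.differentiable, measurable_gradQ h.differentiable, h.growth, h.integrable⟩

lemma continuous_gradient {f : Conf d → ℝ} (h : ContDiff ℝ 3 f) : Continuous (gradient f) :=
  (LinearIsometryEquiv.continuous _).comp (h.continuous_fderiv (by norm_num))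

lemma measurable_convGrad (ρ : M.State) : Measurable (M.convGrad ρ.1) := by
  have hc : Continuous fun z : Conf d × Phase d => ρ.1 z.2 • gradient M.Φ (z.1 - z.2.1) := by
    have h1 := continuous_gradient M.contDiff_Φ
    have h2 := ρ.2.contDiff.continuous
    fun_prop
  exact (hc.stronglyMeasurable.integral_prod_right).measurable

lemma integrable_convGrad (ρ : M.State) :
    Integrable fun y : Phase d => ‖M.convGrad ρ.1 y.1‖ * ρ.1 y := by
  have h := ρ.2.interaction_force.integral_prod_left
  refine h.mono' ?_ (Eventually.of_forall fun y => ?_)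
  · exact (((measurable_convGrad ρ).comp measurable_fst).norm.mul
      ρ.2.contDiff.continuous.measurable).aestronglyMeasurable
  · have hr0 := (ρ.2.pos y).le
    rw [Real.norm_of_nonneg (by positivity)]
    calc ‖M.convGrad ρ.1 y.1‖ * ρ.1 y
        ≤ (∫ z, ‖ρ.1 z • gradient M.Φ (y.1 - z.1)‖) * ρ.1 y := by
          gcongr; exact norm_integral_le_integral_norm _
      _ = _ := by
          rw [← integral_mul_const]
          refine integral_congr_ae (Eventually.of_forall fun z => ?_)
          simp only [norm_smul, Real.norm_of_nonneg (ρ.2.pos z).le]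
          ring

lemma hasGradientAt_conv (ρ : M.State) (q : Conf d) :
    HasGradientAt (M.conv ρ.1) (M.convGrad ρ.1 q) q := by
  obtain ⟨w, hw, hint⟩ := ρ.2.domination (‖q‖ + 1)
  have hr := ρ.2.contDiff.continuous
  have hΦ := M.contDiff_Φ
  have hΦd : Differentiable ℝ M.Φ := hΦ.differentiable (by norm_num)
  have hev : ∀ x, ‖fderiv ℝ M.Φ (-x)‖ = ‖fderiv ℝ M.Φ x‖ := by
    intro x
    have h1 := ((hΦd (-x)).hasFDerivAt.comp x (hasFDerivAt_id x).neg).fderiv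
    have h2 : M.Φ ∘ (fun y => -id y) = M.Φ := funext M.even_Φ
    change fderiv ℝ (M.Φ ∘ fun y => -id y) x = _ at h1
    rw [h2] at h1
    rw [h1]
    simp [ContinuousLinearMap.comp_neg]
  have hw0 : ∀ x, 0 ≤ w x := fun x =>
    (norm_nonneg _).trans (hw 0 (by norm_num) x 0 (by simp; positivity))
  have hwi : Integrable fun y : Phase d => w y.1 * ρ.1 y := by
    refine hint.mono ?_ (Eventually.of_forall fun y => ?_)
    · have := hint.aestronglyMeasurable.mul
        (by fun_prop (disch := intro y; positivity) :
          Continuous fun y : Phase d => (1 + ‖y.2‖)⁻¹).aestronglyMeasurable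
      refine this.congr (Eventually.of_forall fun y => ?_)
      have : (1 + ‖y.2‖) ≠ 0 := by positivity
      simp only [Pi.mul_apply]
      field_simp
    · have h1 := hw0 y.1
      have h2 := (ρ.2.pos y).le
      rw [Real.norm_of_nonneg (by positivity), Real.norm_of_nonneg (by positivity)]
      have h3 : 1 ≤ 1 + ‖y.2‖ := by simp
      calc w y.1 * ρ.1 y = 1 * w y.1 * ρ.1 y := by ring
        _ ≤ _ := by gcongr
  have hfd : Continuous (fderiv ℝ M.Φ) := hΦ.continuous_fderiv (by norm_num)
  have main := hasFDerivAt_integral_of_dominated_of_fderiv_le (𝕜 := ℝ) (μ := volume)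
    (F := fun (x : Conf d) (y : Phase d) => M.Φ (x - y.1) * ρ.1 y)
    (F' := fun x y => ρ.1 y • fderiv ℝ M.Φ (x - y.1))
    (bound := fun y => w y.1 * ρ.1 y) (x₀ := q) (s := Metric.ball q 1)
    (Metric.ball_mem_nhds q one_pos)
    (Eventually.of_forall fun x => by
      have := hΦ.continuous
      exact Continuous.aestronglyMeasurable (by fun_prop))
    (by
      refine hwi.mono' ?_ (Eventually.of_forall fun y => ?_)
      · have := hΦ.continuous
        exact Continuous.aestronglyMeasurable (by fun_prop)
      · have h1 := hw 0 (by norm_num) y.1 q (by simp)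
        rw [norm_iteratedFDeriv_zero, ← M.even_Φ, neg_sub] at h1
        rw [norm_mul, Real.norm_of_nonneg (ρ.2.pos y).le]
        have := (ρ.2.pos y).le
        gcongr)
    (Continuous.aestronglyMeasurable (by fun_prop))
    (Eventually.of_forall fun y x hx => by
      have hx' : ‖x‖ ≤ ‖q‖ + 1 := by
        have := norm_le_norm_add_norm_sub' x q
        have h2 : ‖x - q‖ < 1 := by simpa [dist_eq_norm] using hx
        linarith
      have h1 := hw 1 (by norm_num) y.1 x hx'
      rw [norm_iteratedFDeriv_one, ← hev, neg_sub] at h1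
      rw [norm_smul, Real.norm_of_nonneg (ρ.2.pos y).le, mul_comm]
      have := (ρ.2.pos y).le
      gcongr)
    hwi
    (Eventually.of_forall fun y x _ => by
      have h1 : HasFDerivAt (fun x => M.Φ (x - y.1)) (fderiv ℝ M.Φ (x - y.1)) x := by
        exact (hΦd (x - y.1)).hasFDerivAt.comp x ((hasFDerivAt_id x).sub_const y.1)
      exact h1.mul_const (ρ.1 y))
  rw [hasGradientAt_iff_hasFDerivAt]
  have : InnerProductSpace.toDual ℝ (Conf d) (M.convGrad ρ.1 q)
      = ∫ y, ρ.1 y • fderiv ℝ M.Φ (q - y.1) := by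
    unfold convGrad
    have hb : ∀ y : Phase d, ‖fderiv ℝ M.Φ (q - y.1)‖ ≤ w y.1 := fun y => by
      have h1 := hw 1 (by norm_num) y.1 q (by simp)
      rwa [norm_iteratedFDeriv_one, ← hev, neg_sub] at h1
    have i1 : Integrable fun y : Phase d => ρ.1 y • fderiv ℝ M.Φ (q - y.1) := by
      refine hwi.mono' (Continuous.aestronglyMeasurable (by fun_prop))
        (Eventually.of_forall fun y => ?_)
      rw [norm_smul, Real.norm_of_nonneg (ρ.2.pos y).le, mul_comm]
      have := (ρ.2.pos y).le
      have := hb y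
      gcongr
    have i2 : Integrable fun y : Phase d => ρ.1 y • gradient M.Φ (q - y.1) := by
      have hg := continuous_gradient M.contDiff_Φ
      refine hwi.mono' (Continuous.aestronglyMeasurable (by fun_prop))
        (Eventually.of_forall fun y => ?_)
      rw [norm_smul, Real.norm_of_nonneg (ρ.2.pos y).le, mul_comm, gradient,
        LinearIsometryEquiv.norm_map]
      have := (ρ.2.pos y).le
      have := hb y
      gcongr
    ext v
    rw [ContinuousLinearMap.integral_apply i1, InnerProductSpace.toDual_apply_apply,
      real_inner_comm, ← integral_inner i2]
    refine integral_congr_ae (Eventually.of_forall fun y => ?_)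
    simp only [inner_smul_right, smul_apply, smul_eq_mul]
    rw [real_inner_comm, gradient, InnerProductSpace.toDual_symm_apply]
  rw [this]
  exact main

lemma differentiable_dEnergy (ρ : M.State) : Differentiable ℝ (M.dEnergy ρ.1) := by
  have h1 : Differentiable ℝ (M.conv ρ.1) := fun q => (hasGradientAt_conv ρ q).differentiableAt
  have h2 : Differentiable ℝ M.V := M.contDiff_V.differentiable (by norm_num)
  have h3 : Differentiable ℝ fun y : Phase d => ‖y.2‖ ^ 2 / (2 * M.m) := by
    have h4 : Differentiable ℝ fun y : Phase d => ‖y.2‖ ^ 2 :=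
      Differentiable.norm_sq ℝ (differentiable_snd (𝕜 := ℝ))
    simpa only [div_eq_mul_inv] using h4.mul_const (2 * M.m)⁻¹
  exact (h3.add (h2.comp differentiable_fst)).add (h1.comp differentiable_fst)

lemma gradQ_dEnergy (ρ : M.State) (y : Phase d) :
    gradQ (M.dEnergy ρ.1) y = gradient M.V y.1 + M.convGrad ρ.1 y.1 := by
  have h2 : HasGradientAt M.V (gradient M.V y.1) y.1 :=
    (M.contDiff_V.differentiable (by norm_num) y.1).hasGradientAt
  have h := ((h2.hasFDerivAt.const_add (‖y.2‖ ^ 2 / (2 * M.m))).add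
    (hasGradientAt_conv ρ y.1).hasFDerivAt)
  rw [← map_add] at h
  exact HasGradientAt.gradient (hasGradientAt_iff_hasFDerivAt.2 h)

lemma gradP_dEnergy (ρ : M.State) (y : Phase d) :
    gradP (M.dEnergy ρ.1) y = M.m⁻¹ • y.2 := by
  have h1 : HasFDerivAt (fun p : Conf d => ‖p‖ ^ 2 / (2 * M.m) + M.V y.1 + M.conv ρ.1 y.1)
      (InnerProductSpace.toDual ℝ (Conf d) (M.m⁻¹ • y.2)) y.2 := by
    have h := ((((hasStrictFDerivAt_norm_sq y.2).hasFDerivAt.mul_const (2 * M.m)⁻¹).add_const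
      (M.V y.1)).add_const (M.conv ρ.1 y.1))
    refine h.congr_fderiv ?_
    ext v
    have := M.m_pos.ne'
    simp
    field_simp
  exact HasGradientAt.gradient (hasGradientAt_iff_hasFDerivAt.2 h1)

lemma isFlux_drift (ρ : M.State) : IsFlux ρ.1 (fun y => M.m⁻¹ • y.2)
    (fun y => gradient M.V y.1 + M.convGrad ρ.1 y.1) := by
  have hV := continuous_gradient M.contDiff_V
  refine ⟨by fun_prop, ?_, ⟨M.m⁻¹, fun y => ?_⟩, ?_⟩
  · exact (hV.measurable.comp measurable_fst).add ((measurable_convGrad ρ).comp measurable_fst)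
  · have := M.m_pos
    rw [norm_smul, Real.norm_of_nonneg (by positivity)]
    gcongr
    simp
  · refine (ρ.2.force.add (integrable_convGrad ρ)).mono' ?_ (Eventually.of_forall fun y => ?_)
    · exact (((hV.measurable.comp measurable_fst).add
        ((measurable_convGrad ρ).comp measurable_fst)).norm.mul
        ρ.2.contDiff.continuous.measurable).aestronglyMeasurable
    · have hr := (ρ.2.pos y).le
      rw [Real.norm_of_nonneg (by positivity)]
      simp only [Pi.add_apply, ← add_mul]
      gcongr
      exact norm_add_le _ _

lemma isHamiltonianFor_dEnergy (ρ : M.State) : IsHamiltonianFor ρ.1 (M.dEnergy ρ.1) := by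
  have h := isFlux_drift ρ
  refine ⟨differentiable_dEnergy ρ, ?_, ?_⟩
  · simpa only [gradP_dEnergy] using h.growth
  · simpa only [gradQ_dEnergy] using h.integrable

/-- The Hamiltonian vector field `L(ρ) dE(ρ)`. -/
def LdE (ρ : M.State) : tan ρ := L ρ (M.dEnergy ρ.1) (isHamiltonianFor_dEnergy ρ)

/-- The vector field
`F(ρ) = -div_q(ρ p/m) + div_p(ρ ∇_q V + ρ (∇_q Φ ∗ ρ)) + 𝒢*(ρ)` of the dynamics. -/
def field (ρ : M.State) : tan ρ :=
  flux ρ (fun y => M.m⁻¹ • y.2) (fun y => gradient M.V y.1 + M.convGrad ρ.1 y.1) (isFlux_drift ρ)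
    + adjointG ρ

/-- The dissipation potential
`Ψ*(ρ, ξ) = ℋ₂(ρ, ξ + dS(ρ)/2) - ℋ₂(ρ, dS(ρ)/2)` obtained from the limit Hamiltonian `ℋ₂`. -/
def dissipation (H₂ : Measure (Phase d) → (Phase d → ℝ) → ℝ) (ρ : M.State) (ξ : cot ρ) : ℝ :=
  H₂ ρ.measure (ξ + (1 / 2 : ℝ) • dS ρ : cot ρ).1 - H₂ ρ.measure ((1 / 2 : ℝ) • dS ρ : cot ρ).1

/-! ### Calculus on the states, and on the states with an additional real variable -/

/-- Smooth compactly supported variations of the density, of total mass zero. -/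
structure Variation (d : ℕ) where
  toFun : Phase d → ℝ
  contDiff : ContDiff ℝ ∞ toFun
  compact : HasCompactSupport toFun
  mass_zero : ∫ y, toFun y = 0

open Classical in
/-- The state with density `r + t σ` (only used for those `t`, near `0`, for which it is one). -/
def State.shift (ρ : M.State) (σ : Variation d) (t : ℝ) : M.State :=
  if h : M.IsState fun y => ρ.1 y + t * σ.toFun y then ⟨_, h⟩ else ρ

/-- `ξ` is the functional derivative at `ρ` of the functional `U` of the density. -/
def HasFunctionalDeriv (U : (Phase d → ℝ) → ℝ) (ρ : M.State) (ξ : Phase d → ℝ) : Prop :=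
  ∀ σ : Variation d, HasDerivAt (fun t : ℝ => U fun y => ρ.1 y + t * σ.toFun y)
    (∫ y, ξ y * σ.toFun y) 0

variable (M)

/-- The points `(ρ, e)` of the extended state space. -/
abbrev ExtState : Type := M.State × ℝ

variable {M}

/-- `(ξ, r)` is a differential at `(ρ, e)` of the function `U`: the function
`t ↦ U(ρ + t σ, e + t s)` is defined near `t = 0` and has derivative `⟨ξ, σ⟩ + r s` at `0`. -/
def HasExtDiff (U : M.ExtState → ℝ) (z : M.ExtState) (ξ : cot z.1 × ℝ) : Prop :=
  ∀ (σ : Variation d) (s : ℝ),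
    (∀ᶠ t in 𝓝 (0 : ℝ), M.IsState fun y => z.1.1 y + t * σ.toFun y) ∧
    HasDerivAt (fun t : ℝ => U (z.1.shift σ t, z.2 + t * s))
      ((∫ y, ξ.1.1 y * σ.toFun y) + ξ.2 * s) 0

/-- `U` has a differential everywhere, which is (weakly) continuous along variations. -/
def IsExtC1 (U : M.ExtState → ℝ) : Prop :=
  ∃ D : ∀ z : M.ExtState, cot z.1 × ℝ, (∀ z, HasExtDiff U z (D z)) ∧
    ∀ (z : M.ExtState) (σ τ : Variation d) (s b : ℝ), ContinuousAt (fun t : ℝ =>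
      (∫ y, (D (z.1.shift σ t, z.2 + t * s)).1.1 y * τ.toFun y)
        + (D (z.1.shift σ t, z.2 + t * s)).2 * b) 0

/-- Smooth cylinder functions `(ρ, e) ↦ φ(⟨f_1, ρ⟩, …, ⟨f_l, ρ⟩, e)`. -/
def IsExtCylinder (U : M.ExtState → ℝ) : Prop :=
  ∃ (l : ℕ) (f : Fin l → Phase d → ℝ) (φ : (Fin l → ℝ) × ℝ → ℝ),
    (∀ j, ContDiff ℝ ∞ (f j) ∧ HasCompactSupport (f j)) ∧ ContDiff ℝ ∞ φ ∧
    ∀ z : M.ExtState, U z = φ (fun j => ∫ y, f j y * z.1.1 y, z.2)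

variable (M)

/-- The extended state space with tangent spaces `T_ρ × ℝ` and cotangent spaces `T*_ρ × ℝ`. -/
def extGeometry : Geometry where
  Pt := M.ExtState
  Cot z := cot z.1 × ℝ
  Tan z := tan z.1 × ℝ
  pair z := LinearMap.mk₂ ℝ (fun v ξ => v.1 ξ.1 + v.2 * ξ.2)
    (fun v w ξ => by simp only [Prod.fst_add, Prod.snd_add, LinearMap.add_apply]; ring)
    (fun c v ξ => by
      simp only [Prod.smul_fst, Prod.smul_snd, LinearMap.smul_apply, smul_eq_mul]; ring)
    (fun v ξ η => by simp only [Prod.fst_add, Prod.snd_add, map_add]; ring)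
    (fun c v ξ => by simp only [Prod.smul_fst, Prod.smul_snd, map_smul, smul_eq_mul]; ring)
  HasDiff := HasExtDiff
  IsC1 := IsExtC1
  IsSmooth := IsExtCylinder

/-- `Ŝ(ρ, e) = S(ρ)`. -/
def extEntropy (z : M.ExtState) : ℝ := M.entropy z.1.1

/-- `Ê(ρ, e) = e`. -/
def extEnergy (z : M.ExtState) : ℝ := z.2

/-- `F̂(ρ, e) = (F(ρ), 0)`. -/
def extField (z : M.ExtState) : tan z.1 × ℝ := (field z.1, 0)

/-- `L̂(ρ, e) (ξ, r) = (r L(ρ) dE(ρ), -⟨L(ρ) dE(ρ), ξ⟩)`. -/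
def extL (z : M.ExtState) : (cot z.1 × ℝ) →ₗ[ℝ] tan z.1 × ℝ where
  toFun ξ := (ξ.2 • LdE z.1, -LdE z.1 ξ.1)
  map_add' ξ η := by
    ext1
    · exact add_smul _ _ _
    · simp only [Prod.fst_add, Prod.snd_add, map_add]; ring
  map_smul' c ξ := by
    ext1
    · exact mul_smul _ _ _
    · simp only [Prod.smul_fst, Prod.smul_snd, map_smul, smul_eq_mul, RingHom.id_apply]; ring

/-- `Ψ̂*((ρ, e), (ξ, r)) = Ψ*(ρ, ξ)`. -/
def extDissipation (H₂ : Measure (Phase d) → (Phase d → ℝ) → ℝ) (z : M.ExtState)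
    (ξ : cot z.1 × ℝ) : EReal :=
  ((dissipation H₂ z.1 ξ.1 : ℝ) : EReal)

end Model
end Underdamped

end

/-!
The proof rests on an explicit formula for the limit Hamiltonian. For a linear cylinder function
`F(ρ) = ⟨f, ρ⟩`, the `n`-particle Hamiltonian at an empirical measure `η` is exactly
`⟨e^{-f} 𝒢 e^f, η⟩`, and `e^{-f} 𝒢 e^f` is bounded and continuous. By the law of large numbers each
probability measure `ρ` with `f ∈ L¹(ρ)` is a limit of empirical measures of the required kind,
hence `ℋ₂(ρ, f) = ⟨e^{-f} 𝒢 e^f, ρ⟩` (`HasLimitHamiltonian.eq_integral_expLift`).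

*Dissipation.* Since `(e^{-f} 𝒢 e^f)(q, p) = 𝒢(e^{f(q, ·) - f(q, p)})(p)` and the function to which
`𝒢` is applied equals `1` at `p`, pointwise inequalities for the exponential function turn into
inequalities for `e^{-f} 𝒢 e^f` by the maximum principle: convexity in `f` (`expLift_convex`), the
bound `𝒢 f ≤ e^{-f} 𝒢 e^f` (`lift_le_expLift`), and Taylor expansions along lines
(`TestSpace.contDiff_integral_expLift`). The density of a state is `e^{dS(ρ)}` times a function of
`q` times the Maxwellian, so that `⟨e^{-(ξ + dS/2)} 𝒢 e^{ξ + dS/2}, ρ⟩` pairs `e^{dS/2 - ξ}` with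
`𝒢 e^{dS/2 + ξ}` in `ρ_m`, and reversibility makes it even in `ξ`
(`TestSpace.integral_expLift_neg`). As the tangent space consists of all linear functionals, a
finite convex function that is `C¹` along lines has a subgradient everywhere, its Gateaux
derivative, and equals its Legendre bidual (`Geometry.symmetricDissipationPotentials_legendre`).

*Calculus.* Along `r + t σ`, with `σ` smooth and compactly supported, `dS` changes by a compactly
supported function and a function of the position, so that states remain states
(`State.isState_add_mul`), and energy and entropy can be differentiated
(`hasFunctionalDeriv_energy`, `hasFunctionalDeriv_entropy`). Differentials are unique up to additive
constants, which `L(ρ) dE(ρ)`, `𝒢*(ρ)` and `Ψ*` ignore.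

*Poisson structure.* The bracket is `{F, G} = ∂G XF - XG ∂F`, where `X` is the derivative along
`L dE` and `∂ = ∂/∂e`. On smooth functions the derivations `X` and `∂` commute, and this gives the
Jacobi identity (`isPoisson_extL`); that `XF` is differentiable uses the third derivatives of `V`
and `Φ` (`hasExtDiff_LdE`).

*Degeneracy and equation.* `⟨L dE, dS⟩` is the integral of the divergence of the integrable field
`ρ J ∇dE`, hence zero (`LdE_dS`), and `Ψ̂*` does not depend on the `ℝ`-component of a covector,
while `dÊ = (const, 1)`. Finally `F̂ - L̂ dÊ = (𝒢*(ρ), 0)`, and by `𝒢 η ≤ e^{-η} 𝒢 e^η`, with equality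
at `η = 0`, the supremum in `Ψ(ρ, 𝒢*(ρ))` is attained at `-dS(ρ)/2` (`legendre_adjointG`), which is
the GENERIC equation.
-/

noncomputable section

/-! ### Convex duality in a real vector space -/

/-- A finite convex function that is differentiable along lines has a subgradient at each point,
its Gateaux derivative. That this derivative is additive follows from convexity: the
difference of the two sides of the midpoint inequality is minimal at `t = 0`. -/
theorem exists_subgradient {E : Type*} [AddCommGroup E] [Module ℝ E] {f : E → ℝ}
    (hf : ConvexOn ℝ univ f)
    (hd : ∀ ξ η : E, Differentiable ℝ fun t : ℝ => f (ξ + t • η)) (ξ : E) :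
    ∃ v : E →ₗ[ℝ] ℝ, ∀ η, f ξ + v (η - ξ) ≤ f η := by
  have hN : ∀ (η : E) (c : ℝ), HasDerivAt (fun t : ℝ => f (ξ + (c * t) • η))
      (c * deriv (fun t : ℝ => f (ξ + t • η)) 0) 0 := by
    intro η c
    have h1 : HasDerivAt (fun t : ℝ => f (ξ + t • η))
        (deriv (fun t : ℝ => f (ξ + t • η)) 0) (c * 0) := by
      rw [mul_zero]
      exact (hd ξ η 0).hasDerivAt
    have h2 := h1.comp (0 : ℝ) ((hasDerivAt_id (0 : ℝ)).const_mul c)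
    simpa [Function.comp_def, mul_comm] using h2
  refine ⟨{ toFun := fun η => deriv (fun t : ℝ => f (ξ + t • η)) 0
            map_add' := fun η ζ => ?_
            map_smul' := fun c η => ?_ }, fun η => ?_⟩
  · have h := (((hN η 2).const_mul (1 / 2)).add ((hN ζ 2).const_mul (1 / 2))).sub (hN (η + ζ) 1)
    have hmin : IsLocalMin (((fun t : ℝ => 1 / 2 * f (ξ + (2 * t) • η))
        + fun t : ℝ => 1 / 2 * f (ξ + (2 * t) • ζ)) - fun t : ℝ => f (ξ + (1 * t) • (η + ζ))) 0 := by
      refine Eventually.of_forall fun t => ?_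
      have h1 := hf.2 (mem_univ (ξ + (2 * t) • η)) (mem_univ (ξ + (2 * t) • ζ))
        (by norm_num : (0 : ℝ) ≤ 1 / 2) (by norm_num : (0 : ℝ) ≤ 1 / 2) (by norm_num)
      have h2 : (1 / 2 : ℝ) • (ξ + (2 * t) • η) + (1 / 2 : ℝ) • (ξ + (2 * t) • ζ)
          = ξ + (1 * t) • (η + ζ) := by module
      rw [h2] at h1
      simp only [smul_eq_mul] at h1
      simp
      simp at h1
      linarith
    have := hmin.hasDerivAt_eq_zero h
    linarith
  · have := (hN η c).deriv
    simp only [smul_smul, mul_comm _ c, RingHom.id_apply, smul_eq_mul]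
    exact this
  · have hconv : ConvexOn ℝ univ fun t : ℝ => f (ξ + t • (η - ξ)) := by
      refine ⟨convex_univ, fun s _ t _ a b ha hb hab => ?_⟩
      have h1 := hf.2 (mem_univ (ξ + s • (η - ξ))) (mem_univ (ξ + t • (η - ξ))) ha hb hab
      have h2 : a • (ξ + s • (η - ξ)) + b • (ξ + t • (η - ξ))
          = (a + b) • ξ + (a • s + b • t) • (η - ξ) := by
        simp only [smul_eq_mul]; module
      rw [h2, hab, one_smul] at h1
      exact h1
    have h := hconv.le_slope_of_hasDerivAt (mem_univ 0) (mem_univ 1) one_pos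
      ((hd ξ (η - ξ) 0).hasDerivAt)
    simp [slope_def_field] at h
    simp only [LinearMap.coe_mk, AddHom.coe_mk]
    linarith

namespace Geometry

variable {M : Geometry}

/-- Fenchel–Moreau for finite potentials: a real-valued, even, convex potential that is `C¹` along
lines and vanishes at zero is a dissipation potential together with its Legendre transform,
provided that the tangent vectors represent all linear functionals. -/
theorem symmetricDissipationPotentials_legendre (f : ∀ z, M.Cot z → ℝ)
    (hrep : ∀ z (v : M.Cot z →ₗ[ℝ] ℝ), ∃ w : M.Tan z, ∀ ξ, M.pair z w ξ = v ξ)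
    (hconv : ∀ z, ConvexOn ℝ univ (f z)) (heven : ∀ z ξ, f z (-ξ) = f z ξ)
    (hzero : ∀ z, f z 0 = 0)
    (hdiff : ∀ z ξ η, ContDiff ℝ 1 fun t : ℝ => f z (ξ + t • η)) :
    M.SymmetricDissipationPotentials
      (M.legendre fun z ξ => ((f z ξ : ℝ) : EReal)) (fun z ξ => ((f z ξ : ℝ) : EReal)) := by
  have hle : ∀ z v ξ, ((M.pair z v ξ - f z ξ : ℝ) : EReal)
      ≤ M.legendre (fun z ξ => ((f z ξ : ℝ) : EReal)) z v := fun z v ξ => by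
    rw [EReal.coe_sub]
    exact le_iSup (fun ξ : M.Cot z => ((M.pair z v ξ : ℝ) : EReal) - ((f z ξ : ℝ) : EReal)) ξ
  have hle' : ∀ z v (C : EReal), (∀ ξ, ((M.pair z v ξ - f z ξ : ℝ) : EReal) ≤ C) →
      M.legendre (fun z ξ => ((f z ξ : ℝ) : EReal)) z v ≤ C := fun z v C h => by
    refine iSup_le fun ξ => ?_
    rw [← EReal.coe_sub]
    exact h ξ
  have hnn : ∀ z ξ, 0 ≤ f z ξ := fun z ξ => by
    have h1 := (hconv z).2 (mem_univ ξ) (mem_univ (-ξ))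
      (by norm_num : (0 : ℝ) ≤ 1 / 2) (by norm_num : (0 : ℝ) ≤ 1 / 2) (by norm_num)
    have h2 : (1 / 2 : ℝ) • ξ + (1 / 2 : ℝ) • -ξ = 0 := by module
    rw [h2, hzero, heven] at h1
    simp only [smul_eq_mul] at h1
    linarith
  have hlnn : ∀ z v, 0 ≤ M.legendre (fun z ξ => ((f z ξ : ℝ) : EReal)) z v := fun z v => by
    have := hle z v 0
    simpa [hzero] using this
  refine
    { nonneg := hlnn
      nonneg_dual := fun z ξ => by exact_mod_cast hnn z ξ
      legendre := fun z v => rfl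
      legendre_dual := fun z ξ => ?_
      convex := fun z v w a b ha hb hab => ?_
      convex_dual := fun z ξ η a b ha hb hab => ?_
      contDiff_dual := fun z ξ η => ⟨_, hdiff z ξ η, fun t => rfl⟩
      zero := fun z => ?_
      zero_dual := fun z => by simp [hzero]
      symm := fun z v => ?_
      symm_dual := fun z ξ => by rw [heven] }
  · apply le_antisymm
    · obtain ⟨v, hv⟩ := exists_subgradient (hconv z)
        (fun ξ η => (hdiff z ξ η).differentiable one_ne_zero) ξ
      obtain ⟨w, hw⟩ := hrep z v
      have h1 : M.legendre (fun z ξ => ((f z ξ : ℝ) : EReal)) z w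
          ≤ ((M.pair z w ξ - f z ξ : ℝ) : EReal) := by
        refine hle' z w _ fun η => ?_
        have := hv η
        rw [map_sub] at this
        rw [hw, hw, EReal.coe_le_coe_iff]
        linarith
      refine le_trans ?_ (le_iSup (fun v : M.Tan z => ((M.pair z v ξ : ℝ) : EReal)
        - M.legendre (fun z ξ => ((f z ξ : ℝ) : EReal)) z v) w)
      refine le_trans ?_ (EReal.sub_le_sub le_rfl h1)
      rw [← EReal.coe_sub, EReal.coe_le_coe_iff]
      linarith
    · refine iSup_le fun v => ?_
      refine (EReal.sub_le_sub le_rfl (hle z v ξ)).trans ?_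
      rw [← EReal.coe_sub, EReal.coe_le_coe_iff]
      linarith
  · refine hle' _ _ _ fun ξ => ?_
    have h : M.pair z (a • v + b • w) ξ - f z ξ
        = a * (M.pair z v ξ - f z ξ) + b * (M.pair z w ξ - f z ξ) := by
      simp only [map_add, map_smul, LinearMap.add_apply, LinearMap.smul_apply, smul_eq_mul]
      linear_combination f z ξ * hab
    rw [h, EReal.coe_add, EReal.coe_mul, EReal.coe_mul]
    have ha' : (0 : EReal) ≤ a := by exact_mod_cast ha
    have hb' : (0 : EReal) ≤ b := by exact_mod_cast hb
    exact add_le_add (mul_le_mul_of_nonneg_left (hle z v ξ) ha')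
      (mul_le_mul_of_nonneg_left (hle z w ξ) hb')
  · have := (hconv z).2 (mem_univ ξ) (mem_univ η) ha hb hab
    simp only [smul_eq_mul] at this
    exact_mod_cast this
  · refine le_antisymm (hle' _ _ _ fun ξ => ?_) (hlnn z 0)
    have := hnn z ξ
    simp only [map_zero, LinearMap.zero_apply, zero_sub]
    exact_mod_cast neg_nonpos.2 this
  · have h : ∀ v, M.legendre (fun z ξ => ((f z ξ : ℝ) : EReal)) z (-v)
        ≤ M.legendre (fun z ξ => ((f z ξ : ℝ) : EReal)) z v := fun v => by
      refine hle' _ _ _ fun ξ => le_trans (le_of_eq ?_) (hle z v (-ξ))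
      rw [heven]
      simp
    refine le_antisymm (h v) ?_
    simpa using h (-v)

end Geometry

namespace Underdamped

variable {d : ℕ}

namespace MomentumGenerator

variable (G : MomentumGenerator d)

/-! ### Consequences of the maximum principle -/

variable {G} in
lemma comp_mem_dom {u : Conf d → ℝ} (hu : u ∈ G.dom) {ψ : ℝ → ℝ} (hψ : ContDiff ℝ 2 ψ) :
    (fun p => ψ (u p)) ∈ G.dom :=
  G.comp_mem 1 (fun _ => u) (fun _ => hu) (fun x => ψ (x 0)) (hψ.comp (contDiff_apply ℝ ℝ 0))

variable {G} in
lemma mul_mem_dom {u v : Conf d → ℝ} (hu : u ∈ G.dom) (hv : v ∈ G.dom) :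
    (fun p => u p * v p) ∈ G.dom := by
  refine G.comp_mem 2 ![u, v] (fun j => ?_) (fun x => x 0 * x 1)
    ((contDiff_apply ℝ ℝ 0).mul (contDiff_apply ℝ ℝ 1))
  fin_cases j <;> assumption

lemma const_mem_dom (c : ℝ) : (fun _ => c) ∈ G.dom :=
  G.comp_mem 0 Fin.elim0 (fun j => j.elim0) (fun _ => c) contDiff_const

lemma op_const (c : ℝ) : G.op (fun _ => c) = 0 := by
  have h : (fun _ : Conf d => c) = c • fun _ => (1 : ℝ) := by ext; simp
  rw [h, map_smul, G.op_one, smul_zero]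

variable {G} in
/-- The maximum principle as a comparison principle at a contact point. -/
lemma op_le_op {u w : Conf d → ℝ} (hu : u ∈ G.dom) (hw : w ∈ G.dom) (hle : ∀ p, u p ≤ w p)
    {p : Conf d} (hp : u p = w p) : G.op u p ≤ G.op w p := by
  have h := G.max_principle (u - w) (G.dom.sub_mem hu hw) p fun p' => by
    simp only [Pi.sub_apply, hp, sub_self]
    linarith [hle p']
  rw [map_sub, Pi.sub_apply] at h
  linarith

variable {G} in
/-- At a common zero `p` of `u` and `w`, the bound `|u| ≤ w` passes to `𝒢`. -/
lemma abs_op_le {u w : Conf d → ℝ} (hu : u ∈ G.dom) (hw : w ∈ G.dom)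
    (hle : ∀ p, |u p| ≤ w p) {p : Conf d} (hp : w p = 0) : |G.op u p| ≤ G.op w p := by
  have hup : u p = 0 := abs_nonpos_iff.1 (hp ▸ hle p)
  rw [abs_le]
  constructor
  · have := op_le_op (G.dom.neg_mem hw) hu (fun p => by
      simpa using (abs_le.1 (hle p)).1) (p := p) (by simp [hp, hup])
    simpa using this
  · exact op_le_op hu hw (fun p => (abs_le.1 (hle p)).2) (by rw [hp, hup])

/-- The exponential transform `e^{-f} 𝒢 e^f` of the generator. -/
def expLift (f : Phase d → ℝ) (y : Phase d) : ℝ :=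
  Real.exp (-f y) * G.lift (fun x => Real.exp (f x)) y

lemma expLift_eq (f : Phase d → ℝ) (y : Phase d) :
    G.expLift f y = G.op (fun p => Real.exp (f (y.1, p) - f y)) y.2 := by
  have h : (fun p => Real.exp (f (y.1, p) - f y))
      = Real.exp (-f y) • fun p => Real.exp (f (y.1, p)) := by
    ext p
    rw [Pi.smul_apply, smul_eq_mul, ← Real.exp_add]
    ring_nf
  rw [h, map_smul]
  rfl

lemma expLift_add_const (f : Phase d → ℝ) (c : ℝ) :
    G.expLift (fun y => f y + c) = G.expLift f := by
  ext y
  simp only [expLift_eq, add_sub_add_right_eq_sub]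

lemma expLift_zero : G.expLift (fun _ => 0) = 0 := by
  ext y
  simp only [expLift_eq, sub_self, Real.exp_zero, op_one, Pi.zero_apply]

variable {G}

lemma exp_sub_mem_dom {u : Conf d → ℝ} (hu : u ∈ G.dom) (c : ℝ) :
    (fun p => Real.exp (u p - c)) ∈ G.dom :=
  comp_mem_dom hu (ψ := fun x => Real.exp (x - c))
    (Real.contDiff_exp.comp (contDiff_id.sub contDiff_const))

/-- `𝒢 f ≤ e^{-f} 𝒢 e^f`, since `1 + x ≤ e^x` with equality at `0`. -/
lemma lift_le_expLift {f : Phase d → ℝ} {y : Phase d} (hf : (fun p => f (y.1, p)) ∈ G.dom) :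
    G.lift f y ≤ G.expLift f y := by
  rw [expLift_eq]
  have h1 : (fun p => f (y.1, p)) + (fun _ => 1 - f y) ∈ G.dom :=
    G.dom.add_mem hf (G.const_mem_dom _)
  have h2 := op_le_op h1 (exp_sub_mem_dom hf (f y)) (fun p => by
    have := Real.add_one_le_exp (f (y.1, p) - f y)
    simp only [Pi.add_apply]
    linarith) (p := y.2) (by simp)
  rw [map_add, op_const, add_zero] at h2
  exact h2

/-- `f ↦ e^{-f} 𝒢 e^f` is convex, pointwise. -/
lemma expLift_convex {f h : Phase d → ℝ} {y : Phase d} (hf : (fun p => f (y.1, p)) ∈ G.dom)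
    (hh : (fun p => h (y.1, p)) ∈ G.dom) {a b : ℝ} (ha : 0 ≤ a) (hb : 0 ≤ b) (hab : a + b = 1) :
    G.expLift (a • f + b • h) y ≤ a * G.expLift f y + b * G.expLift h y := by
  simp only [expLift_eq]
  have h1 : (fun p => (a • f + b • h) (y.1, p)) ∈ G.dom :=
    G.dom.add_mem (G.dom.smul_mem a hf) (G.dom.smul_mem b hh)
  have h2 := op_le_op (exp_sub_mem_dom h1 ((a • f + b • h) y))
    (G.dom.add_mem (G.dom.smul_mem a (exp_sub_mem_dom hf (f y)))
      (G.dom.smul_mem b (exp_sub_mem_dom hh (h y)))) (fun p => by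
    have h3 := convexOn_exp.2 (mem_univ (f (y.1, p) - f y)) (mem_univ (h (y.1, p) - h y)) ha hb hab
    simp only [Pi.add_apply, Pi.smul_apply, smul_eq_mul] at h3 ⊢
    refine le_trans (le_of_eq ?_) h3
    ring_nf) (p := y.2) (by simp [hab])
  rw [map_add, map_smul, map_smul] at h2
  exact h2

/-! ### Differentiability of the exponential transform along lines -/

lemma exp_line_mem_dom {X Y : Conf d → ℝ} (hX : X ∈ G.dom) (hY : Y ∈ G.dom) (t : ℝ) :
    (fun p => Real.exp (X p + t * Y p)) ∈ G.dom :=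
  comp_mem_dom (u := X + t • Y) (G.dom.add_mem hX (G.dom.smul_mem t hY)) Real.contDiff_exp

lemma exists_exp_line_le {X Y : Conf d → ℝ} (hX : X ∈ G.dom) (hY : Y ∈ G.dom) (t : ℝ) :
    ∃ B C : ℝ, 0 < B ∧ 0 ≤ C ∧ (∀ p, |Y p| ≤ B) ∧ ∀ p, Real.exp (X p + t * Y p) ≤ C := by
  obtain ⟨-, A, hA⟩ := G.isCb_dom X hX
  obtain ⟨-, B, hB⟩ := G.isCb_dom Y hY
  refine ⟨|B| + 1, Real.exp (A + |t| * B), by positivity, by positivity,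
    fun p => (hB p).trans (by linarith [le_abs_self B]), fun p => ?_⟩
  rw [Real.exp_le_exp]
  have h1 : t * Y p ≤ |t| * B := by
    refine (le_abs_self _).trans ?_
    rw [abs_mul]
    exact mul_le_mul_of_nonneg_left (hB p) (abs_nonneg t)
  linarith [(le_abs_self _).trans (hA p)]

/-- The Taylor remainder of `t ↦ e^{X + t Y}` is dominated by `h² Y²`, which vanishes at the point
`p`; by the maximum principle `𝒢` of it, at `p`, is dominated by `h² (𝒢 Y²)(p)`. -/
lemma hasDerivAt_op_exp_line {X Y : Conf d → ℝ} (hX : X ∈ G.dom) (hY : Y ∈ G.dom) {p : Conf d}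
    (hp : Y p = 0) (t : ℝ) :
    HasDerivAt (fun t : ℝ => G.op (fun p' => Real.exp (X p' + t * Y p')) p)
      (G.op (fun p' => Y p' * Real.exp (X p' + t * Y p')) p) t := by
  obtain ⟨B, C, hB0, hC0, hB, hC⟩ := exists_exp_line_le hX hY t
  rw [hasDerivAt_iff_isLittleO_nhds_zero]
  have key : (fun h : ℝ => G.op (fun p' => Real.exp (X p' + (t + h) * Y p')) p
      - G.op (fun p' => Real.exp (X p' + t * Y p')) p
      - h • G.op (fun p' => Y p' * Real.exp (X p' + t * Y p')) p)
      =O[𝓝 0] fun h : ℝ => h ^ 2 := by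
    refine Asymptotics.IsBigO.of_bound (C * G.op (fun p' => Y p' * Y p') p) ?_
    filter_upwards [Metric.ball_mem_nhds (0 : ℝ) (inv_pos.2 hB0)] with h hh
    have hh' : |h| ≤ B⁻¹ := by
      have := mem_ball_zero_iff.1 hh
      rw [Real.norm_eq_abs] at this
      exact this.le
    have h1 := G.dom.sub_mem (G.dom.sub_mem (exp_line_mem_dom hX hY (t + h))
      (exp_line_mem_dom hX hY t)) (G.dom.smul_mem h (mul_mem_dom hY (exp_line_mem_dom hX hY t)))
    have h2 := abs_op_le h1 (G.dom.smul_mem (C * h ^ 2) (mul_mem_dom hY hY)) (fun p' => by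
      have h3 : |h * Y p'| ≤ 1 := by
        rw [abs_mul]
        calc |h| * |Y p'| ≤ B⁻¹ * B := by gcongr; exact hB p'
          _ = 1 := inv_mul_cancel₀ hB0.ne'
      have h4 := Real.abs_exp_sub_one_sub_id_le h3
      have h5 : Real.exp (X p' + (t + h) * Y p')
          = Real.exp (X p' + t * Y p') * Real.exp (h * Y p') := by
        rw [← Real.exp_add]
        ring_nf
      simp only [Pi.sub_apply, Pi.smul_apply, smul_eq_mul, h5]
      calc |Real.exp (X p' + t * Y p') * Real.exp (h * Y p') - Real.exp (X p' + t * Y p')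
            - h * (Y p' * Real.exp (X p' + t * Y p'))|
          = Real.exp (X p' + t * Y p') * |Real.exp (h * Y p') - 1 - h * Y p'| := by
            rw [← abs_of_pos (Real.exp_pos (X p' + t * Y p')), ← abs_mul,
              abs_of_pos (Real.exp_pos (X p' + t * Y p'))]
            ring_nf
        _ ≤ C * (h * Y p') ^ 2 := by
            gcongr
            exact hC p'
        _ = C * h ^ 2 * (Y p' * Y p') := by ring) (p := p) (by simp [hp])
    simp only [map_sub, map_smul] at h2
    simp only [Pi.sub_apply, Pi.smul_apply, smul_eq_mul] at h2
    rw [Real.norm_eq_abs, Real.norm_eq_abs, abs_of_nonneg (sq_nonneg h), smul_eq_mul]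
    linarith
  exact key.trans_isLittleO (by simpa using Asymptotics.isLittleO_pow_id (one_lt_two))

/-- As for the derivative: the increments of `Y e^{X + t Y}` in `t` are dominated by `Y²`. -/
lemma continuous_op_mul_exp_line {X Y : Conf d → ℝ} (hX : X ∈ G.dom) (hY : Y ∈ G.dom)
    {p : Conf d} (hp : Y p = 0) :
    Continuous fun t : ℝ => G.op (fun p' => Y p' * Real.exp (X p' + t * Y p')) p := by
  rw [continuous_iff_continuousAt]
  intro t
  obtain ⟨B, C, hB0, hC0, hB, hC⟩ := exists_exp_line_le hX hY t
  have key : ∀ᶠ s in 𝓝 t, dist (G.op (fun p' => Y p' * Real.exp (X p' + s * Y p')) p)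
      (G.op (fun p' => Y p' * Real.exp (X p' + t * Y p')) p)
      ≤ (C * 2 * G.op (fun p' => Y p' * Y p') p) * |s - t| := by
    filter_upwards [Metric.ball_mem_nhds t (inv_pos.2 hB0)] with s hs
    have hh' : |s - t| ≤ B⁻¹ := by
      rw [Metric.mem_ball, Real.dist_eq] at hs
      exact hs.le
    have h1 := G.dom.sub_mem (mul_mem_dom hY (exp_line_mem_dom hX hY s))
      (mul_mem_dom hY (exp_line_mem_dom hX hY t))
    have h2 := abs_op_le h1 (G.dom.smul_mem (C * 2 * |s - t|) (mul_mem_dom hY hY)) (fun p' => by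
      have h3 : |(s - t) * Y p'| ≤ 1 := by
        rw [abs_mul]
        calc |s - t| * |Y p'| ≤ B⁻¹ * B := by gcongr; exact hB p'
          _ = 1 := inv_mul_cancel₀ hB0.ne'
      have h4 := Real.abs_exp_sub_one_le h3
      have h5 : Real.exp (X p' + s * Y p')
          = Real.exp (X p' + t * Y p') * Real.exp ((s - t) * Y p') := by
        rw [← Real.exp_add]
        ring_nf
      simp only [Pi.sub_apply, Pi.smul_apply, smul_eq_mul, h5]
      calc |Y p' * (Real.exp (X p' + t * Y p') * Real.exp ((s - t) * Y p'))
            - Y p' * Real.exp (X p' + t * Y p')|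
          = Real.exp (X p' + t * Y p') * |Real.exp ((s - t) * Y p') - 1| * |Y p'| := by
            rw [← abs_of_pos (Real.exp_pos (X p' + t * Y p')), ← abs_mul, ← abs_mul,
              abs_of_pos (Real.exp_pos (X p' + t * Y p'))]
            ring_nf
        _ ≤ C * (2 * |(s - t) * Y p'|) * |Y p'| := by
            gcongr
            exact hC p'
        _ = C * 2 * |s - t| * (Y p' * Y p') := by
            rw [abs_mul, ← abs_mul_abs_self (Y p')]
            ring) (p := p) (by simp [hp])
    simp only [map_sub, map_smul] at h2
    simp only [Pi.sub_apply, Pi.smul_apply, smul_eq_mul] at h2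
    rw [Real.dist_eq]
    linarith
  have h0 : Tendsto (fun s : ℝ => (C * 2 * G.op (fun p' => Y p' * Y p') p) * |s - t|) (𝓝 t)
      (𝓝 0) := by
    have : Continuous fun s : ℝ => (C * 2 * G.op (fun p' => Y p' * Y p') p) * |s - t| := by
      fun_prop
    simpa using this.tendsto t
  rw [ContinuousAt, tendsto_iff_dist_tendsto_zero]
  exact squeeze_zero' (Eventually.of_forall fun _ => dist_nonneg) key h0

/-- The derivative of `t ↦ e^{-(f + t h)} 𝒢 e^{f + t h}`. -/
def expLiftDeriv (G : MomentumGenerator d) (f h : Phase d → ℝ) (t : ℝ) (y : Phase d) : ℝ :=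
  G.op (fun p => (h (y.1, p) - h y)
    * Real.exp ((f (y.1, p) - f y) + t * (h (y.1, p) - h y))) y.2

lemma sub_const_mem_dom {u : Conf d → ℝ} (hu : u ∈ G.dom) (c : ℝ) :
    (fun p => u p - c) ∈ G.dom :=
  G.dom.sub_mem hu (G.const_mem_dom c)

lemma hasDerivAt_expLift {f h : Phase d → ℝ} {y : Phase d} (hf : (fun p => f (y.1, p)) ∈ G.dom)
    (hh : (fun p => h (y.1, p)) ∈ G.dom) (t : ℝ) :
    HasDerivAt (fun t : ℝ => G.expLift (f + t • h) y) (G.expLiftDeriv f h t y) t := by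
  have h1 := hasDerivAt_op_exp_line (sub_const_mem_dom hf (f y)) (sub_const_mem_dom hh (h y))
    (p := y.2) (by simp) t
  refine h1.congr_of_eventuallyEq (Eventually.of_forall fun s => ?_)
  simp only [expLift_eq, Pi.add_apply, Pi.smul_apply, smul_eq_mul]
  refine congrFun (congrArg G.op (funext fun p => congrArg Real.exp ?_)) y.2
  ring

lemma continuous_expLiftDeriv {f h : Phase d → ℝ} {y : Phase d}
    (hf : (fun p => f (y.1, p)) ∈ G.dom) (hh : (fun p => h (y.1, p)) ∈ G.dom) :
    Continuous fun t => G.expLiftDeriv f h t y :=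
  continuous_op_mul_exp_line (sub_const_mem_dom hf (f y)) (sub_const_mem_dom hh (h y))
    (p := y.2) (by simp)

variable {T : G.TestSpace}

lemma TestSpace.integrable_expLift {f : Phase d → ℝ} (hf : f ∈ T.space) {r : Phase d → ℝ}
    (hr : Integrable r) : Integrable fun y => G.expLift f y * r y := by
  obtain ⟨hc, C, hC⟩ := T.isCb_exp f hf
  exact hr.bdd_mul hc.aestronglyMeasurable (Eventually.of_forall fun y => hC y)

lemma TestSpace.integrable_lift {f : Phase d → ℝ} (hf : f ∈ T.space) {r : Phase d → ℝ}
    (hr : Integrable r) : Integrable fun y => G.lift f y * r y := by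
  obtain ⟨hc, C, hC⟩ := T.isCb_lift f hf
  exact hr.bdd_mul hc.aestronglyMeasurable (Eventually.of_forall fun y => hC y)

/-- The derivatives of a family of uniformly bounded convex functions are locally uniformly
bounded. -/
lemma TestSpace.exists_abs_expLiftDeriv_le {f h : Phase d → ℝ} (hf : f ∈ T.space)
    (hh : h ∈ T.space) (R : ℝ) :
    ∃ C : ℝ, ∀ y, ∀ t, |t| ≤ R → |G.expLiftDeriv f h t y| ≤ C := by
  -- The slope on `[-R, R]` is bounded by difference quotients of step `1`, which need bounds of the
  -- function on `[-S, S]`: above by its values at `±S`, below by reflection at `0`.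
  set S := |R| + 1 with hS
  have hline : ∀ t : ℝ, f + t • h ∈ T.space := fun t =>
    T.space.add_mem hf (T.space.smul_mem t hh)
  obtain ⟨-, C₀, hC₀⟩ := T.isCb_exp _ (hline 0)
  obtain ⟨-, C₁, hC₁⟩ := T.isCb_exp _ (hline S)
  obtain ⟨-, C₂, hC₂⟩ := T.isCb_exp _ (hline (-S))
  change ∀ y, |G.expLift (f + (0 : ℝ) • h) y| ≤ C₀ at hC₀
  change ∀ y, |G.expLift (f + S • h) y| ≤ C₁ at hC₁
  change ∀ y, |G.expLift (f + (-S) • h) y| ≤ C₂ at hC₂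
  refine ⟨2 * max C₁ C₂ + 2 * C₀, fun y t ht => ?_⟩
  have hfy := T.slice_mem f hf y.1
  have hhy := T.slice_mem h hh y.1
  set c : ℝ → ℝ := fun t => G.expLift (f + t • h) y with hc
  have hcc : ConvexOn ℝ univ c := by
    refine ⟨convex_univ, fun s _ t _ a b ha hb hab => ?_⟩
    have h1 := expLift_convex (G := G) (T.slice_mem _ (hline s) y.1) (T.slice_mem _ (hline t) y.1)
      ha hb hab
    have h2 : a • (f + s • h) + b • (f + t • h) = (a + b) • f + (a * s + b * t) • h := by module
    rw [h2, hab, one_smul] at h1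
    exact h1
  have hup : ∀ s, |s| ≤ S → c s ≤ max C₁ C₂ := fun s hs => by
    have h1 := hcc.le_max_of_mem_Icc (mem_univ (-S)) (mem_univ S) (abs_le.1 hs)
    refine h1.trans ?_
    rw [max_comm]
    exact max_le_max ((le_abs_self _).trans (hC₁ y)) ((le_abs_self _).trans (hC₂ y))
  have hlow : ∀ s, |s| ≤ S → -(max C₁ C₂ + 2 * C₀) ≤ c s := fun s hs => by
    have h1 := hcc.2 (mem_univ s) (mem_univ (-s)) (by norm_num : (0 : ℝ) ≤ 1 / 2)
      (by norm_num : (0 : ℝ) ≤ 1 / 2) (by norm_num)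
    have h2 := hup (-s) (by rwa [abs_neg])
    have h3 := (abs_le.1 (hC₀ y)).1
    have h4 : (1 / 2 : ℝ) • s + (1 / 2 : ℝ) • -s = 0 := by module
    rw [h4] at h1
    change -C₀ ≤ c 0 at h3
    simp only [smul_eq_mul] at h1
    linarith
  have hR := le_abs_self R
  have hRt := abs_le.1 ht
  have hd : HasDerivAt c (G.expLiftDeriv f h t y) t := hasDerivAt_expLift hfy hhy t
  have b0 : |t| ≤ S := by linarith
  have b1 : |t + 1| ≤ S := abs_le.2 ⟨by linarith, by linarith⟩
  have b2 : |t - 1| ≤ S := abs_le.2 ⟨by linarith, by linarith⟩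
  have h1 := hcc.le_slope_of_hasDerivAt (mem_univ t) (mem_univ (t + 1)) (by linarith) hd
  have h2 := hcc.slope_le_of_hasDerivAt (mem_univ (t - 1)) (mem_univ t) (by linarith) hd
  rw [slope_def_field] at h1 h2
  have e1 : t + 1 - t = 1 := by ring
  have e2 : t - (t - 1) = 1 := by ring
  rw [e1, div_one] at h1
  rw [e2, div_one] at h2
  have := hup _ b1
  have := hup _ b2
  have := hlow _ b0
  exact abs_le.2 ⟨by linarith, by linarith⟩

/-- Differentiation under the integral. The integrand is measurable as a limit of difference
quotients, and the locally uniform bound on it comes from convexity. -/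
lemma TestSpace.contDiff_integral_expLift {f h : Phase d → ℝ} (hf : f ∈ T.space)
    (hh : h ∈ T.space) {r : Phase d → ℝ} (hr : Integrable r) :
    ContDiff ℝ 1 fun t : ℝ => ∫ y, G.expLift (f + t • h) y * r y := by
  have hline : ∀ t : ℝ, f + t • h ∈ T.space := fun t =>
    T.space.add_mem hf (T.space.smul_mem t hh)
  have hd : ∀ y t, HasDerivAt (fun t : ℝ => G.expLift (f + t • h) y) (G.expLiftDeriv f h t y) t :=
    fun y t => hasDerivAt_expLift (T.slice_mem f hf y.1) (T.slice_mem h hh y.1) t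
  have hm : ∀ t, Measurable (G.expLiftDeriv f h t) := fun t => by
    refine measurable_of_tendsto_metrizable
      (f := fun (n : ℕ) (y : Phase d) => ((n : ℝ) + 1) *
        (G.expLift (f + (t + ((n : ℝ) + 1)⁻¹) • h) y - G.expLift (f + t • h) y)) (fun n => ?_) ?_
    · exact (((T.isCb_exp _ (hline _)).1.sub (T.isCb_exp _ (hline _)).1).measurable).const_mul _
    · rw [tendsto_pi_nhds]
      intro y
      have h1 := (hasDerivAt_iff_tendsto_slope_zero.1 (hd y t)).comp
        (f := fun n : ℕ => ((n : ℝ) + 1)⁻¹) (x := atTop) (by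
          refine tendsto_nhdsWithin_iff.2 ⟨?_, Eventually.of_forall fun n => ?_⟩
          · simpa using tendsto_one_div_add_atTop_nhds_zero_nat (𝕜 := ℝ)
          · exact inv_ne_zero (by positivity))
      simpa [Function.comp_def] using h1
  have hderiv : ∀ t, HasDerivAt (fun t : ℝ => ∫ y, G.expLift (f + t • h) y * r y)
      (∫ y, G.expLiftDeriv f h t y * r y) t := fun t => by
    obtain ⟨C, hC⟩ := T.exists_abs_expLiftDeriv_le hf hh (|t| + 1)
    refine (hasDerivAt_integral_of_dominated_loc_of_deriv_le (bound := fun y => C * |r y|)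
      (Metric.ball_mem_nhds t one_pos) (Eventually.of_forall fun s => ?_)
      (T.integrable_expLift (hline t) hr) ?_ (Eventually.of_forall fun y s hs => ?_)
      (hr.abs.const_mul C) (Eventually.of_forall fun y s _ => (hd y s).mul_const (r y))).2
    · exact (T.integrable_expLift (hline s) hr).aestronglyMeasurable
    · exact (hm t).aestronglyMeasurable.mul hr.aestronglyMeasurable
    · rw [norm_mul, Real.norm_eq_abs, Real.norm_eq_abs]
      gcongr
      refine hC y s ?_
      rw [Metric.mem_ball, Real.dist_eq] at hs
      have := abs_sub_abs_le_abs_sub s t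
      linarith
  rw [contDiff_one_iff_deriv]
  refine ⟨fun t => (hderiv t).differentiableAt, ?_⟩
  rw [funext fun t => (hderiv t).deriv, continuous_iff_continuousAt]
  intro t
  obtain ⟨C, hC⟩ := T.exists_abs_expLiftDeriv_le hf hh (|t| + 1)
  refine continuousAt_of_dominated (bound := fun y => C * |r y|)
    (Eventually.of_forall fun s => (hm s).aestronglyMeasurable.mul hr.aestronglyMeasurable)
    ?_ (hr.abs.const_mul C) (Eventually.of_forall fun y => ?_)
  · filter_upwards [Metric.ball_mem_nhds t one_pos] with s hs
    refine Eventually.of_forall fun y => ?_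
    rw [norm_mul, Real.norm_eq_abs, Real.norm_eq_abs]
    gcongr
    refine hC y s ?_
    rw [Metric.mem_ball, Real.dist_eq] at hs
    have := abs_sub_abs_le_abs_sub s t
    linarith
  · exact ((continuous_expLiftDeriv (T.slice_mem f hf y.1) (T.slice_mem h hh y.1)).mul
      continuous_const).continuousAt

/-! ### Reversibility -/

/-- If `r = e^{2 g} c(q) ρ_m(p)`, then `∫ e^{-(f + g)} (𝒢 e^{f + g}) dr` is the integral over `q` of
`c(q) ∫ e^{g - f} 𝒢 e^{g + f} dρ_m`, which is even in `f` by reversibility. -/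
lemma TestSpace.integral_expLift_neg {m : ℝ} (hrev : G.Reversible m) {f g r : Phase d → ℝ}
    {c : Conf d → ℝ} (hf : f ∈ T.space) (hg : g ∈ T.space) (hr : Integrable r)
    (hrg : ∀ y, r y = Real.exp (2 * g y) * c y.1 * maxwellian m y.2) :
    ∫ y, G.expLift (-f + g) y * r y = ∫ y, G.expLift (f + g) y * r y := by
  have i1 := T.integrable_expLift (T.space.add_mem (T.space.neg_mem hf) hg) hr
  have i2 := T.integrable_expLift (T.space.add_mem hf hg) hr
  have key : ∀ h : Phase d → ℝ, ∀ q p, G.expLift (h + g) (q, p) * r (q, p)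
      = c q * (Real.exp (-h (q, p) + g (q, p))
        * G.op (fun p => Real.exp (h (q, p) + g (q, p))) p * maxwellian m p) := by
    intro h q p
    have h1 : Real.exp (-(h + g) (q, p)) * Real.exp (2 * g (q, p))
        = Real.exp (-h (q, p) + g (q, p)) := by
      rw [← Real.exp_add, Pi.add_apply]
      ring_nf
    rw [hrg, ← h1]
    simp only [expLift, lift, Pi.add_apply]
    ring
  rw [Measure.volume_eq_prod] at i1 i2 ⊢
  rw [integral_prod _ i1, integral_prod _ i2]
  refine integral_congr_ae (Eventually.of_forall fun q => ?_)
  simp only [key, integral_const_mul]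
  congr 1
  -- Both sides pair `e^{g + f}` and `e^{g - f}`, with `𝒢` acting on one or the other.
  have e : ∀ h ∈ T.space, (fun p => Real.exp (h (q, p) + g (q, p))) ∈ G.dom := fun h hh =>
    comp_mem_dom (T.slice_mem _ (T.space.add_mem hh hg) q) Real.contDiff_exp
  have h1 := hrev _ (e f hf) _ (e (-f) (T.space.neg_mem hf))
  simpa only [Pi.neg_apply, neg_neg] using h1

end MomentumGenerator

namespace MomentumGenerator

/-! ### Sampling a probability measure by empirical measures -/

lemma integral_empirical {n : ℕ} (y : Fin n → Phase d) (g : Phase d → ℝ) :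
    ∫ x, g x ∂(empirical y) = (∑ i, g (y i)) / n := by
  rw [empirical, integral_smul_measure, integral_finsetSum_measure]
  · simp [div_eq_inv_mul]
  · exact fun i _ => integrable_dirac (by simp)

open ProbabilityTheory in
/-- A sample of independent particles has, almost surely, empirical measures with the required
limits: weak convergence follows from the law of large numbers for the countably many finite
unions of sets of a countable basis, by the portmanteau theorem. -/
theorem exists_empirical_tendsto (μ : Measure (Phase d)) [IsProbabilityMeasure μ]
    {f : Phase d → ℝ} (hfm : Measurable f) (hf : Integrable f μ) :
    ∃ y : ∀ n : ℕ, Fin n → Phase d,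
      (∀ g : BoundedContinuousFunction (Phase d) ℝ,
        Tendsto (fun n => ∫ x, g x ∂(empirical (y n))) atTop (𝓝 (∫ x, g x ∂μ))) ∧
      Tendsto (fun n => ∫ x, f x ∂(empirical (y n))) atTop (𝓝 (∫ x, f x ∂μ)) := by
  obtain ⟨Ω, _, P, X, hXm, hX, hind, hP⟩ := exists_iid ℕ μ
  have lln : ∀ h : Phase d → ℝ, Measurable h → Integrable h μ →
      ∀ᵐ o ∂P, Tendsto (fun n : ℕ => ∫ x, h x ∂(empirical fun i : Fin n => X i o)) atTop
        (𝓝 (∫ x, h x ∂μ)) := by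
    intro h hm hi
    have h1 := strong_law_ae_real (μ := P) (fun i o => h (X i o))
      ((hX 0).map_eq ▸ hi |>.comp_measurable (hXm 0))
      (fun i j hij => (hind.indepFun hij).comp hm hm)
      (fun i => (IdentDistrib.mk (hXm i).aemeasurable (hXm 0).aemeasurable
        ((hX i).map_eq.trans (hX 0).map_eq.symm)).comp hm)
    have h2 : P[fun o => h (X 0 o)] = ∫ x, h x ∂μ := by
      rw [← (hX 0).map_eq, integral_map (hXm 0).aemeasurable hm.aestronglyMeasurable]
    rw [h2] at h1
    filter_upwards [h1] with o h_lim
    refine h_lim.congr fun n => ?_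
    rw [integral_empirical, Finset.sum_range fun i => h (X i o)]
  let b := TopologicalSpace.countableBasis (Phase d)
  have hbc : Countable b := TopologicalSpace.countable_countableBasis _
  let U : Finset b → Set (Phase d) := fun F => ⋃ s ∈ F, s.1
  have hUm : ∀ F, MeasurableSet (U F) := fun F =>
    (isOpen_biUnion fun s _ => TopologicalSpace.isOpen_of_mem_countableBasis s.2).measurableSet
  have hall : ∀ᵐ o ∂P, ∀ F : Finset b, Tendsto
      (fun n : ℕ => ∫ x, (U F).indicator 1 x ∂(empirical fun i : Fin n => X i o)) atTop
        (𝓝 (∫ x, (U F).indicator 1 x ∂μ)) :=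
    ae_all_iff.2 fun F => lln _ (measurable_one.indicator (hUm F))
      ((integrable_const (1 : ℝ)).indicator (hUm F))
  obtain ⟨o, h_lim, h_lim_f⟩ := (hall.and (lln f hfm hf)).exists
  refine ⟨fun n i => X i o, fun g => ?_, h_lim_f⟩
  -- The empirical measure of `0` particles is zero, hence the shift of the index by one.
  have hprob : ∀ n : ℕ, IsProbabilityMeasure (empirical fun i : Fin (n + 1) => X i o) := fun n => by
    refine ⟨?_⟩
    simp only [empirical, Measure.smul_apply, Measure.finsetSum_apply, measure_univ,
      Finset.sum_const, Finset.card_univ, Fintype.card_fin, nsmul_eq_mul, mul_one, smul_eq_mul]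
    exact ENNReal.inv_mul_cancel (by simp) (ENNReal.natCast_ne_top _)
  have hweak := tendsto_of_forall_isOpen_le_liminf_nat' (μ := ⟨μ, inferInstance⟩)
    (μs := fun n => ⟨empirical fun i : Fin (n + 1) => X i o, hprob n⟩) (fun O hO => by
      let I := {F : Finset b // ∀ s ∈ F, s.1 ⊆ O}
      have hI : Countable I := Subtype.countable
      have hOU : O = ⋃ F : I, U F.1 := by
        apply Subset.antisymm
        · intro x hx
          obtain ⟨s, hs, hxs, hsO⟩ :=
            (TopologicalSpace.isBasis_countableBasis (Phase d)).exists_subset_of_mem_open hx hO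
          refine mem_iUnion.2 ⟨⟨{⟨s, hs⟩}, by simpa using hsO⟩, ?_⟩
          simpa [U] using And.intro hs hxs
        · exact iUnion_subset fun F => iUnion₂_subset fun s hs => F.2 s hs
      have hdir : Directed (· ⊆ ·) fun F : I => U F.1 := by
        classical
        intro F F'
        refine ⟨⟨F.1 ∪ F'.1, fun s hs => ?_⟩, ?_, ?_⟩
        · rcases Finset.mem_union.1 hs with h | h
          exacts [F.2 s h, F'.2 s h]
        · exact biUnion_subset_biUnion_left fun s hs => Finset.mem_union_left _ hs
        · exact biUnion_subset_biUnion_left fun s hs => Finset.mem_union_right _ hs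
      change μ O ≤ liminf (fun n : ℕ => (empirical fun i : Fin (n + 1) => X i o) O) atTop
      have hsup : μ O = ⨆ F : I, μ (U F.1) := by
        conv_lhs => rw [hOU]
        exact hdir.measure_iUnion
      rw [hsup]
      refine iSup_le fun F => ?_
      have h1 := (tendsto_add_atTop_iff_nat 1).2 (h_lim F.1)
      simp only [integral_indicator_one (hUm F.1), measureReal_def] at h1
      rw [ENNReal.tendsto_toReal_iff (fun n => by have := hprob n; exact measure_ne_top _ _)
        (measure_ne_top _ _)] at h1
      rw [← h1.liminf_eq]
      refine liminf_le_liminf (Eventually.of_forall fun n => measure_mono ?_)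
      exact iUnion₂_subset fun s hs => F.2 s hs)
  rw [← tendsto_add_atTop_iff_nat 1]
  exact (ProbabilityMeasure.tendsto_iff_forall_integral_tendsto.1 hweak) g

/-! ### The limit Hamiltonian of linear functionals -/

variable {G : MomentumGenerator d} {T : G.TestSpace}

/-- For the cylinder function `F(ρ) = ⟨f, ρ⟩` the `n`-particle Hamiltonian is the
empirical average of `e^{-f} 𝒢 e^f`. -/
lemma hamiltonian_linear {n : ℕ} (f : Phase d → ℝ) (y : Fin n → Phase d) :
    G.hamiltonian n (cylinder (fun x : Fin 1 → ℝ => x 0) fun _ => f) y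
      = ∫ x, G.expLift f x ∂(empirical y) := by
  rcases Nat.eq_zero_or_pos n with rfl | hn
  · simp [hamiltonian, integral_empirical]
  have hn' : (n : ℝ) ≠ 0 := by positivity
  have hF : ∀ x : Fin n → Phase d,
      n * cylinder (fun x : Fin 1 → ℝ => x 0) (fun _ => f) (empirical x) = ∑ i, f (x i) := by
    intro x
    simp only [cylinder, integral_empirical]
    field_simp
  simp only [hamiltonian, hF, integral_empirical, particles]
  rw [mul_assoc, ← div_eq_inv_mul, Finset.mul_sum]
  congr 1
  refine Finset.sum_congr rfl fun i _ => ?_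
  have h1 : ∀ x, ∑ j, f (Function.update y i x j) = (∑ j, f (y j) - f (y i)) + f x := by
    intro x
    rw [← Finset.add_sum_erase _ _ (Finset.mem_univ i),
      ← Finset.add_sum_erase Finset.univ (fun j => f (y j)) (Finset.mem_univ i),
      Function.update_self, add_sub_cancel_left, add_comm]
    congr 1
    refine Finset.sum_congr rfl fun j hj => ?_
    rw [Function.update_of_ne (Finset.ne_of_mem_erase hj)]
  simp only [h1, Real.exp_add, lift]
  have h2 : (fun p => Real.exp (∑ j, f (y j) - f (y i)) * Real.exp (f ((y i).1, p)))
      = Real.exp (∑ j, f (y j) - f (y i)) • fun p => Real.exp (f ((y i).1, p)) := rfl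
  rw [h2, map_smul, Pi.smul_apply, smul_eq_mul, ← mul_assoc, ← Real.exp_add, expLift, lift]
  ring_nf

/-- The limit Hamiltonian is `ℋ₂(ρ, f) = ⟨e^{-f} 𝒢 e^f, ρ⟩`. -/
theorem HasLimitHamiltonian.eq_integral_expLift {H₂ : Measure (Phase d) → (Phase d → ℝ) → ℝ}
    (hlim : G.HasLimitHamiltonian T H₂) (μ : Measure (Phase d)) [IsProbabilityMeasure μ]
    {f : Phase d → ℝ} (hf : f ∈ T.space) (hfi : Integrable f μ) :
    H₂ μ f = ∫ y, G.expLift f y ∂μ := by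
  obtain ⟨y, hy, hyf⟩ := exists_empirical_tendsto μ (T.contDiff f hf).continuous.measurable hfi
  have h1 := hlim 1 (fun x => x 0) (fun _ => f) (contDiff_apply ℝ ℝ 0) (fun _ => hf) μ
    inferInstance (fun _ => hfi) y hy (fun _ => hyf)
  have h2 : dCylinder (fun x : Fin 1 → ℝ => x 0) (fun _ => f) μ = f := by
    ext x
    have : HasFDerivAt (fun x : Fin 1 → ℝ => x 0) (ContinuousLinearMap.proj (R := ℝ) 0)
        (fun _ => ∫ x, f x ∂μ) := hasFDerivAt_apply (0 : Fin 1) _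
    simp only [dCylinder, this.fderiv, ContinuousLinearMap.proj_apply]
  rw [h2] at h1
  simp only [hamiltonian_linear] at h1
  obtain ⟨hc, C, hC⟩ := T.isCb_exp f hf
  exact tendsto_nhds_unique h1
    (hy (BoundedContinuousFunction.ofNormedAddCommGroup (G.expLift f) hc C hC))

end MomentumGenerator

/-! ### Functions dominated by a positive density -/

/-- `g` is continuous and bounded by a multiple of `r`: multiplication by `g / r` then maps
`L¹`-functions with respect to `r` to Lebesgue integrable functions. -/
def DominatedBy {A : Type*} [TopologicalSpace A] (r g : A → ℝ) : Prop :=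
  Continuous g ∧ ∃ C : ℝ, ∀ y, |g y| ≤ C * r y

namespace DominatedBy

section

variable {A : Type*} [TopologicalSpace A] {r g g' : A → ℝ}

lemma refl (hr : Continuous r) (hpos : ∀ y, 0 < r y) : DominatedBy r r :=
  ⟨hr, 1, fun y => by rw [abs_of_pos (hpos y), one_mul]⟩

lemma add (h : DominatedBy r g) (h' : DominatedBy r g') : DominatedBy r fun y => g y + g' y := by
  obtain ⟨hg, C, hC⟩ := h
  obtain ⟨hg', C', hC'⟩ := h'
  refine ⟨hg.add hg', C + C', fun y => (abs_add_le _ _).trans ?_⟩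
  rw [add_mul]
  exact add_le_add (hC y) (hC' y)

lemma const_mul (c : ℝ) (h : DominatedBy r g) : DominatedBy r fun y => c * g y := by
  obtain ⟨hg, C, hC⟩ := h
  refine ⟨continuous_const.mul hg, |c| * C, fun y => ?_⟩
  rw [abs_mul, mul_assoc]
  exact mul_le_mul_of_nonneg_left (hC y) (abs_nonneg c)

lemma of_hasCompactSupport (hr : Continuous r) (hpos : ∀ y, 0 < r y) (hg : Continuous g)
    (hc : HasCompactSupport g) : DominatedBy r g := by
  have h1 : HasCompactSupport fun y => g y * (r y)⁻¹ := hc.mul_right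
  obtain ⟨C, hC⟩ := h1.exists_bound_of_continuous (hg.mul (hr.inv₀ fun y => (hpos y).ne'))
  refine ⟨hg, C, fun y => ?_⟩
  have h2 := hC y
  rw [norm_mul, norm_inv, Real.norm_eq_abs, Real.norm_eq_abs, abs_of_pos (hpos y)] at h2
  rwa [← div_eq_mul_inv, div_le_iff₀ (hpos y)] at h2

lemma prod (h : DominatedBy r g) (h' : DominatedBy r g') :
    DominatedBy (fun z : A × A => r z.1 * r z.2) fun z => g z.1 * g' z.2 := by
  obtain ⟨hg, C, hC⟩ := h
  obtain ⟨hg', C', hC'⟩ := h'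
  refine ⟨by fun_prop, C * C', fun z => ?_⟩
  rw [abs_mul]
  calc |g z.1| * |g' z.2| ≤ (C * r z.1) * (C' * r z.2) :=
        mul_le_mul (hC _) (hC' _) (abs_nonneg _) ((abs_nonneg _).trans (hC _))
    _ = _ := by ring

lemma integrable_mul [MeasurableSpace A] [OpensMeasurableSpace A] {μ : Measure A}
    (h : DominatedBy r g) (hr : Continuous r) (hpos : ∀ y, 0 < r y) {F : A → ℝ}
    (hF : Integrable (fun y => F y * r y) μ) : Integrable (fun y => F y * g y) μ := by
  obtain ⟨hg, C, hC⟩ := h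
  have hc : Continuous fun y => g y / r y := hg.div hr fun y => (hpos y).ne'
  refine (hF.bdd_mul (c := C) hc.stronglyMeasurable.aestronglyMeasurable
    (Eventually.of_forall fun y => ?_)).congr (Eventually.of_forall fun y => ?_)
  · rw [norm_div, Real.norm_eq_abs, Real.norm_eq_abs, abs_of_pos (hpos y),
      div_le_iff₀ (hpos y)]
    exact hC y
  · have := (hpos y).ne'
    field_simp

end

end DominatedBy

/-! ### Convolution in the position variable -/

section PositionConvolution

instance isAddHaarMeasure_volume : (volume : Measure (Phase d)).IsAddHaarMeasure := by
  rw [Measure.volume_eq_prod]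
  infer_instance

instance isNegInvariant_volume : (volume : Measure (Phase d)).IsNegInvariant :=
  Measure.IsAddHaarMeasure.isNegInvariant_of_regular _

variable {F F' : Type*} [NormedAddCommGroup F] [NormedSpace ℝ F] [NormedAddCommGroup F']
  [NormedSpace ℝ F']

/-- The convolution in the position variable of a compactly supported function `h` on phase space
with a kernel `K` is as smooth as `h`. -/
lemma contDiff_positionConvolution {E : Type*} [NormedAddCommGroup E] [NormedSpace ℝ E] {n : ℕ∞}
    (B : F →L[ℝ] F' →L[ℝ] E) {h : Phase d → F}
    (hh : ContDiff ℝ n h) (hc : HasCompactSupport h) {K : Conf d → F'} (hK : Continuous K) :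
    ContDiff ℝ n fun q => ∫ y, B (h y) (K (q - y.1)) := by
  have h1 := hc.contDiff_convolution_left B hh (μ := (volume : Measure (Phase d)))
    (g := fun y : Phase d => K y.1) (by fun_prop : Continuous _).locallyIntegrable
  exact h1.comp (contDiff_id.prodMk (contDiff_const (c := (0 : Conf d))))

set_option maxSynthPendingDepth 4 in
/-- Bounds on a convolution in the position variable, and on its derivative, in terms of a local
bound `w` of the kernel. The derivative falls on `h`, hence no derivative of `K` occurs. -/
lemma exists_positionConvolution_le (B : F →L[ℝ] F' →L[ℝ] ℝ) {h : Phase d → F}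
    (hh : ContDiff ℝ 1 h) (hc : HasCompactSupport h) {K : Conf d → F'} (hK : Continuous K) :
    ∃ R C : ℝ, 0 ≤ R ∧ ∀ w : Conf d → ℝ, (∀ q q' : Conf d, ‖q'‖ ≤ R → ‖K (q - q')‖ ≤ w q) →
      ∀ q, |∫ y, B (h y) (K (q - y.1))| ≤ C * w q ∧
        ‖fderiv ℝ (fun q => ∫ y, B (h y) (K (q - y.1))) q‖ ≤ C * w q := by
  obtain ⟨R, hR⟩ := hc.isCompact.isBounded.subset_closedBall (0 : Phase d)
  have hi1 : Integrable fun y => ‖h y‖ :=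
    hh.continuous.norm.integrable_of_hasCompactSupport hc.norm
  have hi2 : Integrable fun y => ‖fderiv ℝ h y‖ :=
    (hh.continuous_fderiv one_ne_zero).norm.integrable_of_hasCompactSupport (hc.fderiv ℝ).norm
  have hK' : Continuous fun y : Phase d => K y.1 := by fun_prop
  have key : ∀ {E E' : Type _} [NormedAddCommGroup E] [NormedSpace ℝ E] [NormedAddCommGroup E']
      [NormedSpace ℝ E'] (B : E →L[ℝ] F' →L[ℝ] E') (h' : Phase d → E),
      (∀ y, h' y ≠ 0 → y ∈ tsupport h) → Integrable (fun y => ‖h' y‖) →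
      ∀ w : Conf d → ℝ, (∀ q q' : Conf d, ‖q'‖ ≤ |R| → ‖K (q - q')‖ ≤ w q) →
      ∀ q, ‖∫ y, B (h' y) (K (q - y.1))‖ ≤ (‖B‖ * ∫ y, ‖h' y‖) * w q := by
    intro E E' _ _ _ _ B h' hs hi w hw q
    have h1 : (‖B‖ * ∫ y, ‖h' y‖) * w q = ∫ y, ‖B‖ * w q * ‖h' y‖ := by
      rw [integral_const_mul]; ring
    rw [h1]
    refine norm_integral_le_of_norm_le (hi.const_mul _) (Eventually.of_forall fun y => ?_)
    by_cases hy : h' y = 0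
    · simp [hy]
    · have h2 : ‖y‖ ≤ R := by simpa using hR (hs y hy)
      have h3 : ‖y.1‖ ≤ |R| := (norm_fst_le y).trans (h2.trans (le_abs_self R))
      calc ‖B (h' y) (K (q - y.1))‖ ≤ ‖B‖ * ‖h' y‖ * ‖K (q - y.1)‖ := B.le_opNorm₂ _ _
        _ ≤ ‖B‖ * ‖h' y‖ * w q := by gcongr; exact hw q y.1 h3
        _ = _ := by ring
  refine ⟨|R|, max (‖B‖ * ∫ y, ‖h y‖) (‖B.precompL (Phase d)‖ * ∫ y, ‖fderiv ℝ h y‖),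
    abs_nonneg R, fun w hw q => ?_⟩
  have hw0 : 0 ≤ w q := (norm_nonneg _).trans (hw q 0 (by simp))
  constructor
  · exact (key B h (fun y hy => subset_tsupport h hy) hi1 w hw q).trans
      (mul_le_mul_of_nonneg_right (le_max_left _ _) hw0)
  · have h1 := hc.hasFDerivAt_convolution_left B hh (μ := (volume : Measure (Phase d)))
      hK'.locallyIntegrable (q, 0)
    have h2 : HasFDerivAt (fun q => ∫ y, B (h y) (K (q - y.1)))
        ((∫ y, (B.precompL (Phase d)) (fderiv ℝ h y) (K (q - y.1))).comp
          (ContinuousLinearMap.inl ℝ (Conf d) (Conf d))) q :=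
      HasFDerivAt.comp (f := fun q : Conf d => (q, (0 : Conf d))) q h1
        (hasFDerivAt_prodMk_left q (0 : Conf d))
    rw [h2.fderiv]
    refine (ContinuousLinearMap.opNorm_comp_le _ _).trans ?_
    have h3 := key (B.precompL (Phase d)) (fderiv ℝ h)
      (fun y hy => support_fderiv_subset ℝ hy) hi2 w hw q
    calc ‖∫ y, (B.precompL (Phase d)) (fderiv ℝ h y) (K (q - y.1))‖
          * ‖ContinuousLinearMap.inl ℝ (Conf d) (Conf d)‖
        ≤ ‖∫ y, (B.precompL (Phase d)) (fderiv ℝ h y) (K (q - y.1))‖ * 1 := by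
          gcongr
          exact ContinuousLinearMap.norm_inl_le_one ℝ _ _
      _ ≤ _ := by
          rw [mul_one]
          exact h3.trans (mul_le_mul_of_nonneg_right (le_max_right _ _) hw0)

end PositionConvolution

namespace Model

variable {M : Model d}

/-! ### Test functions in the cotangent space -/

lemma norm_gradQ_position (a : Conf d → ℝ) (y : Phase d) :
    ‖gradQ (fun y : Phase d => a y.1) y‖ = ‖fderiv ℝ a y.1‖ := by
  simp only [gradQ, gradient, LinearIsometryEquiv.norm_map]

lemma continuous_gradQ {ξ : Phase d → ℝ} (h : ContDiff ℝ 1 ξ) : Continuous (gradQ ξ) := by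
  rw [funext (gradQ_eq (h.differentiable one_ne_zero))]
  have := h.continuous_fderiv one_ne_zero
  fun_prop

lemma continuous_gradP {ξ : Phase d → ℝ} (h : ContDiff ℝ 1 ξ) : Continuous (gradP ξ) := by
  rw [funext (gradP_eq (h.differentiable one_ne_zero))]
  have := h.continuous_fderiv one_ne_zero
  fun_prop

lemma hasCompactSupport_gradQ {ξ : Phase d → ℝ} (h : ContDiff ℝ 1 ξ) (hc : HasCompactSupport ξ) :
    HasCompactSupport (gradQ ξ) := by
  rw [funext (gradQ_eq (h.differentiable one_ne_zero))]
  exact (hc.fderiv ℝ).comp_left (g := fun A : Phase d →L[ℝ] ℝ =>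
    (InnerProductSpace.toDual ℝ (Conf d)).symm
      (A.comp (ContinuousLinearMap.inl ℝ (Conf d) (Conf d)))) (by simp)

lemma hasCompactSupport_gradP {ξ : Phase d → ℝ} (h : ContDiff ℝ 1 ξ) (hc : HasCompactSupport ξ) :
    HasCompactSupport (gradP ξ) := by
  rw [funext (gradP_eq (h.differentiable one_ne_zero))]
  exact (hc.fderiv ℝ).comp_left (g := fun A : Phase d →L[ℝ] ℝ =>
    (InnerProductSpace.toDual ℝ (Conf d)).symm
      (A.comp (ContinuousLinearMap.inr ℝ (Conf d) (Conf d)))) (by simp)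

lemma isCot_of_hasCompactSupport {r ξ : Phase d → ℝ} (hr : Continuous r) (hξ : ContDiff ℝ 2 ξ)
    (hc : HasCompactSupport ξ) : M.IsCot r ξ := by
  have h1 : ContDiff ℝ 1 ξ := hξ.of_le (by norm_num)
  refine ⟨M.T.compact_mem ξ hξ hc, ?_, ?_⟩
  · exact (hξ.continuous.mul hr).integrable_of_hasCompactSupport hc.mul_right
  · have h2 := continuous_gradQ h1
    refine Continuous.integrable_of_hasCompactSupport (by fun_prop) ?_
    exact ((hasCompactSupport_gradQ h1 hc).norm.mul_left).mul_right

/-- Functions of the position are covectors if they and their gradients are dominated by a weight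
`w` for which `(1 + |p|) w(q)` is integrable. -/
lemma isCot_position {r : Phase d → ℝ} (hr : Continuous r) (hr0 : ∀ y, 0 < r y)
    {a w : Conf d → ℝ} (ha : ContDiff ℝ 2 a) {C : ℝ}
    (hw : Integrable fun y : Phase d => (1 + ‖y.2‖) * w y.1 * r y)
    (h0 : ∀ q, |a q| ≤ C * w q) (h1 : ∀ q, ‖fderiv ℝ a q‖ ≤ C * w q) :
    M.IsCot r fun y => a y.1 := by
  have hac := ha.continuous
  have hfc := ha.continuous_fderiv (by norm_num)
  refine ⟨M.T.position_mem a ha, (hw.const_mul C).mono' ?_ ?_, (hw.const_mul C).mono' ?_ ?_⟩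
  · exact (by fun_prop : Continuous fun y : Phase d => a y.1 * r y).aestronglyMeasurable
  · refine Eventually.of_forall fun y => ?_
    have h2 := h0 y.1
    have h3 : 0 ≤ C * w y.1 := (abs_nonneg _).trans h2
    rw [norm_mul, Real.norm_eq_abs, Real.norm_of_nonneg (hr0 y).le]
    calc |a y.1| * r y ≤ 1 * (C * w y.1) * r y := by
          rw [one_mul]; exact mul_le_mul_of_nonneg_right h2 (hr0 y).le
      _ ≤ (1 + ‖y.2‖) * (C * w y.1) * r y := by
          have := (hr0 y).le
          gcongr
          simp
      _ = _ := by ring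
  · simp only [norm_gradQ_position]
    exact (by fun_prop : Continuous fun y : Phase d =>
      (1 + ‖y.2‖) * ‖fderiv ℝ a y.1‖ * r y).aestronglyMeasurable
  · refine Eventually.of_forall fun y => ?_
    have h2 := h1 y.1
    have hry := (hr0 y).le
    rw [norm_gradQ_position, Real.norm_of_nonneg (by positivity)]
    calc (1 + ‖y.2‖) * ‖fderiv ℝ a y.1‖ * r y ≤ (1 + ‖y.2‖) * (C * w y.1) * r y := by
          gcongr
      _ = _ := by ring

lemma State.continuous (ρ : M.State) : Continuous ρ.1 := ρ.2.contDiff.continuous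

lemma State.dominatedBy_of_hasCompactSupport (ρ : M.State) {g : Phase d → ℝ} (hg : Continuous g)
    (hc : HasCompactSupport g) : DominatedBy ρ.1 g :=
  DominatedBy.of_hasCompactSupport ρ.continuous ρ.2.pos hg hc

lemma State.dominatedBy_self (ρ : M.State) : DominatedBy ρ.1 ρ.1 :=
  DominatedBy.refl ρ.continuous ρ.2.pos

lemma IsCot.of_dominatedBy {ρ : M.State} {g ξ : Phase d → ℝ} (hg : DominatedBy ρ.1 g)
    (h : M.IsCot ρ.1 ξ) : M.IsCot g ξ :=
  ⟨h.mem, hg.integrable_mul ρ.continuous ρ.2.pos h.integrable,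
    hg.integrable_mul ρ.continuous ρ.2.pos h.integrable_grad⟩

/-- Local bounds of `Φ` and `∇Φ` by weights with `(1 + |p|) w(q)` integrable. -/
lemma State.exists_weight (ρ : M.State) (R : ℝ) : ∃ w : Conf d → ℝ,
    (∀ q q' : Conf d, ‖q'‖ ≤ R → ‖M.Φ (q - q')‖ ≤ w q) ∧
    (∀ q q' : Conf d, ‖q'‖ ≤ R → ‖gradient M.Φ (q - q')‖ ≤ w q) ∧
    Integrable fun y : Phase d => (1 + ‖y.2‖) * w y.1 * ρ.1 y := by
  obtain ⟨w, hw, hi⟩ := ρ.2.domination R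
  refine ⟨w, fun q q' h => ?_, fun q q' h => ?_, hi⟩
  · simpa using hw 0 (by norm_num) q q' h
  · have := hw 1 (by norm_num) q q' h
    rwa [norm_iteratedFDeriv_one, ← LinearIsometryEquiv.norm_map
      (InnerProductSpace.toDual ℝ (Conf d)).symm] at this

lemma conv_eq_positionConvolution (g : Phase d → ℝ) :
    M.conv g = fun q => ∫ y, ContinuousLinearMap.mul ℝ ℝ (g y) (M.Φ (q - y.1)) := by
  ext q
  simp only [conv, ContinuousLinearMap.mul_apply', mul_comm]

lemma contDiff_conv {n : ℕ∞} {g : Phase d → ℝ} (hg : ContDiff ℝ n g) (hc : HasCompactSupport g) :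
    ContDiff ℝ n (M.conv g) := by
  rw [conv_eq_positionConvolution]
  exact contDiff_positionConvolution _ hg hc M.contDiff_Φ.continuous

lemma isCot_conv (ρ : M.State) {g : Phase d → ℝ} (hg : ContDiff ℝ 2 g)
    (hc : HasCompactSupport g) : M.IsCot ρ.1 fun y => M.conv g y.1 := by
  obtain ⟨R, C, -, h⟩ := exists_positionConvolution_le (ContinuousLinearMap.mul ℝ ℝ)
    (hg.of_le (by norm_num)) hc M.contDiff_Φ.continuous
  obtain ⟨w, hw, -, hi⟩ := ρ.exists_weight R
  have h' := h w hw
  rw [← conv_eq_positionConvolution] at h'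
  refine isCot_position ρ.continuous ρ.2.pos (contDiff_conv (n := 2) hg hc) hi
    (C := C) (fun q => ?_) fun q => (h' q).2
  rw [conv_eq_positionConvolution]
  exact (h' q).1

/-! ### The interaction energy -/

lemma State.norm_sub_le_weight (ρ : M.State) (q : Conf d) : ∃ w : Conf d → ℝ,
    (∀ q', ‖M.Φ (q - q')‖ ≤ w q') ∧ Integrable fun y : Phase d => (1 + ‖y.2‖) * w y.1 * ρ.1 y := by
  obtain ⟨w, hw, -, hi⟩ := ρ.exists_weight ‖q‖
  refine ⟨w, fun q' => ?_, hi⟩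
  rw [← M.even_Φ, neg_sub]
  exact hw q' q le_rfl

lemma _root_.Underdamped.DominatedBy.integrable_Φ_mul {ρ : M.State} {g : Phase d → ℝ}
    (hg : DominatedBy ρ.1 g)
    (q : Conf d) : Integrable fun y : Phase d => M.Φ (q - y.1) * g y := by
  obtain ⟨w, hw, hi⟩ := ρ.norm_sub_le_weight q
  refine hg.integrable_mul ρ.continuous ρ.2.pos (hi.mono' ?_ (Eventually.of_forall fun y => ?_))
  · have := M.contDiff_Φ.continuous
    have := ρ.continuous
    exact Continuous.aestronglyMeasurable (by fun_prop)
  · have hr := (ρ.2.pos y).le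
    rw [norm_mul, Real.norm_of_nonneg hr]
    have h1 := hw y.1
    have h0 := (norm_nonneg _).trans h1
    gcongr
    calc ‖M.Φ (q - y.1)‖ ≤ 1 * w y.1 := by rwa [one_mul]
      _ ≤ (1 + ‖y.2‖) * w y.1 := by gcongr; simp

lemma conv_add_mul {ρ : M.State} {g g' : Phase d → ℝ} (hg : DominatedBy ρ.1 g)
    (hg' : DominatedBy ρ.1 g') (t : ℝ) (q : Conf d) :
    M.conv (fun y => g y + t * g' y) q = M.conv g q + t * M.conv g' q := by
  simp only [conv]
  rw [← integral_const_mul, ← integral_add (hg.integrable_Φ_mul q)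
    ((hg'.integrable_Φ_mul q).const_mul t)]
  refine integral_congr_ae (Eventually.of_forall fun y => ?_)
  simp only []
  ring

lemma _root_.Underdamped.DominatedBy.integrable_interaction {ρ : M.State} {g g' : Phase d → ℝ}
    (hg : DominatedBy ρ.1 g) (hg' : DominatedBy ρ.1 g') :
    Integrable fun z : Phase d × Phase d => M.Φ (z.1.1 - z.2.1) * (g z.1 * g' z.2) := by
  have hc := ρ.continuous
  exact (DominatedBy.prod hg hg').integrable_mul (by fun_prop)
    (fun z => mul_pos (ρ.2.pos _) (ρ.2.pos _)) ρ.2.interaction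

lemma _root_.Underdamped.DominatedBy.integrable_conv_mul {ρ : M.State} {g g' : Phase d → ℝ}
    (hg : DominatedBy ρ.1 g) (hg' : DominatedBy ρ.1 g') :
    Integrable fun y : Phase d => M.conv g' y.1 * g y := by
  refine (hg.integrable_interaction hg').integral_prod_left.congr (Eventually.of_forall fun y => ?_)
  simp only [conv, ← integral_mul_const]
  refine integral_congr_ae (Eventually.of_forall fun z => ?_)
  simp only []
  ring

/-- The interaction energy is symmetric, since `Φ` is even. -/
lemma integral_conv_mul_comm {ρ : M.State} {g g' : Phase d → ℝ}
    (hg : DominatedBy ρ.1 g) (hg' : DominatedBy ρ.1 g') :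
    ∫ y, M.conv g' y.1 * g y = ∫ y, M.conv g y.1 * g' y := by
  have key : ∀ g g' : Phase d → ℝ,
      ∫ y, M.conv g' y.1 * g y = ∫ y, ∫ z, M.Φ (y.1 - z.1) * (g y * g' z) := by
    intro g g'
    refine integral_congr_ae (Eventually.of_forall fun y => ?_)
    simp only [conv, ← integral_mul_const]
    refine integral_congr_ae (Eventually.of_forall fun z => ?_)
    simp only []
    ring
  rw [key, key, integral_integral_swap (hg.integrable_interaction hg')]
  refine integral_congr_ae (Eventually.of_forall fun y => ?_)
  refine integral_congr_ae (Eventually.of_forall fun z => ?_)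
  simp only []
  rw [← M.even_Φ, neg_sub, mul_comm (g z)]

lemma _root_.Underdamped.DominatedBy.integrable_kinetic {ρ : M.State} {g : Phase d → ℝ}
    (hg : DominatedBy ρ.1 g) :
    Integrable fun y : Phase d => ‖y.2‖ ^ 2 / (2 * M.m) * g y := by
  refine ((hg.integrable_mul ρ.continuous ρ.2.pos ρ.2.kinetic).const_mul (2 * M.m)⁻¹).congr
    (Eventually.of_forall fun y => ?_)
  simp only []
  ring

lemma _root_.Underdamped.DominatedBy.integrable_potential {ρ : M.State} {g : Phase d → ℝ}
    (hg : DominatedBy ρ.1 g) :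
    Integrable fun y : Phase d => M.V y.1 * g y :=
  hg.integrable_mul ρ.continuous ρ.2.pos ρ.2.potential

lemma _root_.Underdamped.DominatedBy.integrable_dEnergy {ρ : M.State} {g : Phase d → ℝ}
    (hg : DominatedBy ρ.1 g) :
    Integrable fun y : Phase d => M.dEnergy ρ.1 y * g y := by
  refine ((hg.integrable_kinetic.add hg.integrable_potential).add
    (hg.integrable_conv_mul ρ.dominatedBy_self)).congr (Eventually.of_forall fun y => ?_)
  simp only [dEnergy, Pi.add_apply]
  ring

/-- The energy is a quadratic functional, with derivative `dE`. -/
lemma energy_add_mul {ρ : M.State} {g : Phase d → ℝ} (hg : DominatedBy ρ.1 g) (t : ℝ) :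
    M.energy (fun y => ρ.1 y + t * g y) = M.energy ρ.1 + t * (∫ y, M.dEnergy ρ.1 y * g y)
      + t ^ 2 * (1 / 2 * ∫ y, M.conv g y.1 * g y) := by
  have hr := ρ.dominatedBy_self
  have i0 : Integrable fun y => (‖y.2‖ ^ 2 / (2 * M.m) + M.V y.1 + 1 / 2 * M.conv ρ.1 y.1) * ρ.1 y :=
    ((hr.integrable_kinetic.add hr.integrable_potential).add
      ((hr.integrable_conv_mul hr).const_mul (1 / 2))).congr (Eventually.of_forall fun y => by
        simp only [Pi.add_apply]; ring)
  have i1 := hg.integrable_dEnergy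
  have i2 := hg.integrable_conv_mul hr
  have i3 := hr.integrable_conv_mul hg
  have i4 := hg.integrable_conv_mul hg
  have e1 : M.energy (fun y => ρ.1 y + t * g y) = ∫ y,
      ((((‖y.2‖ ^ 2 / (2 * M.m) + M.V y.1 + 1 / 2 * M.conv ρ.1 y.1) * ρ.1 y
        + t * (M.dEnergy ρ.1 y * g y)) + (t / 2 * (M.conv g y.1 * ρ.1 y)
        - t / 2 * (M.conv ρ.1 y.1 * g y))) + t ^ 2 / 2 * (M.conv g y.1 * g y)) := by
    unfold energy
    refine integral_congr_ae (Eventually.of_forall fun y => ?_)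
    simp only [conv_add_mul hr hg, dEnergy]
    ring
  have e2 := integral_conv_mul_comm hr hg
  rw [e1, integral_add, integral_add, integral_add, integral_sub, integral_const_mul,
    integral_const_mul, integral_const_mul, integral_const_mul, e2, energy]
  · ring
  · exact i3.const_mul _
  · exact i2.const_mul _
  · exact i0
  · exact i1.const_mul _
  · exact i0.add (i1.const_mul _)
  · exact (i3.const_mul _).sub (i2.const_mul _)
  · exact (i0.add (i1.const_mul _)).add ((i3.const_mul _).sub (i2.const_mul _))
  · exact i4.const_mul _

lemma dEnergy_add_mul {ρ : M.State} {g : Phase d → ℝ} (hg : DominatedBy ρ.1 g) (t : ℝ)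
    (y : Phase d) :
    M.dEnergy (fun y => ρ.1 y + t * g y) y = M.dEnergy ρ.1 y + t * M.conv g y.1 := by
  simp only [dEnergy, conv_add_mul ρ.dominatedBy_self hg]
  ring

/-! ### Variations of a state, and the derivatives of energy and entropy -/

lemma Variation.continuous (σ : Variation d) : Continuous σ.toFun := σ.contDiff.continuous

lemma State.dominatedBy_variation (ρ : M.State) (σ : Variation d) : DominatedBy ρ.1 σ.toFun :=
  ρ.dominatedBy_of_hasCompactSupport σ.continuous σ.compact

/-- `|t σ| ≤ r / 2` for small `t`. -/
lemma State.exists_forall_abs_mul_le (ρ : M.State) (σ : Variation d) :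
    ∃ ε > 0, ∀ t : ℝ, |t| < ε → ∀ y, |t * σ.toFun y| ≤ ρ.1 y / 2 := by
  obtain ⟨-, C, hC⟩ := ρ.dominatedBy_variation σ
  refine ⟨(2 * (|C| + 1))⁻¹, by positivity, fun t ht y => ?_⟩
  have hr := (ρ.2.pos y).le
  have h1 : |t| * (|C| + 1) ≤ 1 / 2 := by
    calc |t| * (|C| + 1) ≤ (2 * (|C| + 1))⁻¹ * (|C| + 1) := by gcongr
      _ = 1 / 2 := by field_simp
  rw [abs_mul]
  calc |t| * |σ.toFun y| ≤ |t| * ((|C| + 1) * ρ.1 y) := by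
        gcongr
        exact (hC y).trans (by gcongr; linarith [le_abs_self C])
    _ = |t| * (|C| + 1) * ρ.1 y := by ring
    _ ≤ 1 / 2 * ρ.1 y := by gcongr
    _ = _ := by ring

lemma abs_log_add_le {r s : ℝ} (hr : 0 < r) (hs : |s| ≤ r / 2) :
    |Real.log (r + s)| ≤ |Real.log r| + Real.log 2 := by
  obtain ⟨h1, h2⟩ := abs_le.1 hs
  have h3 : Real.log (r + s) ≤ Real.log (r * 2) := Real.log_le_log (by linarith) (by linarith)
  have h4 : Real.log (r / 2) ≤ Real.log (r + s) := Real.log_le_log (by linarith) (by linarith)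
  rw [Real.log_mul hr.ne' two_ne_zero] at h3
  rw [Real.log_div hr.ne' two_ne_zero] at h4
  rw [abs_le]
  constructor
  · linarith [neg_abs_le (Real.log r)]
  · linarith [le_abs_self (Real.log r)]

/-- Small variations of a state are states: their densities are comparable, and the
functional derivative `dS` changes by a compactly supported function and a function of the
position. -/
lemma State.isState_add_mul (ρ : M.State) (σ : Variation d) {t : ℝ}
    (ht : ∀ y, |t * σ.toFun y| ≤ ρ.1 y / 2) : M.IsState fun y => ρ.1 y + t * σ.toFun y := by
  have hσ := ρ.dominatedBy_variation σ
  have hg : DominatedBy ρ.1 fun y => ρ.1 y + t * σ.toFun y :=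
    ρ.dominatedBy_self.add (hσ.const_mul t)
  have hr := ρ.continuous
  have hpos : ∀ y, 0 < ρ.1 y + t * σ.toFun y := fun y => by
    have := (abs_le.1 (ht y)).1
    have := ρ.2.pos y
    linarith
  have hσi : Integrable σ.toFun := σ.continuous.integrable_of_hasCompactSupport σ.compact
  have hsm : ContDiff ℝ 2 fun y => ρ.1 y + t * σ.toFun y :=
    ρ.2.contDiff.add (contDiff_const.mul (contDiff_infty.1 σ.contDiff 2))
  have hg2 := DominatedBy.prod hg hg
  have hpos2 : ∀ z : Phase d × Phase d, 0 < ρ.1 z.1 * ρ.1 z.2 :=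
    fun z => mul_pos (ρ.2.pos _) (ρ.2.pos _)
  refine
    { pos := hpos
      contDiff := hsm
      integrable := ρ.2.integrable.add (hσi.const_mul t)
      integral_eq_one := ?_
      kinetic := hg.integrable_mul hr ρ.2.pos ρ.2.kinetic
      potential := hg.integrable_potential
      force := hg.integrable_mul hr ρ.2.pos ρ.2.force
      interaction := hg.integrable_interaction hg
      interaction_force := hg2.integrable_mul (by fun_prop) hpos2 ρ.2.interaction_force
      domination := fun R => ?_
      dEntropy_isCot := IsCot.of_dominatedBy hg ?_ }
  · rw [integral_add ρ.2.integrable (hσi.const_mul t), integral_const_mul, σ.mass_zero,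
      ρ.2.integral_eq_one]
    simp
  · obtain ⟨w, hw, hi⟩ := ρ.2.domination R
    exact ⟨w, hw, hg.integrable_mul hr ρ.2.pos hi⟩
  · have hlog : M.IsCot ρ.1 fun y => Real.log (ρ.1 y + t * σ.toFun y) - Real.log (ρ.1 y) := by
      refine isCot_of_hasCompactSupport hr ((hsm.log fun y => (hpos y).ne').sub
        (ρ.2.contDiff.log fun y => (ρ.2.pos y).ne')) (σ.compact.mono fun y hy => ?_)
      contrapose! hy
      simp [Function.notMem_support.1 hy]
    have hconv : M.IsCot ρ.1 fun y => M.conv σ.toFun y.1 :=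
      isCot_conv ρ (contDiff_infty.1 σ.contDiff 2) σ.compact
    have h := (cot ρ).add_mem ((cot ρ).add_mem (x := M.dEntropy ρ.1) ρ.2.dEntropy_isCot hlog)
      ((cot ρ).smul_mem t hconv)
    refine (congrArg (M.IsCot ρ.1) ?_).mpr h
    ext y
    simp only [dEntropy, dEnergy_add_mul hσ, Pi.add_apply, Pi.smul_apply, smul_eq_mul]
    ring

lemma State.eventually_isState (ρ : M.State) (σ : Variation d) :
    ∀ᶠ t in 𝓝 (0 : ℝ), (∀ y, |t * σ.toFun y| ≤ ρ.1 y / 2) ∧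
      M.IsState fun y => ρ.1 y + t * σ.toFun y := by
  obtain ⟨ε, hε, h⟩ := ρ.exists_forall_abs_mul_le σ
  filter_upwards [Metric.ball_mem_nhds (0 : ℝ) hε] with t ht
  have h1 := h t (by simpa using ht)
  exact ⟨h1, ρ.isState_add_mul σ h1⟩

lemma State.shift_eq (ρ : M.State) (σ : Variation d) {t : ℝ}
    (h : M.IsState fun y => ρ.1 y + t * σ.toFun y) :
    (ρ.shift σ t).1 = fun y => ρ.1 y + t * σ.toFun y := by
  exact congrArg Subtype.val (dif_pos h)

theorem hasFunctionalDeriv_energy (ρ : M.State) :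
    HasFunctionalDeriv M.energy ρ (M.dEnergy ρ.1) := by
  intro σ
  simp only [energy_add_mul (ρ.dominatedBy_variation σ)]
  have h1 := ((hasDerivAt_id (0 : ℝ)).mul_const (∫ y, M.dEnergy ρ.1 y * σ.toFun y)).const_add
    (M.energy ρ.1)
  have h2 := ((hasDerivAt_id (0 : ℝ)).pow 2).mul_const (1 / 2 * ∫ y, M.conv σ.toFun y.1 * σ.toFun y)
  refine (h1.add h2).congr_deriv ?_
  simp

lemma State.continuous_log (ρ : M.State) : Continuous fun y => Real.log (ρ.1 y) :=
  ρ.continuous.log fun y => (ρ.2.pos y).ne'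

lemma State.integrable_log_mul (ρ : M.State) : Integrable fun y => Real.log (ρ.1 y) * ρ.1 y := by
  refine ((ρ.2.dEntropy_isCot.integrable.sub ρ.dominatedBy_self.integrable_dEnergy).sub
    ρ.2.integrable).congr (Eventually.of_forall fun y => ?_)
  simp only [Pi.sub_apply, dEntropy]
  ring

lemma hasDerivAt_integral_log (ρ : M.State) (σ : Variation d) :
    HasDerivAt (fun t : ℝ => ∫ y, Real.log (ρ.1 y + t * σ.toFun y) * (ρ.1 y + t * σ.toFun y))
      (∫ y, (Real.log (ρ.1 y) + 1) * σ.toFun y) 0 := by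
  obtain ⟨ε, hε, hsmall⟩ := ρ.exists_forall_abs_mul_le σ
  have hr := ρ.continuous
  have hlog := ρ.continuous_log
  have hσ := σ.continuous
  have h := (hasDerivAt_integral_of_dominated_loc_of_deriv_le
    (F := fun (t : ℝ) y => Real.log (ρ.1 y + t * σ.toFun y) * (ρ.1 y + t * σ.toFun y))
    (F' := fun t y => (Real.log (ρ.1 y + t * σ.toFun y) + 1) * σ.toFun y)
    (bound := fun y => (|Real.log (ρ.1 y)| + Real.log 2 + 1) * |σ.toFun y|)
    (μ := volume) (x₀ := (0 : ℝ)) (Metric.ball_mem_nhds (0 : ℝ) hε)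
    (Eventually.of_forall fun t => ?_) ?_ ?_ (Eventually.of_forall fun y t ht => ?_) ?_
    (Eventually.of_forall fun y t ht => ?_)).2
  · simpa using h
  · have hm : Measurable fun y => ρ.1 y + t * σ.toFun y :=
      (by fun_prop : Continuous fun y => ρ.1 y + t * σ.toFun y).measurable
    exact (hm.log.mul hm).aestronglyMeasurable
  · simpa using ρ.integrable_log_mul
  · simp only [zero_mul, add_zero]
    exact Continuous.aestronglyMeasurable (by fun_prop)
  · have h1 := abs_log_add_le (ρ.2.pos y) (hsmall t (by simpa using ht) y)
    rw [norm_mul, Real.norm_eq_abs, Real.norm_eq_abs]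
    gcongr
    refine (abs_add_le _ _).trans ?_
    rw [abs_one]
    linarith
  · refine Continuous.integrable_of_hasCompactSupport (by fun_prop) ?_
    exact HasCompactSupport.mul_left σ.compact.norm
  · have h1 := hsmall t (by simpa using ht) y
    have h2 : 0 < ρ.1 y + t * σ.toFun y := by
      have := (abs_le.1 h1).1
      have := ρ.2.pos y
      linarith
    have h3 : HasDerivAt (fun t : ℝ => ρ.1 y + t * σ.toFun y) (σ.toFun y) t := by
      simpa using ((hasDerivAt_id t).mul_const (σ.toFun y)).const_add (ρ.1 y)
    have h4 := (h3.log h2.ne').mul h3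
    refine h4.congr_deriv ?_
    rw [div_mul_cancel₀ _ h2.ne']
    ring

theorem hasFunctionalDeriv_entropy (ρ : M.State) :
    HasFunctionalDeriv M.entropy ρ (M.dEntropy ρ.1) := by
  intro σ
  have h := (hasDerivAt_integral_log ρ σ).add (hasFunctionalDeriv_energy ρ σ)
  have hlog := ρ.continuous_log
  have hσ := σ.continuous
  refine h.congr_deriv ?_
  rw [← integral_add]
  · refine integral_congr_ae (Eventually.of_forall fun y => ?_)
    simp only [dEntropy]
    ring
  · exact Continuous.integrable_of_hasCompactSupport (by fun_prop) σ.compact.mul_left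
  · exact (ρ.dominatedBy_variation σ).integrable_dEnergy

/-! ### Differentials on the extended state space -/

/-- A continuous function that is orthogonal to all variations of mass zero is constant. -/
lemma eq_const_of_forall_integral_eq_zero {h : Phase d → ℝ} (hc : Continuous h)
    (h0 : ∀ σ : Variation d, ∫ y, h y * σ.toFun y = 0) : ∃ c : ℝ, ∀ y, h y = c := by
  let χ : ContDiffBump (0 : Phase d) := ⟨1, 2, one_pos, one_lt_two⟩
  have hχ : ContDiff ℝ ∞ (χ.normed volume) := χ.contDiff_normed
  have hχc : HasCompactSupport (χ.normed volume) := χ.hasCompactSupport_normed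
  have hχi : Integrable (χ.normed volume) := χ.integrable_normed
  -- Subtracting a multiple of a bump function of mass one turns test functions into variations.
  set c := ∫ y, h y * χ.normed volume y with hcdef
  have hae : ∀ᵐ y, h y - c = 0 := by
    refine ae_eq_zero_of_integral_contDiff_smul_eq_zero
      (by fun_prop : Continuous fun y => h y - c).locallyIntegrable fun g hg hgc => ?_
    have hgi : Integrable g := hg.continuous.integrable_of_hasCompactSupport hgc
    let σ : Variation d :=
      { toFun := fun y => g y - (∫ x, g x) * χ.normed volume y
        contDiff := hg.sub (contDiff_const.mul hχ)
        compact := hgc.sub hχc.mul_left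
        mass_zero := by
          rw [integral_sub hgi (hχi.const_mul _), integral_const_mul, χ.integral_normed]
          ring }
    have h1 := h0 σ
    have i1 : Integrable fun y => h y * g y :=
      (hc.mul hg.continuous).integrable_of_hasCompactSupport hgc.mul_left
    have i2 : Integrable fun y => h y * χ.normed volume y :=
      (hc.mul hχ.continuous).integrable_of_hasCompactSupport hχc.mul_left
    have e1 : ∫ y, h y * σ.toFun y = (∫ y, h y * g y) - (∫ x, g x) * c := by
      rw [hcdef, ← integral_const_mul, ← integral_sub i1 (i2.const_mul _)]
      refine integral_congr_ae (Eventually.of_forall fun y => ?_)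
      simp only [σ]
      ring
    have e2 : ∫ y, g y • (h y - c) = (∫ y, h y * g y) - (∫ x, g x) * c := by
      rw [← integral_mul_const, ← integral_sub i1 (hgi.mul_const _)]
      refine integral_congr_ae (Eventually.of_forall fun y => ?_)
      simp only [smul_eq_mul]
      ring
    rw [e2, ← e1, h1]
  have heq := Continuous.ae_eq_iff_eq volume (f := fun y => h y - c) (g := fun _ => 0)
    (by fun_prop) continuous_const |>.1 hae
  exact ⟨c, fun y => sub_eq_zero.1 (congrFun heq y)⟩

lemma cot.contDiff {ρ : M.State} (ξ : cot ρ) : ContDiff ℝ 2 ξ.1 := M.T.contDiff ξ.1 ξ.2.mem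

lemma cot.integrable_mul {ρ : M.State} (ξ : cot ρ) (σ : Variation d) :
    Integrable fun y => ξ.1 y * σ.toFun y :=
  ((cot.contDiff ξ).continuous.mul σ.continuous).integrable_of_hasCompactSupport σ.compact.mul_left

/-- The pairing of a covector `(ξ, r)` with a variation `(σ, s)`. -/
def variationPair (z : M.ExtState) (σ : Variation d) (s : ℝ) : cot z.1 × ℝ →ₗ[ℝ] ℝ where
  toFun ξ := (∫ y, ξ.1.1 y * σ.toFun y) + ξ.2 * s
  map_add' ξ η := by
    have h : ∫ y, (ξ + η).1.1 y * σ.toFun y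
        = (∫ y, ξ.1.1 y * σ.toFun y) + ∫ y, η.1.1 y * σ.toFun y := by
      rw [← integral_add (cot.integrable_mul _ _) (cot.integrable_mul _ _)]
      refine integral_congr_ae (Eventually.of_forall fun y => ?_)
      simp only [Prod.fst_add, Submodule.coe_add, Pi.add_apply]
      ring
    rw [h, Prod.snd_add]
    ring
  map_smul' c ξ := by
    have h : ∫ y, (c • ξ).1.1 y * σ.toFun y = c * ∫ y, ξ.1.1 y * σ.toFun y := by
      rw [← integral_const_mul]
      refine integral_congr_ae (Eventually.of_forall fun y => ?_)
      simp only [Prod.smul_fst, Submodule.coe_smul, Pi.smul_apply, smul_eq_mul]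
      ring
    rw [h, Prod.smul_snd, RingHom.id_apply, smul_eq_mul, smul_eq_mul]
    ring

lemma State.shift_zero (ρ : M.State) (σ : Variation d) : ρ.shift σ 0 = ρ := by
  have h : M.IsState fun y => ρ.1 y + 0 * σ.toFun y := by simpa using ρ.2
  exact Subtype.ext ((ρ.shift_eq σ h).trans (by simp))

lemma hasExtDiff_iff {U : M.ExtState → ℝ} {z : M.ExtState} {ξ : cot z.1 × ℝ} :
    HasExtDiff U z ξ ↔ ∀ (σ : Variation d) (s : ℝ),
      HasDerivAt (fun t : ℝ => U (z.1.shift σ t, z.2 + t * s)) (variationPair z σ s ξ) 0 :=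
  ⟨fun h σ s => (h σ s).2, fun h σ s => ⟨(z.1.eventually_isState σ).mono fun _ h => h.2, h σ s⟩⟩

/-- To find differentials of functions of the density it is enough to look at the densities
`r + t σ`. -/
lemma HasExtDiff.of_density {U : (Phase d → ℝ) → ℝ → ℝ} {z : M.ExtState} {ξ : cot z.1 × ℝ}
    (h : ∀ (σ : Variation d) (s : ℝ),
      HasDerivAt (fun t : ℝ => U (fun y => z.1.1 y + t * σ.toFun y) (z.2 + t * s))
        (variationPair z σ s ξ) 0) :
    HasExtDiff (fun z : M.ExtState => U z.1.1 z.2) z ξ := by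
  refine hasExtDiff_iff.2 fun σ s => (h σ s).congr_of_eventuallyEq ?_
  filter_upwards [z.1.eventually_isState σ] with t ht
  simp only [z.1.shift_eq σ ht.2]

/-- The zero variation. -/
def Variation.zero (d : ℕ) : Variation d where
  toFun := 0
  contDiff := contDiff_const
  compact := HasCompactSupport.zero
  mass_zero := by simp

/-- Differentials are unique up to an additive constant in the first component. -/
lemma HasExtDiff.unique {U : M.ExtState → ℝ} {z : M.ExtState} {ξ ξ' : cot z.1 × ℝ}
    (h : HasExtDiff U z ξ) (h' : HasExtDiff U z ξ') :
    ξ.2 = ξ'.2 ∧ ∃ c : ℝ, ∀ y, ξ.1.1 y = ξ'.1.1 y + c := by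
  have key : ∀ σ s, variationPair z σ s ξ = variationPair z σ s ξ' := fun σ s =>
    (h σ s).2.unique (h' σ s).2
  constructor
  · have := key (Variation.zero d) 1
    simpa [variationPair, Variation.zero] using this
  · obtain ⟨c, hc⟩ := eq_const_of_forall_integral_eq_zero (h := fun y => ξ.1.1 y - ξ'.1.1 y)
      ((cot.contDiff ξ.1).continuous.sub (cot.contDiff ξ'.1).continuous) fun σ => by
        have := key σ 0
        simp only [variationPair, LinearMap.coe_mk, AddHom.coe_mk, mul_zero, add_zero] at this
        simp only [sub_mul]
        rw [integral_sub (cot.integrable_mul _ _) (cot.integrable_mul _ _), this, sub_self]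
    exact ⟨c, fun y => by linarith [hc y]⟩

lemma gradQ_add_const (f : Phase d → ℝ) (c : ℝ) : gradQ (fun y => f y + c) = gradQ f := by
  ext1 y
  simp only [gradQ, gradient, fderiv_add_const]

lemma gradP_add_const (f : Phase d → ℝ) (c : ℝ) : gradP (fun y => f y + c) = gradP f := by
  ext1 y
  simp only [gradP, gradient, fderiv_add_const]

lemma LdE_apply (ρ : M.State) (ξ : cot ρ) : LdE ρ ξ = ∫ y,
    (inner ℝ (gradP (M.dEnergy ρ.1) y) (gradQ ξ.1 y)
      - inner ℝ (gradQ (M.dEnergy ρ.1) y) (gradP ξ.1 y)) * ρ.1 y :=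
  rfl

lemma LdE_eq_of_add_const {ρ : M.State} {ξ η : cot ρ} {c : ℝ} (h : ∀ y, ξ.1 y = η.1 y + c) :
    LdE ρ ξ = LdE ρ η := by
  rw [LdE_apply, LdE_apply, show ξ.1 = fun y => η.1 y + c from funext h, gradQ_add_const,
    gradP_add_const]

lemma adjointG_eq_of_add_const {ρ : M.State} {ξ η : cot ρ} {c : ℝ} (h : ∀ y, ξ.1 y = η.1 y + c) :
    adjointG ρ ξ = adjointG ρ η := by
  refine integral_congr_ae (Eventually.of_forall fun y => ?_)
  have h1 : (fun p => ξ.1 (y.1, p)) = (fun p => η.1 (y.1, p)) + fun _ => c := by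
    ext p
    exact h _
  simp only [MomentumGenerator.lift, h1, map_add, MomentumGenerator.op_const, add_zero]

namespace HasExtDiff

variable {U W : M.ExtState → ℝ} {z : M.ExtState} {ξ η : cot z.1 × ℝ}

lemma add (hU : HasExtDiff U z ξ) (hW : HasExtDiff W z η) :
    HasExtDiff (fun z => U z + W z) z (ξ + η) :=
  hasExtDiff_iff.2 fun σ s => by
    rw [map_add]
    exact (hU σ s).2.add (hW σ s).2

lemma sub (hU : HasExtDiff U z ξ) (hW : HasExtDiff W z η) :
    HasExtDiff (fun z => U z - W z) z (ξ - η) :=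
  hasExtDiff_iff.2 fun σ s => by
    rw [map_sub]
    exact (hU σ s).2.sub (hW σ s).2

lemma mul (hU : HasExtDiff U z ξ) (hW : HasExtDiff W z η) :
    HasExtDiff (fun z => U z * W z) z (W z • ξ + U z • η) :=
  hasExtDiff_iff.2 fun σ s => by
    have h := (hU σ s).2.mul (hW σ s).2
    simp only [zero_mul, add_zero, State.shift_zero] at h
    rw [map_add, map_smul, map_smul, smul_eq_mul, smul_eq_mul]
    refine h.congr_deriv ?_
    change variationPair z σ s ξ * W z + U z * variationPair z σ s η = _
    ring

lemma zero : HasExtDiff (fun _ => 0) z 0 :=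
  hasExtDiff_iff.2 fun σ s => by
    rw [map_zero]
    exact hasDerivAt_const _ _

lemma sum {ι : Type*} (s : Finset ι) {U : ι → M.ExtState → ℝ} {ξ : ι → cot z.1 × ℝ}
    (h : ∀ j, HasExtDiff (U j) z (ξ j)) :
    HasExtDiff (fun z => ∑ j ∈ s, U j z) z (∑ j ∈ s, ξ j) := by
  classical
  induction s using Finset.induction_on with
  | empty => simpa using zero
  | insert a s ha ih =>
    simp only [Finset.sum_insert ha]
    exact (h a).add ih

end HasExtDiff

/-! ### Energy, entropy and cylinder functions -/

lemma hasExtDiff_extEnergy (z : M.ExtState) : HasExtDiff M.extEnergy z (0, 1) :=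
  hasExtDiff_iff.2 fun σ s => by
    have h : HasDerivAt (fun t : ℝ => z.2 + t * s) s 0 := by
      simpa using ((hasDerivAt_id (0 : ℝ)).mul_const s).const_add z.2
    refine h.congr_deriv ?_
    simp [variationPair]

lemma hasExtDiff_extEntropy (z : M.ExtState) : HasExtDiff M.extEntropy z (dS z.1, 0) :=
  HasExtDiff.of_density (U := fun r _ => M.entropy r) fun σ s => by
    refine (hasFunctionalDeriv_entropy z.1 σ).congr_deriv ?_
    simp [variationPair, dS]

lemma isExtC1_extEnergy : IsExtC1 M.extEnergy := by
  refine ⟨fun _ => (0, 1), hasExtDiff_extEnergy, fun z σ τ s b => ?_⟩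
  simpa using continuousAt_const

lemma isExtC1_extEntropy : IsExtC1 M.extEntropy := by
  refine ⟨fun z => (dS z.1, 0), hasExtDiff_extEntropy, fun z σ τ s b => ?_⟩
  simp only [zero_mul, add_zero, dS]
  have hσ := z.1.dominatedBy_variation σ
  have hE := (differentiable_dEnergy z.1).continuous
  have hτ := τ.continuous
  have hσc := σ.continuous
  have hlog := z.1.continuous_log
  have hconv : Continuous (M.conv σ.toFun) :=
    (contDiff_conv (contDiff_infty.1 σ.contDiff 1) σ.compact).continuous
  have hr := z.1.continuous
  let F : ℝ → Phase d → ℝ := fun t y => (Real.log (z.1.1 y + t * σ.toFun y) + 1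
    + (M.dEnergy z.1.1 y + t * M.conv σ.toFun y.1)) * τ.toFun y
  have heq : (fun t => ∫ y, M.dEntropy (z.1.shift σ t).1 y * τ.toFun y)
      =ᶠ[𝓝 0] fun t => ∫ y, F t y := by
    filter_upwards [z.1.eventually_isState σ] with t ht
    simp only [z.1.shift_eq σ ht.2, dEntropy, dEnergy_add_mul hσ, F]
  refine ContinuousAt.congr ?_ heq.symm
  refine continuousAt_of_dominated (bound := fun y => (|Real.log (z.1.1 y)| + Real.log 2 + 1
    + (|M.dEnergy z.1.1 y| + |M.conv σ.toFun y.1|)) * |τ.toFun y|)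
    (Eventually.of_forall fun t => ?_) ?_ ?_ (Eventually.of_forall fun y => ?_)
  · have hm : Measurable fun y => z.1.1 y + t * σ.toFun y :=
      (by fun_prop : Continuous fun y => z.1.1 y + t * σ.toFun y).measurable
    have hm2 : Measurable fun y : Phase d => M.dEnergy z.1.1 y + t * M.conv σ.toFun y.1 :=
      (by fun_prop : Continuous fun y : Phase d =>
        M.dEnergy z.1.1 y + t * M.conv σ.toFun y.1).measurable
    exact (((hm.log.add_const 1).add hm2).mul hτ.measurable).aestronglyMeasurable
  · filter_upwards [z.1.eventually_isState σ, Metric.ball_mem_nhds (0 : ℝ) one_pos] with t ht h1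
    refine Eventually.of_forall fun y => ?_
    have h2 : |t| ≤ 1 := by
      have : |t| < 1 := by simpa using h1
      exact this.le
    have h3 := abs_log_add_le (z.1.2.pos y) (ht.1 y)
    have h4 : |t * M.conv σ.toFun y.1| ≤ |M.conv σ.toFun y.1| := by
      rw [abs_mul]
      exact mul_le_of_le_one_left (abs_nonneg _) h2
    simp only [F]
    rw [norm_mul, Real.norm_eq_abs, Real.norm_eq_abs]
    gcongr
    refine (abs_add_le _ _).trans (add_le_add ((abs_add_le _ _).trans ?_)
      ((abs_add_le _ _).trans ?_))
    · rw [abs_one]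
      linarith
    · linarith
  · refine Continuous.integrable_of_hasCompactSupport (by fun_prop) ?_
    exact HasCompactSupport.mul_left τ.compact.norm
  · have hne : z.1.1 y + 0 * σ.toFun y ≠ 0 := by simpa using (z.1.2.pos y).ne'
    have h1 : ContinuousAt (fun t : ℝ => z.1.1 y + t * σ.toFun y) 0 := by fun_prop
    have h2 : ContinuousAt (fun t : ℝ => Real.log (z.1.1 y + t * σ.toFun y)) 0 := h1.log hne
    simp only [F]
    fun_prop

/-- A smooth compactly supported function as a covector. -/
def testCot (ρ : M.State) {f : Phase d → ℝ} (hf : ContDiff ℝ ∞ f) (hc : HasCompactSupport f) :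
    cot ρ :=
  ⟨f, isCot_of_hasCompactSupport ρ.continuous (contDiff_infty.1 hf 2) hc⟩

/-- The arguments `(⟨f_1, ρ⟩, …, ⟨f_l, ρ⟩, e)` of a cylinder function. -/
def coords {l : ℕ} (f : Fin l → Phase d → ℝ) (z : M.ExtState) : (Fin l → ℝ) × ℝ :=
  (fun j => ∫ y, f j y * z.1.1 y, z.2)

lemma clm_apply_eq_sum {l : ℕ} (A : (Fin l → ℝ) × ℝ →L[ℝ] ℝ) (a : Fin l → ℝ) (s : ℝ) :
    A (a, s) = ∑ j, a j * A (Pi.single j 1, 0) + s * A (0, 1) := by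
  have h : (a, s) = ∑ j, a j • ((Pi.single j 1, 0) : (Fin l → ℝ) × ℝ)
      + s • ((0, 1) : (Fin l → ℝ) × ℝ) := by
    ext k
    · simp [Prod.fst_sum, Finset.sum_apply, Pi.single_apply]
    · simp [Prod.snd_sum]
  conv_lhs => rw [h]
  simp only [map_add, map_sum, map_smul, smul_eq_mul]

lemma hasExtDiff_cylinder {l : ℕ} {f : Fin l → Phase d → ℝ}
    (hf : ∀ j, ContDiff ℝ ∞ (f j) ∧ HasCompactSupport (f j)) {φ : (Fin l → ℝ) × ℝ → ℝ}
    (hφ : Differentiable ℝ φ) (z : M.ExtState) :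
    HasExtDiff (fun z : M.ExtState => φ (coords f z)) z
      (∑ j, fderiv ℝ φ (coords f z) (Pi.single j 1, 0) • testCot z.1 (hf j).1 (hf j).2,
        fderiv ℝ φ (coords f z) (0, 1)) := by
  refine HasExtDiff.of_density (U := fun r e => φ (fun j => ∫ y, f j y * r y, e)) fun σ s => ?_
  have h1 : ∀ (t : ℝ) j, ∫ y, f j y * (z.1.1 y + t * σ.toFun y)
      = (∫ y, f j y * z.1.1 y) + t * ∫ y, f j y * σ.toFun y := fun t j => by
    have i1 := (testCot z.1 (hf j).1 (hf j).2).2.integrable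
    have i2 := cot.integrable_mul (testCot z.1 (hf j).1 (hf j).2) σ
    simp only [testCot] at i1 i2
    rw [← integral_const_mul, ← integral_add i1 (i2.const_mul t)]
    refine integral_congr_ae (Eventually.of_forall fun y => ?_)
    simp only []
    ring
  simp only [h1]
  have h2 : HasDerivAt (fun t : ℝ => ((fun j => (∫ y, f j y * z.1.1 y)
      + t * ∫ y, f j y * σ.toFun y, z.2 + t * s) : (Fin l → ℝ) × ℝ))
      (fun j => ∫ y, f j y * σ.toFun y, s) 0 := by
    refine HasDerivAt.prodMk (hasDerivAt_pi.2 fun j => ?_) ?_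
    · simpa using ((hasDerivAt_id (0 : ℝ)).mul_const (∫ y, f j y * σ.toFun y)).const_add
        (∫ y, f j y * z.1.1 y)
    · simpa using ((hasDerivAt_id (0 : ℝ)).mul_const s).const_add z.2
  have h3 : HasFDerivAt φ (fderiv ℝ φ (coords f z))
      (fun j => (∫ y, f j y * z.1.1 y) + 0 * ∫ y, f j y * σ.toFun y, z.2 + 0 * s) := by
    simp only [zero_mul, add_zero]
    exact (hφ _).hasFDerivAt
  refine (h3.comp_hasDerivAt (0 : ℝ) h2).congr_deriv ?_
  rw [clm_apply_eq_sum]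
  have h4 : ∀ j, variationPair z σ s (testCot z.1 (hf j).1 (hf j).2, 0)
      = ∫ y, f j y * σ.toFun y := fun j => by
    simp [variationPair, testCot]
  have h5 : variationPair z σ s (0, 1) = s := by simp [variationPair]
  have h6 : ((∑ j, fderiv ℝ φ (coords f z) (Pi.single j 1, 0) • testCot z.1 (hf j).1 (hf j).2,
        fderiv ℝ φ (coords f z) (0, 1)) : cot z.1 × ℝ)
      = ∑ j, fderiv ℝ φ (coords f z) (Pi.single j 1, 0)
          • ((testCot z.1 (hf j).1 (hf j).2, 0) : cot z.1 × ℝ)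
        + fderiv ℝ φ (coords f z) (0, 1) • ((0, 1) : cot z.1 × ℝ) := by
    refine Prod.ext ?_ ?_
    · simp [Prod.fst_sum]
    · simp [Prod.snd_sum]
  rw [h6, map_add, map_sum, map_smul, h5]
  simp only [map_smul, h4, smul_eq_mul, mul_comm]

end Model

/-! ### Smoothness of gradients and of the mean field -/

lemma toDual_symm_apply_coord (A : Conf d →L[ℝ] ℝ) (i : Fin d) :
    (InnerProductSpace.toDual ℝ (Conf d)).symm A i = A (EuclideanSpace.single i 1) := by
  rw [← InnerProductSpace.toDual_symm_apply (𝕜 := ℝ), real_inner_comm,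
    EuclideanSpace.inner_single_left]
  simp

lemma contDiff_toDual_symm {n : WithTop ℕ∞} :
    ContDiff ℝ n fun A : Conf d →L[ℝ] ℝ => (InnerProductSpace.toDual ℝ (Conf d)).symm A := by
  rw [contDiff_euclidean]
  intro i
  simp only [toDual_symm_apply_coord]
  exact (ContinuousLinearMap.apply ℝ ℝ (EuclideanSpace.single i (1 : ℝ))).contDiff

lemma contDiff_gradient {f : Conf d → ℝ} {n m : WithTop ℕ∞} (hf : ContDiff ℝ m f)
    (h : n + 1 ≤ m) : ContDiff ℝ n (gradient f) :=
  contDiff_toDual_symm.comp (hf.fderiv_right h)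

namespace Model

variable {M : Model d}

lemma contDiff_gradQ {f : Phase d → ℝ} (hf : ContDiff ℝ ∞ f) (n : ℕ) : ContDiff ℝ n (gradQ f) := by
  rw [funext (gradQ_eq (hf.differentiable (by simp)))]
  exact contDiff_toDual_symm.comp
    (((contDiff_infty.1 hf (n + 1)).fderiv_right (by norm_cast)).clm_comp contDiff_const)

lemma contDiff_gradP {f : Phase d → ℝ} (hf : ContDiff ℝ ∞ f) (n : ℕ) : ContDiff ℝ n (gradP f) := by
  rw [funext (gradP_eq (hf.differentiable (by simp)))]
  exact contDiff_toDual_symm.comp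
    (((contDiff_infty.1 hf (n + 1)).fderiv_right (by norm_cast)).clm_comp contDiff_const)

lemma gradient_Φ_neg (x : Conf d) : gradient M.Φ (-x) = -gradient M.Φ x := by
  have hd : Differentiable ℝ M.Φ := M.contDiff_Φ.differentiable (by norm_num)
  have h1 := ((hd (-x)).hasFDerivAt.comp x (hasFDerivAt_id x).neg).fderiv
  have h2 : M.Φ ∘ (fun y => -id y) = M.Φ := funext M.even_Φ
  change fderiv ℝ (M.Φ ∘ fun y => -id y) x = _ at h1
  rw [h2] at h1
  simp [gradient, h1, ContinuousLinearMap.comp_neg]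

/-- Differentiation under the integral: if a kernel and its derivatives up to order `n` have
locally uniform integrable bounds, then its convolution with a state is `Cⁿ`. -/
lemma contDiff_integral_smul_sub (ρ : M.State) (n : ℕ) :
    ∀ {F : Type} [NormedAddCommGroup F] [NormedSpace ℝ F] {K : Conf d → F}, ContDiff ℝ n K →
    (∀ R : ℝ, ∃ w : Conf d → ℝ,
      (∀ k : ℕ, k ≤ n → ∀ x q : Conf d, ‖x‖ ≤ R → ‖iteratedFDeriv ℝ k K (x - q)‖ ≤ w q) ∧
      Integrable fun y : Phase d => w y.1 * ρ.1 y) →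
    ContDiff ℝ n fun x => ∫ y, ρ.1 y • K (x - y.1) := by
  have hr := ρ.continuous
  have hball : ∀ x₀ : Conf d, ∀ x ∈ Metric.ball x₀ 1, ‖x‖ ≤ ‖x₀‖ + 1 := fun x₀ x hx => by
    have := norm_le_norm_add_norm_sub' x x₀
    have h2 : ‖x - x₀‖ < 1 := by simpa [dist_eq_norm] using hx
    linarith
  have hle : ∀ (y : Phase d) {a b : ℝ}, a ≤ b → ρ.1 y * a ≤ b * ρ.1 y := fun y a b h => by
    rw [mul_comm]
    exact mul_le_mul_of_nonneg_right h (ρ.2.pos y).le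
  induction n with
  | zero =>
    intro F _ _ K hK hw
    have hKc := hK.continuous
    rw [Nat.cast_zero, contDiff_zero, continuous_iff_continuousAt]
    intro x₀
    obtain ⟨w, hw, hi⟩ := hw (‖x₀‖ + 1)
    refine continuousAt_of_dominated (bound := fun y : Phase d => w y.1 * ρ.1 y)
      (Eventually.of_forall fun x => Continuous.aestronglyMeasurable (by fun_prop)) ?_ hi
      (Eventually.of_forall fun y => by fun_prop)
    filter_upwards [Metric.ball_mem_nhds x₀ one_pos] with x hx
    refine Eventually.of_forall fun y => ?_
    have h1 := hw 0 le_rfl x y.1 (hball x₀ x hx)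
    rw [norm_iteratedFDeriv_zero] at h1
    rw [norm_smul, Real.norm_of_nonneg (ρ.2.pos y).le]
    exact hle y h1
  | succ n ih =>
    intro F _ _ K hK hw
    have hKc := hK.continuous
    have hK1 : ContDiff ℝ 1 K := hK.of_le (by norm_cast; omega)
    have hKd : Differentiable ℝ K := hK1.differentiable one_ne_zero
    have hKf : Continuous (fderiv ℝ K) := hK1.continuous_fderiv one_ne_zero
    have hder : ∀ x₀, HasFDerivAt (fun x => ∫ y, ρ.1 y • K (x - y.1))
        (∫ y, ρ.1 y • fderiv ℝ K (x₀ - y.1)) x₀ := fun x₀ => by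
      obtain ⟨w, hw, hi⟩ := hw (‖x₀‖ + 1)
      refine hasFDerivAt_integral_of_dominated_of_fderiv_le (𝕜 := ℝ) (μ := volume)
        (F := fun (x : Conf d) (y : Phase d) => ρ.1 y • K (x - y.1))
        (F' := fun x y => ρ.1 y • fderiv ℝ K (x - y.1))
        (bound := fun y => w y.1 * ρ.1 y) (Metric.ball_mem_nhds x₀ one_pos)
        (Eventually.of_forall fun x => Continuous.aestronglyMeasurable (by fun_prop))
        (hi.mono' (Continuous.aestronglyMeasurable (by fun_prop))
          (Eventually.of_forall fun y => ?_))
        (Continuous.aestronglyMeasurable (by fun_prop))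
        (Eventually.of_forall fun y x hx => ?_) hi (Eventually.of_forall fun y x _ => ?_)
      · have h1 := hw 0 (Nat.zero_le _) x₀ y.1 (by linarith)
        rw [norm_iteratedFDeriv_zero] at h1
        rw [norm_smul, Real.norm_of_nonneg (ρ.2.pos y).le]
        exact hle y h1
      · have h1 := hw 1 (by omega) x y.1 (hball x₀ x hx)
        rw [norm_iteratedFDeriv_one] at h1
        rw [norm_smul, Real.norm_of_nonneg (ρ.2.pos y).le]
        exact hle y h1
      · have h1 : HasFDerivAt (fun x => K (x - y.1)) (fderiv ℝ K (x - y.1)) x := by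
          exact (hKd (x - y.1)).hasFDerivAt.comp x ((hasFDerivAt_id x).sub_const y.1)
        exact h1.const_smul (ρ.1 y)
    rw [Nat.cast_succ, contDiff_succ_iff_fderiv]
    refine ⟨fun x => (hder x).differentiableAt, fun h => absurd h (by simp), ?_⟩
    rw [funext fun x => (hder x).fderiv]
    refine ih (hK.fderiv_right (by norm_cast)) fun R => ?_
    obtain ⟨w, hw, hi⟩ := hw R
    refine ⟨w, fun k hk x q hx => ?_, hi⟩
    rw [norm_iteratedFDeriv_fderiv]
    exact hw (k + 1) (by omega) x q hx

lemma contDiff_conv_state (ρ : M.State) : ContDiff ℝ 3 (M.conv ρ.1) := by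
  have h := contDiff_integral_smul_sub ρ 3 (K := M.Φ) M.contDiff_Φ fun R => by
    obtain ⟨w, hw, hi⟩ := ρ.2.domination (|R|)
    have hw0 : ∀ q, 0 ≤ w q := fun q =>
      (norm_nonneg _).trans (hw 0 (by norm_num) q 0 (by simp))
    refine ⟨w, fun k hk x q hx => ?_, ?_⟩
    · have h1 := hw k hk q x (hx.trans (le_abs_self R))
      have h2 : M.Φ ∘ LinearIsometryEquiv.neg ℝ = M.Φ := funext M.even_Φ
      have h3 := (LinearIsometryEquiv.neg ℝ).norm_iteratedFDeriv_comp_right M.Φ (q - x) k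
      rw [h2, LinearIsometryEquiv.coe_neg] at h3
      simp only [neg_sub] at h3
      rwa [← h3]
    · have hc : Continuous fun y : Phase d => (1 + ‖y.2‖)⁻¹ :=
        Continuous.inv₀ (by fun_prop) fun y => by positivity
      refine (hi.bdd_mul (c := 1) hc.aestronglyMeasurable
        (Eventually.of_forall fun y => ?_)).congr (Eventually.of_forall fun y => ?_)
      · rw [Real.norm_of_nonneg (by positivity)]
        exact inv_le_one_of_one_le₀ (by simp)
      · have : (1 + ‖y.2‖) ≠ 0 := by positivity
        field_simp
  have e : M.conv ρ.1 = fun x => ∫ y, ρ.1 y • M.Φ (x - y.1) := by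
    ext q
    simp only [conv, smul_eq_mul, mul_comm]
  rw [e]
  exact h

lemma contDiff_convGrad_state (ρ : M.State) : ContDiff ℝ 2 (M.convGrad ρ.1) := by
  have h : M.convGrad ρ.1 = gradient (M.conv ρ.1) :=
    funext fun q => (hasGradientAt_conv ρ q).gradient.symm
  rw [h]
  exact contDiff_gradient (contDiff_conv_state ρ) (by norm_num)

lemma continuous_gradient_Φ : Continuous (gradient M.Φ) := continuous_gradient M.contDiff_Φ

lemma continuous_convGrad {g : Phase d → ℝ} (hg : Continuous g) (hc : HasCompactSupport g) :
    Continuous (M.convGrad g) :=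
  (contDiff_positionConvolution (n := 0) (ContinuousLinearMap.lsmul ℝ ℝ)
    (contDiff_zero.2 hg) hc continuous_gradient_Φ).continuous

lemma State.integrable_smul_gradient (ρ : M.State) (q : Conf d) :
    Integrable fun y : Phase d => ρ.1 y • gradient M.Φ (q - y.1) := by
  obtain ⟨w, -, hw, hi⟩ := ρ.exists_weight ‖q‖
  have := ρ.continuous
  have := continuous_gradient_Φ (M := M)
  refine hi.mono' (Continuous.aestronglyMeasurable (by fun_prop))
    (Eventually.of_forall fun y => ?_)
  have hr := (ρ.2.pos y).le
  have h1 := hw y.1 q le_rfl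
  rw [← neg_sub, gradient_Φ_neg, norm_neg] at h1
  have h0 := (norm_nonneg _).trans h1
  rw [norm_smul, Real.norm_of_nonneg hr, mul_comm]
  gcongr
  calc ‖gradient M.Φ (q - y.1)‖ ≤ 1 * w y.1 := by rwa [one_mul]
    _ ≤ (1 + ‖y.2‖) * w y.1 := by gcongr; simp

lemma convGrad_add_mul (ρ : M.State) (σ : Variation d) (t : ℝ) (q : Conf d) :
    M.convGrad (fun y => ρ.1 y + t * σ.toFun y) q
      = M.convGrad ρ.1 q + t • M.convGrad σ.toFun q := by
  have hσ : Integrable fun y : Phase d => σ.toFun y • gradient M.Φ (q - y.1) := by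
    have := σ.continuous
    have := continuous_gradient_Φ (M := M)
    exact Continuous.integrable_of_hasCompactSupport (by fun_prop) σ.compact.smul_right
  simp only [convGrad]
  rw [← integral_smul]
  refine Eq.trans (integral_congr_ae (Eventually.of_forall fun y => ?_))
    (integral_add (ρ.integrable_smul_gradient q) (hσ.smul t))
  simp only [add_smul, mul_smul]

/-! ### The Hamiltonian vector field of the energy on smooth functions -/

/-- The Poisson bracket `{f, dE}` of a test function with the mean-field Hamiltonian. -/
def poissonEnergy (M : Model d) (f r : Phase d → ℝ) (y : Phase d) : ℝ :=
  inner ℝ (M.m⁻¹ • y.2) (gradQ f y) - inner ℝ (gradient M.V y.1 + M.convGrad r y.1) (gradP f y)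

/-- The inner product of positions or momenta as a continuous `ℝ`-bilinear map. -/
def innerBilin (d : ℕ) : Conf d →L[ℝ] Conf d →L[ℝ] ℝ :=
  LinearMap.mkContinuous₂ (innerₗ (Conf d)) 1 fun x y => by
    simpa using norm_inner_le_norm (𝕜 := ℝ) x y

@[simp]
lemma innerBilin_apply (x y : Conf d) : innerBilin d x y = inner ℝ x y := rfl

/-- The functional derivative of `ρ ↦ ∫ {f, dE(ρ)} dρ` that stems from the mean field:
`q ↦ ∫ ⟨∇Φ(q - q'), ∇_p f(q', p')⟩ ρ(dq', dp')`. -/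
def meanFieldResponse (M : Model d) (f r : Phase d → ℝ) (q : Conf d) : ℝ :=
  ∫ y, innerBilin d (r y • gradP f y) (gradient M.Φ (q - y.1))

lemma LdE_testCot (ρ : M.State) {f : Phase d → ℝ} (hf : ContDiff ℝ ∞ f)
    (hc : HasCompactSupport f) :
    LdE ρ (testCot ρ hf hc) = ∫ y, M.poissonEnergy f ρ.1 y * ρ.1 y := by
  simp only [LdE_apply, gradQ_dEnergy, gradP_dEnergy, testCot, poissonEnergy]

lemma hasCompactSupport_poissonEnergy {f : Phase d → ℝ} (hf : ContDiff ℝ ∞ f)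
    (hc : HasCompactSupport f)
    (r : Phase d → ℝ) :
    HasCompactSupport (M.poissonEnergy f r) := by
  have hf1 := contDiff_infty.1 hf 1
  refine HasCompactSupport.sub ?_ ?_
  · exact (hasCompactSupport_gradQ hf1 hc).mono' fun y hy => subset_tsupport _ fun h => hy (by
      simp [h])
  · exact (hasCompactSupport_gradP hf1 hc).mono' fun y hy => subset_tsupport _ fun h => hy (by
      simp [h])

lemma isCot_poissonEnergy {f : Phase d → ℝ} (hf : ContDiff ℝ ∞ f) (hc : HasCompactSupport f)
    (ρ : M.State) : M.IsCot ρ.1 (M.poissonEnergy f ρ.1) := by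
  refine isCot_of_hasCompactSupport ρ.continuous ?_ (hasCompactSupport_poissonEnergy hf hc _)
  have h1 := contDiff_gradQ hf 2
  have h2 := contDiff_gradP hf 2
  have h3 := contDiff_convGrad_state ρ
  have h4 : ContDiff ℝ 2 (gradient M.V) := contDiff_gradient M.contDiff_V (by norm_num)
  have h5 : ContDiff ℝ 2 fun y : Phase d => M.m⁻¹ • y.2 := contDiff_snd.const_smul _
  exact (h5.inner ℝ h1).sub
    (((h4.comp contDiff_fst).add (h3.comp contDiff_fst)).inner ℝ h2)

lemma isCot_meanFieldResponse {f : Phase d → ℝ} (hf : ContDiff ℝ ∞ f) (hc : HasCompactSupport f)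
    (ρ : M.State) :
    M.IsCot ρ.1 fun y => M.meanFieldResponse f ρ.1 y.1 := by
  have hP : ContDiff ℝ 2 (gradP f) := contDiff_gradP hf 2
  have h1 : ContDiff ℝ 2 fun y => ρ.1 y • gradP f y := ρ.2.contDiff.smul hP
  have h2 : HasCompactSupport fun y => ρ.1 y • gradP f y :=
    HasCompactSupport.smul_left (f := ρ.1)
      (hasCompactSupport_gradP (contDiff_infty.1 hf 1) hc)
  obtain ⟨R, C, -, h⟩ := exists_positionConvolution_le (innerBilin d)
    (h1.of_le (by norm_num)) h2 (continuous_gradient_Φ (M := M))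
  obtain ⟨w, -, hw, hi⟩ := ρ.exists_weight R
  have h3 : ContDiff ℝ 2 (M.meanFieldResponse f ρ.1) :=
    contDiff_positionConvolution (n := 2) (innerBilin d) h1 h2 continuous_gradient_Φ
  have h4 : ∀ q, |M.meanFieldResponse f ρ.1 q| ≤ C * w q := fun q => (h w hw q).1
  have h5 : ∀ q, ‖fderiv ℝ (M.meanFieldResponse f ρ.1) q‖ ≤ C * w q := fun q => (h w hw q).2
  exact isCot_position ρ.continuous ρ.2.pos h3 hi h4 h5

/-- The differential of `ρ ↦ ⟨L(ρ) dE(ρ), f⟩`. -/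
def responseCot {f : Phase d → ℝ} (hf : ContDiff ℝ ∞ f) (hc : HasCompactSupport f)
    (ρ : M.State) : cot ρ :=
  ⟨M.poissonEnergy f ρ.1, isCot_poissonEnergy hf hc ρ⟩
    + ⟨fun y => M.meanFieldResponse f ρ.1 y.1, isCot_meanFieldResponse hf hc ρ⟩

/-- Fubini, with `∇Φ` odd: the mean field of `σ` acting on `f` is the pairing of
`σ` with the response. -/
lemma integral_inner_convGrad {f : Phase d → ℝ} (hf : ContDiff ℝ ∞ f) (hc : HasCompactSupport f)
    (ρ : M.State) (σ : Variation d) :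
    ∫ y, inner ℝ (M.convGrad σ.toFun y.1) (gradP f y) * ρ.1 y
      = -∫ y, M.meanFieldResponse f ρ.1 y.1 * σ.toFun y := by
  have hf1 := contDiff_infty.1 hf 1
  have hg := continuous_gradP hf1
  have hgc := hasCompactSupport_gradP hf1 hc
  have hΦ := continuous_gradient_Φ (M := M)
  have hr := ρ.continuous
  have hσ := σ.continuous
  have e1 : ∀ y, inner ℝ (M.convGrad σ.toFun y.1) (gradP f y) * ρ.1 y
      = ∫ z, inner ℝ (gradient M.Φ (y.1 - z.1)) (gradP f y) * ρ.1 y * σ.toFun z := fun y => by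
    have hi : Integrable fun z : Phase d => σ.toFun z • gradient M.Φ (y.1 - z.1) :=
      Continuous.integrable_of_hasCompactSupport (by fun_prop) σ.compact.smul_right
    rw [real_inner_comm, convGrad, ← integral_inner hi, ← integral_mul_const]
    refine integral_congr_ae (Eventually.of_forall fun z => ?_)
    simp only [inner_smul_right, real_inner_comm]
    ring
  have e2 : ∀ z, -(M.meanFieldResponse f ρ.1 z.1 * σ.toFun z)
      = ∫ y, inner ℝ (gradient M.Φ (y.1 - z.1)) (gradP f y) * ρ.1 y * σ.toFun z := fun z => by
    rw [integral_mul_const, meanFieldResponse, ← neg_mul, ← integral_neg]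
    congr 1
    refine integral_congr_ae (Eventually.of_forall fun y => ?_)
    simp only [innerBilin_apply, ← neg_sub y.1 z.1, gradient_Φ_neg, inner_neg_right,
      inner_smul_left, neg_neg, real_inner_comm]
    simp only [RCLike.conj_to_real]
    ring
  rw [← integral_neg]
  simp only [e1, e2]
  refine integral_integral_swap_of_hasCompactSupport
    (f := fun y z : Phase d => inner ℝ (gradient M.Φ (y.1 - z.1)) (gradP f y) * ρ.1 y * σ.toFun z)
    (by simp only [Function.uncurry_def]; fun_prop) ?_
  refine HasCompactSupport.intro (hgc.isCompact.prod σ.compact.isCompact) fun x hx => ?_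
  simp only [mem_prod, not_and_or] at hx
  rcases hx with hx | hx
  · simp [Function.uncurry, image_eq_zero_of_notMem_tsupport hx]
  · simp [Function.uncurry, image_eq_zero_of_notMem_tsupport hx]

/-- `⟨L(ρ) dE(ρ), f⟩` is a quadratic functional of the density. -/
lemma hasExtDiff_LdE {f : Phase d → ℝ} (hf : ContDiff ℝ ∞ f) (hc : HasCompactSupport f)
    (z : M.ExtState) :
    HasExtDiff (fun z : M.ExtState => LdE z.1 (testCot z.1 hf hc)) z (responseCot hf hc z.1, 0) := by
  simp only [LdE_testCot]
  refine HasExtDiff.of_density (U := fun r _ => ∫ y, M.poissonEnergy f r y * r y) fun σ s => ?_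
  have hf1 := contDiff_infty.1 hf 1
  have hg := continuous_gradP hf1
  have hgc := hasCompactSupport_gradP hf1 hc
  have hσ := σ.continuous
  have hr := z.1.continuous
  have hac := (cot.contDiff
    (⟨M.poissonEnergy f z.1.1, isCot_poissonEnergy hf hc z.1⟩ : cot z.1)).continuous
  simp only [] at hac
  have has := hasCompactSupport_poissonEnergy (M := M) hf hc z.1.1
  have hv : Continuous (M.convGrad σ.toFun) := continuous_convGrad hσ σ.compact
  set a := M.poissonEnergy f z.1.1
  let b : Phase d → ℝ := fun y => inner ℝ (M.convGrad σ.toFun y.1) (gradP f y)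
  have hbc : Continuous b := by fun_prop
  have hbs : HasCompactSupport b :=
    hgc.mono' fun y hy => subset_tsupport _ fun h => hy (by simp [b, h])
  have i1 : Integrable fun y => a y * z.1.1 y :=
    (hac.mul hr).integrable_of_hasCompactSupport has.mul_right
  have i2 : Integrable fun y => a y * σ.toFun y :=
    (hac.mul hσ).integrable_of_hasCompactSupport has.mul_right
  have i3 : Integrable fun y => b y * z.1.1 y :=
    (hbc.mul hr).integrable_of_hasCompactSupport hbs.mul_right
  have i4 : Integrable fun y => b y * σ.toFun y :=
    (hbc.mul hσ).integrable_of_hasCompactSupport hbs.mul_right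
  have e : ∀ t : ℝ, ∫ y, M.poissonEnergy f (fun y => z.1.1 y + t * σ.toFun y) y
      * (z.1.1 y + t * σ.toFun y) = (∫ y, a y * z.1.1 y)
        + t * ((∫ y, a y * σ.toFun y) - ∫ y, b y * z.1.1 y) - t ^ 2 * ∫ y, b y * σ.toFun y := by
    intro t
    rw [← integral_sub i2 i3, ← integral_const_mul, ← integral_const_mul]
    have j1 : Integrable fun y => t * (a y * σ.toFun y - b y * z.1.1 y) := (i2.sub i3).const_mul t
    have j2 : Integrable fun y => a y * z.1.1 y + t * (a y * σ.toFun y - b y * z.1.1 y) :=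
      i1.add j1
    rw [← integral_add i1 j1, ← integral_sub j2 (i4.const_mul _)]
    refine integral_congr_ae (Eventually.of_forall fun y => ?_)
    have h1 : M.poissonEnergy f (fun y => z.1.1 y + t * σ.toFun y) y = a y - t * b y := by
      simp only [a, b, poissonEnergy, convGrad_add_mul, inner_add_left, inner_smul_left]
      simp only [RCLike.conj_to_real]
      ring
    simp only [h1]
    ring
  simp only [e]
  have h1 := ((hasDerivAt_id (0 : ℝ)).mul_const
    ((∫ y, a y * σ.toFun y) - ∫ y, b y * z.1.1 y)).const_add (∫ y, a y * z.1.1 y)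
  have h2 := ((hasDerivAt_id (0 : ℝ)).pow 2).mul_const (∫ y, b y * σ.toFun y)
  refine (h1.sub h2).congr_deriv ?_
  have h3 : ∫ y, b y * z.1.1 y = -∫ y, M.meanFieldResponse f z.1.1 y.1 * σ.toFun y :=
    integral_inner_convGrad hf hc z.1 σ
  have h4 : variationPair z σ s (responseCot hf hc z.1, 0)
      = (∫ y, a y * σ.toFun y) + ∫ y, M.meanFieldResponse f z.1.1 y.1 * σ.toFun y := by
    have h5 : ((responseCot hf hc z.1, 0) : cot z.1 × ℝ)
        = ((⟨M.poissonEnergy f z.1.1, isCot_poissonEnergy hf hc z.1⟩ : cot z.1), 0)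
          + ((⟨fun y => M.meanFieldResponse f z.1.1 y.1,
            isCot_meanFieldResponse hf hc z.1⟩ : cot z.1), 0) := by
      simp [responseCot]
    rw [h5, map_add]
    simp [variationPair, a]
  rw [h4, h3]
  simp

/-! ### The Poisson bracket and the Jacobi identity -/

/-- A smooth function `F` has two derivatives `X F = ⟨L dE, dF⟩` (along the Hamiltonian vector
field) and `∂ F = ∂F/∂e`, which do not depend on the choice of differential, are again
differentiable, and commute: `∂ X F = X ∂ F`, by the symmetry of second derivatives. -/
lemma exists_commuting_derivatives {F : M.ExtState → ℝ} (hF : IsExtCylinder F) :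
    ∃ XF DF : M.ExtState → ℝ, (∀ z, ∃ ξ, HasExtDiff F z ξ) ∧
      (∀ z ξ, HasExtDiff F z ξ → LdE z.1 ξ.1 = XF z ∧ ξ.2 = DF z) ∧
      ∀ z, ∃ ξ η, HasExtDiff XF z ξ ∧ HasExtDiff DF z η ∧ ξ.2 = LdE z.1 η.1 := by
  obtain ⟨l, f, φ, hf, hφ, hFφ⟩ := hF
  have hFeq : F = fun z => φ (coords f z) := funext hFφ
  have hφd : Differentiable ℝ φ := hφ.differentiable (by simp)
  have hdir : ∀ v, ContDiff ℝ ∞ fun x => fderiv ℝ φ x v := fun v =>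
    (hφ.fderiv_right (m := ∞) (by simp)).clm_apply contDiff_const
  have hdird : ∀ v, Differentiable ℝ fun x => fderiv ℝ φ x v := fun v =>
    (hdir v).differentiable (by simp)
  let e : Fin l → (Fin l → ℝ) × ℝ := fun j => (Pi.single j 1, 0)
  have hd := fun z : M.ExtState => hasExtDiff_cylinder hf hφd z
  refine ⟨fun z => ∑ j, fderiv ℝ φ (coords f z) (e j) * LdE z.1 (testCot z.1 (hf j).1 (hf j).2),
    fun z => fderiv ℝ φ (coords f z) (0, 1), fun z => ⟨_, hFeq ▸ hd z⟩, fun z ξ hξ => ?_,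
    fun z => ⟨_, _, HasExtDiff.sum Finset.univ fun j =>
      (hasExtDiff_cylinder hf (hdird (e j)) z).mul (hasExtDiff_LdE (hf j).1 (hf j).2 z),
      hasExtDiff_cylinder hf (hdird (0, 1)) z, ?_⟩⟩
  · rw [hFeq] at hξ
    obtain ⟨h2, c, hc⟩ := hξ.unique (hd z)
    refine ⟨?_, h2⟩
    rw [LdE_eq_of_add_const hc, map_sum]
    simp only [map_smul, smul_eq_mul, e]
  · have hsymm : IsSymmSndFDerivAt ℝ φ (coords f z) :=
      (contDiff_infty.1 hφ 2).contDiffAt.isSymmSndFDerivAt (by simp)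
    have hsnd : ∀ v w, fderiv ℝ (fun x => fderiv ℝ φ x v) (coords f z) w
        = fderiv ℝ (fderiv ℝ φ) (coords f z) w v := fun v w => by
      have h : DifferentiableAt ℝ (fderiv ℝ φ) (coords f z) :=
        (hφ.fderiv_right (m := ∞) (by simp)).differentiable (by simp) _
      rw [fderiv_clm_apply h (differentiableAt_const v)]
      simp
    rw [Prod.snd_sum, map_sum]
    refine Finset.sum_congr rfl fun j _ => ?_
    simp only [Prod.snd_add, Prod.smul_snd, smul_eq_mul, mul_zero, add_zero, map_smul, hsnd]
    rw [hsymm (0, 1) (e j), mul_comm]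

lemma hasExtDiff_d {U : M.ExtState → ℝ} {z : M.ExtState} {ξ : cot z.1 × ℝ}
    (h : HasExtDiff U z ξ) : HasExtDiff U z (M.extGeometry.d U z) := by
  have hex : ∃ ξ, M.extGeometry.HasDiff U z ξ := ⟨ξ, h⟩
  have e : M.extGeometry.d U z = hex.choose := dif_pos hex
  rw [e]
  exact hex.choose_spec

/-- The bracket is `{F, G} = ∂G XF - XG ∂F`. -/
lemma bracket_eq {F G : M.ExtState → ℝ} {z : M.ExtState} {ξ η : cot z.1 × ℝ}
    (hF : HasExtDiff F z ξ) (hG : HasExtDiff G z η) :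
    M.extGeometry.bracket M.extL F G z = η.2 * LdE z.1 ξ.1 - LdE z.1 η.1 * ξ.2 := by
  obtain ⟨h2, c, h1⟩ := (hasExtDiff_d hF).unique hF
  obtain ⟨k2, c', k1⟩ := (hasExtDiff_d hG).unique hG
  have e : M.extGeometry.bracket M.extL F G z
      = (M.extGeometry.d G z).2 * LdE z.1 (M.extGeometry.d F z).1
        + -LdE z.1 (M.extGeometry.d G z).1 * (M.extGeometry.d F z).2 := rfl
  rw [e, h2, k2, LdE_eq_of_add_const h1, LdE_eq_of_add_const k1]
  ring

/-- `L̂` is Poisson because its bracket is `∂G XF - XG ∂F` for two commuting derivations. -/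
theorem isPoisson_extL (M : Model d) : M.extGeometry.IsPoisson M.extL := by
  have hbr : ∀ {F G XF DF XG DG : M.ExtState → ℝ}, (∀ z, ∃ ξ, HasExtDiff F z ξ) →
      (∀ z, ∃ ξ, HasExtDiff G z ξ) →
      (∀ z ξ, HasExtDiff F z ξ → LdE z.1 ξ.1 = XF z ∧ ξ.2 = DF z) →
      (∀ z ξ, HasExtDiff G z ξ → LdE z.1 ξ.1 = XG z ∧ ξ.2 = DG z) →
      M.extGeometry.bracket M.extL F G = fun z => DG z * XF z - XG z * DF z := by
    intro F G XF DF XG DG hF hG hF' hG'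
    funext z
    obtain ⟨ξ, hξ⟩ := hF z
    obtain ⟨η, hη⟩ := hG z
    rw [bracket_eq hξ hη, (hF' z ξ hξ).1, (hF' z ξ hξ).2, (hG' z η hη).1, (hG' z η hη).2]
  refine ⟨fun z ξ η => ?_, fun F hF => ?_, fun F G hF hG => ?_, fun F₁ F₂ F₃ h₁ h₂ h₃ z => ?_⟩
  · change ξ.2 * LdE z.1 η.1 + -LdE z.1 ξ.1 * η.2 = -(η.2 * LdE z.1 ξ.1 + -LdE z.1 η.1 * ξ.2)
    ring
  · obtain ⟨-, -, h, -⟩ := exists_commuting_derivatives hF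
    exact h
  · obtain ⟨XF, DF, hF0, hF1, hF2⟩ := exists_commuting_derivatives hF
    obtain ⟨XG, DG, hG0, hG1, hG2⟩ := exists_commuting_derivatives hG
    rw [hbr hF0 hG0 hF1 hG1]
    intro z
    obtain ⟨ξ, η, hX, hD, -⟩ := hF2 z
    obtain ⟨ξ', η', hX', hD', -⟩ := hG2 z
    exact ⟨_, (hD'.mul hX).sub (hX'.mul hD)⟩
  -- Jacobi: expanding `{{F₁, F₂}, F₃}` by the product rule, the second derivatives `X ∂ F = ∂ X F`
  -- and `∂ ∂ F`, `X X F` cancel in the cyclic sum.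
  · obtain ⟨X₁, D₁, a₁, b₁, c₁⟩ := exists_commuting_derivatives h₁
    obtain ⟨X₂, D₂, a₂, b₂, c₂⟩ := exists_commuting_derivatives h₂
    obtain ⟨X₃, D₃, a₃, b₃, c₃⟩ := exists_commuting_derivatives h₃
    rw [hbr a₁ a₂ b₁ b₂, hbr a₃ a₁ b₃ b₁, hbr a₂ a₃ b₂ b₃]
    obtain ⟨ξ₁, η₁, x₁, y₁, s₁⟩ := c₁ z
    obtain ⟨ξ₂, η₂, x₂, y₂, s₂⟩ := c₂ z
    obtain ⟨ξ₃, η₃, x₃, y₃, s₃⟩ := c₃ z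
    obtain ⟨ω₁, o₁⟩ := a₁ z
    obtain ⟨ω₂, o₂⟩ := a₂ z
    obtain ⟨ω₃, o₃⟩ := a₃ z
    rw [bracket_eq ((y₂.mul x₁).sub (x₂.mul y₁)) o₃, bracket_eq ((y₁.mul x₃).sub (x₁.mul y₃)) o₂,
      bracket_eq ((y₃.mul x₂).sub (x₃.mul y₂)) o₁, (b₁ z ω₁ o₁).1, (b₁ z ω₁ o₁).2,
      (b₂ z ω₂ o₂).1, (b₂ z ω₂ o₂).2, (b₃ z ω₃ o₃).1, (b₃ z ω₃ o₃).2]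
    simp only [Prod.fst_sub, Prod.snd_sub, Prod.fst_add, Prod.snd_add, Prod.smul_fst,
      Prod.smul_snd, map_add, map_sub, map_smul, smul_eq_mul, s₁, s₂, s₃]
    ring

/-! ### Conservation of entropy by the Hamiltonian flow -/

lemma inner_gradQ {h : Phase d → ℝ} (hh : Differentiable ℝ h) (v : Conf d) (y : Phase d) :
    inner ℝ v (gradQ h y) = ∑ i, v i * fderiv ℝ h y (EuclideanSpace.single i 1, 0) := by
  rw [PiLp.inner_apply]
  refine Finset.sum_congr rfl fun i _ => ?_
  rw [gradQ_eq hh, toDual_symm_apply_coord]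
  simp [mul_comm]

lemma inner_gradP {h : Phase d → ℝ} (hh : Differentiable ℝ h) (v : Conf d) (y : Phase d) :
    inner ℝ v (gradP h y) = ∑ i, v i * fderiv ℝ h y (0, EuclideanSpace.single i 1) := by
  rw [PiLp.inner_apply]
  refine Finset.sum_congr rfl fun i _ => ?_
  rw [gradP_eq hh, toDual_symm_apply_coord]
  simp [mul_comm]

/-- Integration by parts in a direction in which the coefficient is constant. -/
lemma integral_mul_fderiv_eq_zero {c h : Phase d → ℝ} (hc : Continuous c) (hh : ContDiff ℝ 1 h)
    (hs : HasCompactSupport h) {v : Phase d}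
    (hv : ∀ (y : Phase d) (t : ℝ), c (y + t • v) = c y) :
    Integrable (fun y => c y * fderiv ℝ h y v) ∧ ∫ y, c y * fderiv ℝ h y v = 0 := by
  have hf : Continuous fun y => fderiv ℝ h y v :=
    (hh.continuous_fderiv one_ne_zero).clm_apply continuous_const
  have hfs : HasCompactSupport fun y => fderiv ℝ h y v :=
    hs.fderiv_apply (𝕜 := ℝ) v
  have hi : Integrable fun y => c y * fderiv ℝ h y v :=
    (hc.mul hf).integrable_of_hasCompactSupport hfs.mul_left
  refine ⟨hi, ?_⟩
  have h1 := integral_bilinear_hasLineDerivAt_right_eq_neg_left_of_integrable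
    (B := ContinuousLinearMap.mul ℝ ℝ) (μ := (volume : Measure (Phase d))) (f := c)
    (f' := fun _ => 0) (g := h) (g' := fun y => fderiv ℝ h y v) (v := v) (by simp) hi
    ((hc.mul hh.continuous).integrable_of_hasCompactSupport hs.mul_left)
    (fun y _ => by
      rw [HasLineDerivAt]
      simp only [hv]
      exact hasDerivAt_const _ _)
    (fun y _ => ((hh.differentiable one_ne_zero) y).hasFDerivAt.hasLineDerivAt v)
  simpa using h1

/-- The vector field `(a(p), -b(q))` is divergence free. -/
lemma integral_inner_grad_eq_zero {a b : Conf d → Conf d} (ha : Continuous a) (hb : Continuous b)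
    {h : Phase d → ℝ} (hh : ContDiff ℝ 1 h) (hs : HasCompactSupport h) :
    ∫ y, (inner ℝ (a y.2) (gradQ h y) - inner ℝ (b y.1) (gradP h y)) = 0 := by
  have hd := hh.differentiable one_ne_zero
  have h1 : ∀ i, _ := fun i => integral_mul_fderiv_eq_zero (c := fun y : Phase d => a y.2 i)
    (by fun_prop) hh hs (v := (EuclideanSpace.single i 1, 0)) (fun y t => by simp)
  have h2 : ∀ i, _ := fun i => integral_mul_fderiv_eq_zero (c := fun y : Phase d => b y.1 i)
    (by fun_prop) hh hs (v := (0, EuclideanSpace.single i 1)) (fun y t => by simp)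
  simp only [inner_gradQ hd, inner_gradP hd]
  rw [integral_sub (integrable_finsetSum _ fun i _ => (h1 i).1)
    (integrable_finsetSum _ fun i _ => (h2 i).1), integral_finsetSum _ fun i _ => (h1 i).1,
    integral_finsetSum _ fun i _ => (h2 i).1]
  simp only [(h1 _).2, (h2 _).2, Finset.sum_const_zero, sub_zero]

lemma norm_gradQ_le {h : Phase d → ℝ} (hh : Differentiable ℝ h) (y : Phase d) :
    ‖gradQ h y‖ ≤ ‖fderiv ℝ h y‖ := by
  rw [gradQ_eq hh, LinearIsometryEquiv.norm_map]
  refine (ContinuousLinearMap.opNorm_comp_le _ _).trans ?_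
  exact mul_le_of_le_one_right (norm_nonneg _) (ContinuousLinearMap.norm_inl_le_one ℝ _ _)

lemma norm_gradP_le {h : Phase d → ℝ} (hh : Differentiable ℝ h) (y : Phase d) :
    ‖gradP h y‖ ≤ ‖fderiv ℝ h y‖ := by
  rw [gradP_eq hh, LinearIsometryEquiv.norm_map]
  refine (ContinuousLinearMap.opNorm_comp_le _ _).trans ?_
  exact mul_le_of_le_one_right (norm_nonneg _) (ContinuousLinearMap.norm_inr_le_one ℝ _ _)

/-- Smooth cutoff functions on phase space, with gradients tending to zero uniformly. -/
lemma exists_cutoff (d : ℕ) : ∃ (χ : ℕ → Phase d → ℝ) (C : ℝ),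
    (∀ n, ContDiff ℝ ∞ (χ n)) ∧ (∀ n, HasCompactSupport (χ n)) ∧ (∀ n y, |χ n y| ≤ 1) ∧
    (∀ y, Tendsto (fun n => χ n y) atTop (𝓝 1)) ∧
    ∀ n y, ‖fderiv ℝ (χ n) y‖ ≤ C * ((n : ℝ) + 1)⁻¹ := by
  let χ : ContDiffBump (0 : Phase d) := ⟨1, 2, one_pos, one_lt_two⟩
  have hχ : ContDiff ℝ ∞ χ := χ.contDiff
  have hχd : Differentiable ℝ χ := hχ.differentiable (by simp)
  obtain ⟨C, hC⟩ := (χ.hasCompactSupport.fderiv ℝ).exists_bound_of_continuous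
    (hχ.continuous_fderiv (by simp))
  have hn : ∀ n : ℕ, ((n : ℝ) + 1)⁻¹ ≠ 0 := fun n => inv_ne_zero (by positivity)
  refine ⟨fun n y => χ (((n : ℝ) + 1)⁻¹ • y), C, fun n => hχ.comp (contDiff_id.const_smul _),
    fun n => χ.hasCompactSupport.comp_smul (hn n), fun n y => ?_, fun y => ?_, fun n y => ?_⟩
  · rw [abs_of_nonneg χ.nonneg]
    exact χ.le_one
  · refine tendsto_const_nhds.congr' ?_
    have h1 : Tendsto (fun n : ℕ => ((n : ℝ) + 1)⁻¹ • y) atTop (𝓝 ((0 : ℝ) • y)) := by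
      refine Tendsto.smul_const ?_ y
      simpa using tendsto_one_div_add_atTop_nhds_zero_nat (𝕜 := ℝ)
    rw [zero_smul] at h1
    filter_upwards [h1 (Metric.closedBall_mem_nhds (0 : Phase d) one_pos)] with n hmem
    exact (χ.one_of_mem_closedBall hmem).symm
  · have h1 : HasFDerivAt (fun y => χ (((n : ℝ) + 1)⁻¹ • y))
        ((fderiv ℝ χ (((n : ℝ) + 1)⁻¹ • y)).comp
          (((n : ℝ) + 1)⁻¹ • ContinuousLinearMap.id ℝ (Phase d))) y :=
      HasFDerivAt.comp (f := fun y : Phase d => ((n : ℝ) + 1)⁻¹ • y) y (hχd _).hasFDerivAt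
        (((n : ℝ) + 1)⁻¹ • ContinuousLinearMap.id ℝ (Phase d)).hasFDerivAt
    rw [h1.fderiv, ContinuousLinearMap.comp_smul, ContinuousLinearMap.comp_id, norm_smul, mul_comm,
      Real.norm_of_nonneg (by positivity)]
    gcongr
    exact hC _

lemma gradQ_mul {f g : Phase d → ℝ} (hf : Differentiable ℝ f) (hg : Differentiable ℝ g)
    (y : Phase d) : gradQ (fun y => f y * g y) y = f y • gradQ g y + g y • gradQ f y := by
  rw [gradQ_eq (hf.fun_mul hg), gradQ_eq hf, gradQ_eq hg, fderiv_fun_mul (hf y) (hg y),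
    ContinuousLinearMap.add_comp, map_add, ContinuousLinearMap.smul_comp,
    ContinuousLinearMap.smul_comp]
  simp

lemma gradP_mul {f g : Phase d → ℝ} (hf : Differentiable ℝ f) (hg : Differentiable ℝ g)
    (y : Phase d) : gradP (fun y => f y * g y) y = f y • gradP g y + g y • gradP f y := by
  rw [gradP_eq (hf.fun_mul hg), gradP_eq hf, gradP_eq hg, fderiv_fun_mul (hf y) (hg y),
    ContinuousLinearMap.add_comp, map_add, ContinuousLinearMap.smul_comp,
    ContinuousLinearMap.smul_comp]
  simp

lemma State.differentiable (ρ : M.State) : Differentiable ℝ ρ.1 :=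
  ρ.2.contDiff.differentiable (by norm_num)

lemma gradQ_log (ρ : M.State) (y : Phase d) :
    gradQ (fun y => Real.log (ρ.1 y)) y = (ρ.1 y)⁻¹ • gradQ ρ.1 y := by
  have h := ρ.differentiable
  rw [gradQ_eq (h.log fun y => (ρ.2.pos y).ne'), gradQ_eq h,
    fderiv.log (h y) (ρ.2.pos y).ne', ContinuousLinearMap.smul_comp]
  simp

lemma gradP_log (ρ : M.State) (y : Phase d) :
    gradP (fun y => Real.log (ρ.1 y)) y = (ρ.1 y)⁻¹ • gradP ρ.1 y := by
  have h := ρ.differentiable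
  rw [gradP_eq (h.log fun y => (ρ.2.pos y).ne'), gradP_eq h,
    fderiv.log (h y) (ρ.2.pos y).ne', ContinuousLinearMap.smul_comp]
  simp

lemma dEntropy_eq (ρ : M.State) :
    M.dEntropy ρ.1 = fun y => ((fun y => Real.log (ρ.1 y)) + M.dEnergy ρ.1) y + 1 := by
  ext y
  simp only [dEntropy, Pi.add_apply]
  ring

lemma poissonEnergy_mul (ρ : M.State) {f : Phase d → ℝ} (hf : Differentiable ℝ f) (y : Phase d) :
    M.poissonEnergy (fun y => f y * ρ.1 y) ρ.1 y
      = f y * M.poissonEnergy ρ.1 ρ.1 y + M.poissonEnergy f ρ.1 y * ρ.1 y := by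
  simp only [poissonEnergy, gradQ_mul hf ρ.differentiable, gradP_mul hf ρ.differentiable,
    inner_add_right, inner_smul_right]
  ring

/-- The integrand of `⟨L(ρ) dE, dS⟩` is `{ρ, dE}`: the energy part of `dS` drops out. -/
lemma poissonEnergy_state (ρ : M.State) (y : Phase d) :
    (inner ℝ (gradP (M.dEnergy ρ.1) y) (gradQ (M.dEntropy ρ.1) y)
      - inner ℝ (gradQ (M.dEnergy ρ.1) y) (gradP (M.dEntropy ρ.1) y)) * ρ.1 y
      = M.poissonEnergy ρ.1 ρ.1 y := by
  have hl : Differentiable ℝ fun y => Real.log (ρ.1 y) :=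
    ρ.differentiable.log fun y => (ρ.2.pos y).ne'
  have hr := (ρ.2.pos y).ne'
  rw [dEntropy_eq, gradQ_add_const, gradP_add_const, gradQ_add hl (differentiable_dEnergy ρ),
    gradP_add hl (differentiable_dEnergy ρ)]
  simp only [Pi.add_apply, gradQ_log, gradP_log, inner_add_right, inner_smul_right]
  rw [real_inner_comm (gradQ (M.dEnergy ρ.1) y) (gradP (M.dEnergy ρ.1) y)]
  simp only [gradQ_dEnergy, gradP_dEnergy, poissonEnergy]
  field_simp
  ring

/-- `⟨L(ρ) dE(ρ), dS(ρ)⟩ = ∫ {ρ, dE(ρ)} = 0`: the flux `ρ J ∇dE` is integrable, hence its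
divergence has integral zero, by testing with cutoff functions. -/
theorem LdE_dS (ρ : M.State) : LdE ρ (dS ρ) = 0 := by
  have hflux := isFlux_drift ρ
  obtain ⟨χ, C, hχ, hχc, hχ1, hχlim, hχd⟩ := exists_cutoff d
  have hV := continuous_gradient M.contDiff_V
  have hG : Continuous (M.convGrad ρ.1) := (contDiff_convGrad_state ρ).continuous
  have hr := ρ.continuous
  have e1 : LdE ρ (dS ρ) = ∫ y, M.poissonEnergy ρ.1 ρ.1 y := by
    rw [LdE_apply]
    exact integral_congr_ae (Eventually.of_forall (poissonEnergy_state ρ))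
  have hDi : Integrable (M.poissonEnergy ρ.1 ρ.1) := by
    refine (IsFlux.integrable_pair ⟨measurable_gradP (differentiable_dEnergy ρ),
      measurable_gradQ (differentiable_dEnergy ρ), (isHamiltonianFor_dEnergy ρ).growth,
      (isHamiltonianFor_dEnergy ρ).integrable⟩ (dS ρ)).congr
      (Eventually.of_forall (poissonEnergy_state ρ))
  -- `∫ χ_n {ρ, dE}` tends to `∫ {ρ, dE}`; by parts it is `-∫ {χ_n, dE} ρ`, which is `O(1 / n)`.
  have hlim : Tendsto (fun n => ∫ y, χ n y * M.poissonEnergy ρ.1 ρ.1 y) atTop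
      (𝓝 (∫ y, M.poissonEnergy ρ.1 ρ.1 y)) := by
    refine tendsto_integral_of_dominated_convergence (fun y => |M.poissonEnergy ρ.1 ρ.1 y|)
      (fun n => (hχ n).continuous.aestronglyMeasurable.mul hDi.aestronglyMeasurable) hDi.abs
      (fun n => Eventually.of_forall fun y => ?_) (Eventually.of_forall fun y => ?_)
    · rw [norm_mul, Real.norm_eq_abs, Real.norm_eq_abs]
      exact mul_le_of_le_one_left (abs_nonneg _) (hχ1 n y)
    · simpa using (hχlim y).mul_const (M.poissonEnergy ρ.1 ρ.1 y)
  let b : Phase d → ℝ := fun y =>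
    (M.m⁻¹ * ‖y.2‖ + ‖gradient M.V y.1 + M.convGrad ρ.1 y.1‖) * ρ.1 y
  have hb : Integrable b := by
    have h1 : Integrable fun y : Phase d => ‖y.2‖ * ρ.1 y := by
      refine (ρ.2.integrable.add ρ.2.kinetic).mono'
        (Continuous.aestronglyMeasurable (by fun_prop)) (Eventually.of_forall fun y => ?_)
      have hry := (ρ.2.pos y).le
      rw [Real.norm_of_nonneg (by positivity)]
      simp only [Pi.add_apply]
      nlinarith [sq_nonneg (‖y.2‖ - 1), norm_nonneg y.2]
    refine ((h1.const_mul M.m⁻¹).add hflux.integrable).congr (Eventually.of_forall fun y => ?_)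
    simp only [b, Pi.add_apply]
    ring
  have hle : ∀ n y, ‖M.poissonEnergy (χ n) ρ.1 y * ρ.1 y‖ ≤ C * ((n : ℝ) + 1)⁻¹ * b y := by
    intro n y
    have hd : Differentiable ℝ (χ n) := (hχ n).differentiable (by simp)
    have hry := (ρ.2.pos y).le
    have hm := M.m_pos
    have h1 : ‖(inner ℝ (M.m⁻¹ • y.2) (gradQ (χ n) y) : ℝ)‖
        ≤ M.m⁻¹ * ‖y.2‖ * (C * ((n : ℝ) + 1)⁻¹) := by
      refine (norm_inner_le_norm _ _).trans ?_
      rw [norm_smul, Real.norm_of_nonneg (by positivity)]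
      gcongr
      exact (norm_gradQ_le hd y).trans (hχd n y)
    have h2 : ‖(inner ℝ (gradient M.V y.1 + M.convGrad ρ.1 y.1) (gradP (χ n) y) : ℝ)‖
        ≤ ‖gradient M.V y.1 + M.convGrad ρ.1 y.1‖ * (C * ((n : ℝ) + 1)⁻¹) := by
      refine (norm_inner_le_norm _ _).trans ?_
      gcongr
      exact (norm_gradP_le hd y).trans (hχd n y)
    rw [norm_mul, Real.norm_of_nonneg hry, poissonEnergy]
    calc _ ≤ (M.m⁻¹ * ‖y.2‖ * (C * ((n : ℝ) + 1)⁻¹)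
          + ‖gradient M.V y.1 + M.convGrad ρ.1 y.1‖ * (C * ((n : ℝ) + 1)⁻¹)) * ρ.1 y := by
          gcongr
          exact (norm_sub_le _ _).trans (add_le_add h1 h2)
      _ = _ := by simp only [b]; ring
  have hcut : ∀ n, ∫ y, χ n y * M.poissonEnergy ρ.1 ρ.1 y
      = -∫ y, M.poissonEnergy (χ n) ρ.1 y * ρ.1 y := fun n => by
    have hd : Differentiable ℝ (χ n) := (hχ n).differentiable (by simp)
    have h1 := integral_inner_grad_eq_zero (a := fun p => M.m⁻¹ • p)
      (b := fun q => gradient M.V q + M.convGrad ρ.1 q) (by fun_prop) (by fun_prop)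
      (h := fun y => χ n y * ρ.1 y)
      ((contDiff_infty.1 (hχ n) 1).mul (ρ.2.contDiff.of_le (by norm_num))) (hχc n).mul_right
    have i1 : Integrable fun y => χ n y * M.poissonEnergy ρ.1 ρ.1 y :=
      hDi.bdd_mul (c := 1) (hχ n).continuous.aestronglyMeasurable
        (Eventually.of_forall fun y => hχ1 n y)
    have i2 : Integrable fun y => M.poissonEnergy (χ n) ρ.1 y * ρ.1 y := by
      refine (hb.const_mul (C * ((n : ℝ) + 1)⁻¹)).mono' ?_ (Eventually.of_forall (hle n))
      have := continuous_gradQ (contDiff_infty.1 (hχ n) 1)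
      have := continuous_gradP (contDiff_infty.1 (hχ n) 1)
      unfold poissonEnergy
      exact Continuous.aestronglyMeasurable (by fun_prop)
    have h2 : ∫ y, M.poissonEnergy (fun y => χ n y * ρ.1 y) ρ.1 y = 0 := h1
    simp only [poissonEnergy_mul ρ hd] at h2
    rw [integral_add i1 i2] at h2
    linarith
  have hzero : Tendsto (fun n => ∫ y, χ n y * M.poissonEnergy ρ.1 ρ.1 y) atTop (𝓝 0) := by
    refine squeeze_zero_norm (a := fun n : ℕ => C * ((n : ℝ) + 1)⁻¹ * ∫ y, b y) (fun n => ?_) ?_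
    · rw [hcut, norm_neg, ← integral_const_mul]
      exact norm_integral_le_of_norm_le (hb.const_mul _) (Eventually.of_forall (hle n))
    · have h1 : Tendsto (fun n : ℕ => ((n : ℝ) + 1)⁻¹) atTop (𝓝 0) := by
        simpa using tendsto_one_div_add_atTop_nhds_zero_nat (𝕜 := ℝ)
      simpa using (h1.const_mul C).mul_const (∫ y, b y)
  rw [e1]
  exact tendsto_nhds_unique hlim hzero

/-! ### The dissipation potential -/

/-- The function `ξ ↦ ∫ e^{-ξ} 𝒢 e^ξ dρ` on the cotangent space. -/
def meanExpLift (ρ : M.State) (ξ : cot ρ) : ℝ := ∫ y, M.G.expLift ξ.1 y * ρ.1 y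

instance State.isProbabilityMeasure_measure (ρ : M.State) : IsProbabilityMeasure ρ.measure := by
  refine ⟨?_⟩
  rw [State.measure, withDensity_apply _ MeasurableSet.univ, Measure.restrict_univ,
    ← ofReal_integral_eq_lintegral_ofReal ρ.2.integrable
      (Eventually.of_forall fun y => (ρ.2.pos y).le), ρ.2.integral_eq_one, ENNReal.ofReal_one]

/-- On states, the limit Hamiltonian is `ℋ₂(ρ, ξ) = ∫ e^{-ξ} 𝒢 e^ξ dρ`. -/
lemma hamiltonian_eq_meanExpLift {H₂ : Measure (Phase d) → (Phase d → ℝ) → ℝ}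
    (hlim : M.G.HasLimitHamiltonian M.T H₂) (ρ : M.State) (ξ : cot ρ) :
    H₂ ρ.measure ξ.1 = meanExpLift ρ ξ := by
  have hm : Measurable fun y => ENNReal.ofReal (ρ.1 y) :=
    ENNReal.measurable_ofReal.comp ρ.continuous.measurable
  have hlt : ∀ᵐ y : Phase d, ENNReal.ofReal (ρ.1 y) < ⊤ :=
    Eventually.of_forall fun y => ENNReal.ofReal_lt_top
  have hr : ∀ y, (ENNReal.ofReal (ρ.1 y)).toReal = ρ.1 y := fun y =>
    ENNReal.toReal_ofReal (ρ.2.pos y).le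
  have hi : Integrable ξ.1 ρ.measure := by
    refine (integrable_withDensity_iff_integrable_smul' hm hlt).2 ?_
    simpa only [hr, smul_eq_mul, mul_comm] using ξ.2.integrable
  rw [hlim.eq_integral_expLift ρ.measure ξ.2.mem hi, State.measure,
    integral_withDensity_eq_integral_toReal_smul hm hlt, meanExpLift]
  simp only [hr, smul_eq_mul, mul_comm]

lemma dissipation_eq {H₂ : Measure (Phase d) → (Phase d → ℝ) → ℝ}
    (hlim : M.G.HasLimitHamiltonian M.T H₂) (ρ : M.State) (ξ : cot ρ) :
    dissipation H₂ ρ ξ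
      = meanExpLift ρ (ξ + (1 / 2 : ℝ) • dS ρ) - meanExpLift ρ ((1 / 2 : ℝ) • dS ρ) := by
  rw [dissipation, hamiltonian_eq_meanExpLift hlim, hamiltonian_eq_meanExpLift hlim]

lemma meanExpLift_eq_of_add_const {ρ : M.State} {ξ η : cot ρ} {c : ℝ}
    (h : ∀ y, ξ.1 y = η.1 y + c) : meanExpLift ρ ξ = meanExpLift ρ η := by
  rw [meanExpLift, meanExpLift, show ξ.1 = fun y => η.1 y + c from funext h,
    MomentumGenerator.expLift_add_const]

lemma meanExpLift_zero (ρ : M.State) : meanExpLift ρ 0 = 0 := by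
  have h : M.G.expLift (0 : cot ρ).1 = 0 := M.G.expLift_zero
  rw [meanExpLift, h]
  simp

lemma convexOn_meanExpLift (ρ : M.State) : ConvexOn ℝ univ (meanExpLift ρ) := by
  refine ⟨convex_univ, fun ξ _ η _ a b ha hb hab => ?_⟩
  have i := fun ζ : cot ρ => M.T.integrable_expLift ζ.2.mem ρ.2.integrable
  simp only [meanExpLift, smul_eq_mul]
  rw [← integral_const_mul, ← integral_const_mul,
    ← integral_add ((i ξ).const_mul a) ((i η).const_mul b)]
  refine integral_mono (i (a • ξ + b • η)) (((i ξ).const_mul a).add ((i η).const_mul b))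
    fun y => ?_
  have h := MomentumGenerator.expLift_convex (M.T.slice_mem _ ξ.2.mem y.1)
    (M.T.slice_mem _ η.2.mem y.1) ha hb hab
  calc _ ≤ (a * M.G.expLift ξ.1 y + b * M.G.expLift η.1 y) * ρ.1 y :=
        mul_le_mul_of_nonneg_right h (ρ.2.pos y).le
    _ = _ := by ring

lemma adjointG_le_meanExpLift (ρ : M.State) (ξ : cot ρ) : adjointG ρ ξ ≤ meanExpLift ρ ξ :=
  integral_mono (M.T.integrable_lift ξ.2.mem ρ.2.integrable)
    (M.T.integrable_expLift ξ.2.mem ρ.2.integrable) fun y =>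
      mul_le_mul_of_nonneg_right
        (MomentumGenerator.lift_le_expLift (M.T.slice_mem _ ξ.2.mem y.1)) (ρ.2.pos y).le

/-- As a function of the momentum, `e^{-dS(ρ)} ρ` is a multiple of the Maxwellian. -/
lemma State.eq_exp_mul_maxwellian (ρ : M.State) : ∃ c : Conf d → ℝ, ∀ y,
    ρ.1 y = Real.exp (2 * ((1 / 2 : ℝ) • dS ρ : cot ρ).1 y) * c y.1 * maxwellian M.m y.2 := by
  have hm := M.m_pos
  have ha : (√(2 * Real.pi * M.m))⁻¹ ^ d ≠ 0 := by positivity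
  refine ⟨fun q => Real.exp (-1 - M.V q - M.conv ρ.1 q) * ((√(2 * Real.pi * M.m))⁻¹ ^ d)⁻¹,
    fun y => ?_⟩
  have h : ((1 / 2 : ℝ) • dS ρ : cot ρ).1 y = 1 / 2 * M.dEntropy ρ.1 y := rfl
  have e : Real.exp (2 * ((1 / 2 : ℝ) • dS ρ : cot ρ).1 y)
      * Real.exp (-1 - M.V y.1 - M.conv ρ.1 y.1) * Real.exp (-(‖y.2‖ ^ 2 / (2 * M.m)))
      = ρ.1 y := by
    rw [h, ← Real.exp_add, ← Real.exp_add, dEntropy, dEnergy]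
    refine (congrArg Real.exp ?_).trans (Real.exp_log (ρ.2.pos y))
    ring
  -- The normalization of the Maxwellian cancels against the one in `c`.
  rw [← e, maxwellian]
  generalize (√(2 * Real.pi * M.m))⁻¹ ^ d = a at ha
  field_simp

/-- Reversibility of `𝒢` makes `ξ ↦ ∫ e^{-ξ} 𝒢 e^ξ dρ` symmetric about `dS(ρ) / 2`. -/
lemma meanExpLift_neg_add (hrev : M.G.Reversible M.m) (ρ : M.State) (ξ : cot ρ) :
    meanExpLift ρ (-ξ + (1 / 2 : ℝ) • dS ρ) = meanExpLift ρ (ξ + (1 / 2 : ℝ) • dS ρ) := by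
  obtain ⟨c, hc⟩ := ρ.eq_exp_mul_maxwellian
  exact M.T.integral_expLift_neg hrev ξ.2.mem ((1 / 2 : ℝ) • dS ρ : cot ρ).2.mem
    ρ.2.integrable hc

/-- The potential `Ψ*(ρ, ξ) = ∫ e^{-η} 𝒢 e^η dρ - const`, `η = ξ + dS(ρ) / 2`, is convex by the
maximum principle and even by reversibility; duality then holds as `T_ρ` consists of all linear
functionals. -/
theorem symmetricDissipationPotentials_extDissipation
    {H₂ : Measure (Phase d) → (Phase d → ℝ) → ℝ}
    (hrev : M.G.Reversible M.m) (hlim : M.G.HasLimitHamiltonian M.T H₂) :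
    M.extGeometry.SymmetricDissipationPotentials
      (M.extGeometry.legendre (M.extDissipation H₂)) (M.extDissipation H₂) := by
  refine Geometry.symmetricDissipationPotentials_legendre (M := M.extGeometry)
    (fun z ξ => dissipation H₂ z.1 ξ.1) (fun z v => ?_) (fun z => ?_) (fun z ξ => ?_) (fun z => ?_)
    (fun z ξ η => ?_)
  · change (cot z.1 × ℝ) →ₗ[ℝ] ℝ at v
    refine ⟨(v ∘ₗ LinearMap.inl ℝ (cot z.1) ℝ, v (0, 1)), fun ξ => ?_⟩
    change cot z.1 × ℝ at ξ
    change v (ξ.1, 0) + v (0, 1) * ξ.2 = v ξ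
    have h : ξ = (ξ.1, 0) + ξ.2 • ((0, 1) : cot z.1 × ℝ) := by ext1 <;> simp
    rw [h, map_add, map_smul, smul_eq_mul]
    simp [mul_comm]
  · refine ⟨convex_univ, fun ξ _ η _ a b ha hb hab => ?_⟩
    change cot z.1 × ℝ at ξ η
    change dissipation H₂ z.1 (a • ξ.1 + b • η.1)
      ≤ a * dissipation H₂ z.1 ξ.1 + b * dissipation H₂ z.1 η.1
    simp only [dissipation_eq hlim]
    set h := (1 / 2 : ℝ) • dS z.1
    have e : a • ξ.1 + b • η.1 + h = a • (ξ.1 + h) + b • (η.1 + h) := by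
      rw [smul_add, smul_add, add_add_add_comm, ← add_smul, hab, one_smul]
    have hc := (convexOn_meanExpLift z.1).2 (mem_univ (ξ.1 + h)) (mem_univ (η.1 + h)) ha hb hab
    simp only [smul_eq_mul] at hc
    have hb' : b = 1 - a := by linarith
    rw [e]
    refine (sub_le_sub_right hc _).trans (le_of_eq ?_)
    rw [hb']
    ring
  · change cot z.1 × ℝ at ξ
    change dissipation H₂ z.1 (-ξ.1) = dissipation H₂ z.1 ξ.1
    rw [dissipation_eq hlim, dissipation_eq hlim, meanExpLift_neg_add hrev]
  · change dissipation H₂ z.1 0 = 0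
    rw [dissipation_eq hlim, zero_add, sub_self]
  · change cot z.1 × ℝ at ξ η
    change ContDiff ℝ 1 fun t : ℝ => dissipation H₂ z.1 (ξ.1 + t • η.1)
    simp only [dissipation_eq hlim, add_right_comm ξ.1 _ ((1 / 2 : ℝ) • dS z.1)]
    exact (M.T.contDiff_integral_expLift (ξ.1 + (1 / 2 : ℝ) • dS z.1 : cot z.1).2.mem η.1.2.mem
      z.1.2.integrable).sub contDiff_const

/-! ### The GENERIC equation -/

lemma d_extEntropy (z : M.ExtState) : ∃ (ξ : cot z.1) (c : ℝ),
    M.extGeometry.d M.extEntropy z = (ξ, (0 : ℝ)) ∧ ∀ y, ξ.1 y = (dS z.1).1 y + c := by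
  obtain ⟨h2, c, h1⟩ := (hasExtDiff_d (hasExtDiff_extEntropy z)).unique (hasExtDiff_extEntropy z)
  exact ⟨_, c, Prod.ext rfl h2, h1⟩

lemma d_extEnergy (z : M.ExtState) : ∃ (ξ : cot z.1) (c : ℝ),
    M.extGeometry.d M.extEnergy z = (ξ, (1 : ℝ)) ∧ ∀ y, ξ.1 y = (0 : cot z.1).1 y + c := by
  obtain ⟨h2, c, h1⟩ := (hasExtDiff_d (hasExtDiff_extEnergy z)).unique (hasExtDiff_extEnergy z)
  exact ⟨_, c, Prod.ext rfl h2, h1⟩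

lemma field_eq (ρ : M.State) : field ρ = LdE ρ + adjointG ρ := by
  refine congrArg (· + adjointG ρ) (LinearMap.ext fun ξ => ?_)
  rw [LdE_apply]
  simp only [gradQ_dEnergy, gradP_dEnergy]
  rfl

/-- The Legendre transform at `𝒢*(ρ)` is attained at `-dS(ρ) / 2`: the inequality
`∫ 𝒢 η dρ ≤ ∫ e^{-η} 𝒢 e^η dρ` is an equality for `η = 0`. -/
lemma legendre_adjointG {H₂ : Measure (Phase d) → (Phase d → ℝ) → ℝ}
    (hlim : M.G.HasLimitHamiltonian M.T H₂) (z : M.ExtState) :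
    M.extGeometry.legendre (M.extDissipation H₂) z (adjointG z.1, (0 : ℝ))
      = ((meanExpLift z.1 ((1 / 2 : ℝ) • dS z.1) - 1 / 2 * adjointG z.1 (dS z.1) : ℝ) : EReal) := by
  have hpair : ∀ ξ : cot z.1 × ℝ,
      ((M.extGeometry.pair z (adjointG z.1, (0 : ℝ)) ξ : ℝ) : EReal) - M.extDissipation H₂ z ξ
        = ((adjointG z.1 ξ.1 + 0 * ξ.2 - (meanExpLift z.1 (ξ.1 + (1 / 2 : ℝ) • dS z.1)
          - meanExpLift z.1 ((1 / 2 : ℝ) • dS z.1)) : ℝ) : EReal) := fun ξ => by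
    rw [← dissipation_eq hlim, EReal.coe_sub]
    rfl
  refine le_antisymm (iSup_le fun ξ => ?_) (le_iSup_of_le ((-((1 / 2 : ℝ) • dS z.1), 0) :
    cot z.1 × ℝ) ?_)
  · change cot z.1 × ℝ at ξ
    rw [hpair, EReal.coe_le_coe_iff]
    have h := adjointG_le_meanExpLift z.1 (ξ.1 + (1 / 2 : ℝ) • dS z.1)
    rw [map_add, map_smul, smul_eq_mul] at h
    linarith
  · rw [hpair, EReal.coe_le_coe_iff, neg_add_cancel, meanExpLift_zero, map_neg, map_smul,
      smul_eq_mul]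
    linarith

theorem isGENERIC {H₂ : Measure (Phase d) → (Phase d → ℝ) → ℝ}
    (hrev : M.G.Reversible M.m) (hlim : M.G.HasLimitHamiltonian M.T H₂) :
    M.extGeometry.IsGENERIC M.extEntropy M.extEnergy
      (M.extGeometry.legendre (M.extDissipation H₂)) (M.extDissipation H₂) M.extL M.extField where
  entropy_C1 := isExtC1_extEntropy
  energy_C1 := isExtC1_extEnergy
  potentials := symmetricDissipationPotentials_extDissipation hrev hlim
  poisson := isPoisson_extL M
  degeneracy_entropy z := by
    obtain ⟨ξ, c, h, hc⟩ := d_extEntropy z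
    rw [h]
    change ((0 : ℝ) • LdE z.1, -LdE z.1 ξ) = (0, 0)
    rw [LdE_eq_of_add_const hc, LdE_dS, zero_smul, neg_zero]
  degeneracy_energy z ξ α := by
    obtain ⟨η, c, h, hc⟩ := d_extEnergy z
    change cot z.1 × ℝ at ξ
    rw [h]
    change ((dissipation H₂ z.1 (ξ.1 + α • η) : ℝ) : EReal) = ((dissipation H₂ z.1 ξ.1 : ℝ) : EReal)
    rw [dissipation_eq hlim, dissipation_eq hlim]
    refine congrArg (fun x : ℝ => ((x - _ : ℝ) : EReal))
      (meanExpLift_eq_of_add_const (c := α * c) fun y => ?_)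
    have h1 : η.1 y = c := (hc y).trans (zero_add c)
    change ξ.1.1 y + α * η.1 y + ((1 / 2 : ℝ) • dS z.1 : cot z.1).1 y
      = ξ.1.1 y + ((1 / 2 : ℝ) • dS z.1 : cot z.1).1 y + α * c
    rw [h1]
    ring
  equation z := by
    obtain ⟨ξ, c, h, hc⟩ := d_extEntropy z
    obtain ⟨η, c', h', hc'⟩ := d_extEnergy z
    have hv : M.extField z - M.extL z (M.extGeometry.d M.extEnergy z) = (adjointG z.1, (0 : ℝ)) := by
      rw [h']
      change (field z.1 - (1 : ℝ) • LdE z.1, 0 - -LdE z.1 η) = _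
      rw [LdE_eq_of_add_const hc', map_zero, field_eq, one_smul, add_sub_cancel_left, neg_zero,
        sub_zero]
    have hψ : M.extDissipation H₂ z (-((1 / 2 : ℝ) • M.extGeometry.d M.extEntropy z))
        = ((-meanExpLift z.1 ((1 / 2 : ℝ) • dS z.1) : ℝ) : EReal) := by
      rw [h]
      change ((dissipation H₂ z.1 (-((1 / 2 : ℝ) • ξ)) : ℝ) : EReal) = _
      rw [dissipation_eq hlim, meanExpLift_eq_of_add_const (η := 0) (c := -(1 / 2 * c)),
        meanExpLift_zero, zero_sub]
      intro y
      change -(1 / 2 * ξ.1 y) + 1 / 2 * (dS z.1).1 y = 0 + -(1 / 2 * c)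
      rw [hc y]
      ring
    have hp : M.extGeometry.pair z (M.extField z) (M.extGeometry.d M.extEntropy z)
        = adjointG z.1 (dS z.1) := by
      rw [h]
      change field z.1 ξ + 0 * 0 = _
      rw [field_eq, LinearMap.add_apply, LdE_eq_of_add_const hc, LdE_dS,
        adjointG_eq_of_add_const hc]
      ring
    have key := legendre_adjointG hlim z
    rw [hψ, hp]
    refine (congrArg (· + _ + _) ((congrArg _ hv).trans key)).trans ?_
    rw [← EReal.coe_add, ← EReal.coe_add, ← EReal.coe_zero]
    refine congrArg _ ?_
    ring

end Model
end Underdamped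

theorem corollary5p4 {d : ℕ} (M : Underdamped.Model d)
    (H₂ : Measure (Underdamped.Phase d) → (Underdamped.Phase d → ℝ) → ℝ)
    (hrev : M.G.Reversible M.m) (hlim : M.G.HasLimitHamiltonian M.T H₂) :
    (∀ ρ : M.State, Underdamped.Model.HasFunctionalDeriv M.energy ρ (M.dEnergy ρ.1) ∧
      Underdamped.Model.HasFunctionalDeriv M.entropy ρ (M.dEntropy ρ.1)) ∧
    M.extGeometry.IsGENERIC M.extEntropy M.extEnergy
      (M.extGeometry.legendre (M.extDissipation H₂)) (M.extDissipation H₂) M.extL M.extField :=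
  ⟨fun ρ => ⟨Underdamped.Model.hasFunctionalDeriv_energy ρ,
    Underdamped.Model.hasFunctionalDeriv_entropy ρ⟩, Underdamped.Model.isGENERIC hrev hlim⟩

end
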